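/- **Setting.** A *smooth sieving function* is an even, Lipschitz continuous function $E:\mathbb R\to\mathbb R$ with support $[-1,1]$ and $E(0)=1$ that is decreasing on $[0,\infty)$, such that $E$, $E'$ and $E''$ are absolutely continuous and $E'''$ (which exists almost everywhere) is of bounded variation, i.e. agrees almost everywhere with a function of bounded variation on $\mathbb R$. For $\lambda>0$ put $E^\lambda(\nu)=E(\nu/\lambda)$, let $\hat E^\lambda(t)=\int_{\mathbb R}E^\lambda(\nu)e^{-i\nu t}\,d\nu$, and let $$M^\lambda(z)=\frac1\pi\int_0^\infty \hat E^\lambda(t)\,t^{-z}\,dt .$$ For real $c_1<c_2$ and $B>0$ let $L(c,B)=L(c_1,c_2,B)$ be the path consisting of the half-line $\{x=c_1,\ -\infty<y\le -B\}$, the segment from $c_1-iB$ to $c_2-iB$, the segment from $c_2-iB$ to $c_2+iB$, the segment from $c_2+iB$ to $c_1+iB$, and the half-line $\{x=c_1,\ B\le y<\infty\}$ (where $z=x+iy$), traversed in this order with $y$ increasing on the vertical pieces. Write $\int_{L(c,B)}f(z)\,dz$ for $1/(2\pi i)$ times the usual contour integral along this path. **Proposition 4.1.** Let $E$ be a smooth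 sieving function, $\lambda>0$, $\alpha,\beta>0$, $-3/2<c_1<0<c_2<1/2$ and $B>0$. The integral defining $M^\lambda(z)$ converges absolutely and is holomorphic in the strip $-3<\operatorname{Re}z<1$ (so there $M^\lambda$ is the analytic continuation of its restriction to $-1<\operatorname{Re}z<1$), and $$E^\lambda(\alpha-\beta)=\int_{L(c,B)}\Gamma(z)\alpha^{-z}\,dz\int_{L(c,B)}\Gamma(w)\beta^{-w}M^\lambda(z+w)\cos\{\pi(z-w)/2\}\,dw ,$$ where the inner integral converges absolutely for every $z\in L(c,B)$ and the double integral converges absolutely, i.e. its integrand is integrable on $L(c,B)\times L(c,B)$ with respect to the product of the arc length measures. -/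

import Mathlib

open MeasureTheory Set

noncomputable section

/-- A real function is (locally) absolutely continuous: it is absolutely continuous on every
compact interval. -/
def IsAbsolutelyContinuous (f : ℝ → ℝ) : Prop :=
  ∀ a b : ℝ, AbsolutelyContinuousOnInterval f a b

/-- Smooth basic sieving functions: `E` is even, Lipschitz, decreasing on `[0, ∞)`, has support
`[-1, 1]` and `E 0 = 1`; moreover `E`, `E'`, `E''` are absolutely continuous and `E'''`, which is
then defined almost everywhere, is of bounded variation, i.e. it agrees almost everywhere with a
function of bounded variation on the line. -/
structure IsSmoothSieving (E : ℝ → ℝ) : Prop where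
  even : ∀ x, E (-x) = E x
  support : tsupport E = Icc (-1) 1
  lipschitz : ∃ K, LipschitzWith K E
  decreasing : AntitoneOn E (Ici 0)
  map_zero : E 0 = 1
  absCont : IsAbsolutelyContinuous E
  absCont_deriv : IsAbsolutelyContinuous (deriv E)
  absCont_deriv_two : IsAbsolutelyContinuous (deriv (deriv E))
  boundedVariation : ∃ g : ℝ → ℝ, BoundedVariationOn g univ ∧
    deriv (deriv (deriv E)) =ᵐ[volume] g

/-- The scaled sieving function `E^lam(ν) = E(ν / lam)`. -/
def sieve (E : ℝ → ℝ) (lam : ℝ) (ν : ℝ) : ℝ := E (ν / lam)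

/-- The Fourier transform `∫ E^lam(ν) exp(-iνt) dν` of the scaled sieving function. -/
def sieveFourier (E : ℝ → ℝ) (lam : ℝ) (t : ℝ) : ℂ :=
  ∫ ν : ℝ, (sieve E lam ν : ℂ) * Complex.exp (-(Complex.I * ν * t))

/-- The Mellin transform `M^lam(z) = (1/π) ∫₀^∞ Ê^lam(t) t^(-z) dt`. For smooth sieving functions
`Ê^lam(t)` is `O(t⁻⁴)`, so this integral still converges absolutely in the strip
`-3 < Re z < 1`, where it is therefore the analytic continuation of its restriction to
`-1 < Re z < 1` (this is part of the conclusion of the theorem). -/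
def sieveMellin (E : ℝ → ℝ) (lam : ℝ) (z : ℂ) : ℂ :=
  (1 / Real.pi : ℂ) * ∫ t in Ioi (0 : ℝ), sieveFourier E lam t * (t : ℂ) ^ (-z)

/-- The contour integral `(1/2πi) ∫ f(z) dz` over the path that consists of the half-line
`{x = c₁, -∞ < y ≤ -B}`, the segment from `c₁ - iB` to `c₂ - iB`, the segment from `c₂ - iB` to
`c₂ + iB`, the segment from `c₂ + iB` to `c₁ + iB`, and the half-line
`{x = c₁, B ≤ y < ∞}`. -/
def bentLineIntegral (c₁ c₂ B : ℝ) (f : ℂ → ℂ) : ℂ :=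
  (1 / (2 * Real.pi * Complex.I) : ℂ) *
    ((∫ y in Iic (-B), f (c₁ + y * Complex.I) * Complex.I)
      + (∫ x in c₁..c₂, f (x - B * Complex.I))
      + (∫ y in (-B)..B, f (c₂ + y * Complex.I) * Complex.I)
      + (∫ x in c₂..c₁, f (x + B * Complex.I))
      + (∫ y in Ici B, f (c₁ + y * Complex.I) * Complex.I))

/-- The set of points of the path. -/
def bentLine (c₁ c₂ B : ℝ) : Set ℂ :=
  {z | (z.re = c₁ ∧ B ≤ |z.im|) ∨ (z.re ∈ Icc c₁ c₂ ∧ |z.im| = B) ∨ (z.re = c₂ ∧ |z.im| ≤ B)}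

/-- The arc length measure `|dz|` on the path, as the sum of its five pieces. -/
def bentLineMeasure (c₁ c₂ B : ℝ) : Measure ℂ :=
  (volume.restrict (Iic (-B))).map (fun y : ℝ => (c₁ + y * Complex.I : ℂ))
    + (volume.restrict (Icc c₁ c₂)).map (fun x : ℝ => (x - B * Complex.I : ℂ))
    + (volume.restrict (Icc (-B) B)).map (fun y : ℝ => (c₂ + y * Complex.I : ℂ))
    + (volume.restrict (Icc c₁ c₂)).map (fun x : ℝ => (x + B * Complex.I : ℂ))
    + (volume.restrict (Ici B)).map (fun y : ℝ => (c₁ + y * Complex.I : ℂ))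

end

/-! Fourier inversion and evenness give E^λ(α-β) = (1/π) ∫₀^∞ Ê^λ(t) cos((α-β)t) dt, and the cosine
is half the sum of e^{iαt}e^{-iβt} and its conjugate. Replacing every exponential by the
Mellin-Barnes integral e^{-s} = ∫_L Γ(z) s^{-z} dz and integrating over t first turns the t-integral
into M^λ(z+w), while the powers of ±i combine to cos(π(z-w)/2).

For imaginary s the decay e^{-π|y|/2} of Γ is cancelled exactly by |s^{-z}|, and only the power
(1+|y|)^{c₁-1/2} remains, which need not be integrable. Hence ±i is first replaced by ε±i with ε >
0: then |arg s| < π/2, everything converges exponentially, and Fubini on L × L × (0,∞) applies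
(`IsDecayingTransform.integral_mul_exp_mul_exp`). Dominated convergence as ε → 0
(`IsDecayingTransform.limit_identity`) then yields the formula.

The majorant needs decay of M^λ(z+w) in Im(z+w). Three integrations by parts and the bounded
variation of E''' show that Ê^λ and its first two derivatives are O(t⁻⁴)
(`IsSmoothSieving.fourierDecay`), so up to two integrations by parts in the Mellin integral are
possible, depending on how far left Re(z+w) ≥ 2c₁ lies. In each range of c₁, AM-GM bounds the
product of Gamma factors and M^λ by an integrable sum of pairwise products
(`IsDecayingTransform.exists_bracketTriple_le`). -/

/-! ### Upper bounds of Stirling type for the Gamma function -/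

/-- On the line `Re z = 1/2` the Gamma function decays like `exp (-π |Im z| / 2)`. -/
theorem norm_Gamma_half_le (z : ℂ) (hz : z.re = 1 / 2) :
    ‖Complex.Gamma z‖ * Real.exp (Real.pi / 2 * |z.im|) ≤ Real.sqrt (2 * Real.pi) := by
  have hzz : z = 1 / 2 + z.im * Complex.I := by
    apply Complex.ext <;> simp [hz]
  have h1 : 1 - z = (starRingEnd ℂ) z := by
    apply Complex.ext <;> simp [hz]; norm_num
  have h2 := Complex.Gamma_mul_Gamma_one_sub z
  rw [h1, Complex.Gamma_conj, Complex.mul_conj] at h2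
  have h3 : Complex.sin (Real.pi * z) = Real.cosh (Real.pi * z.im) := by
    conv_lhs => rw [hzz]
    rw [show (Real.pi : ℂ) * (1 / 2 + z.im * Complex.I)
      = ((Real.pi * z.im : ℝ) : ℂ) * Complex.I + Real.pi / 2 by push_cast; ring,
      Complex.sin_add_pi_div_two, Complex.cos_mul_I, Complex.ofReal_cosh]
  rw [h3] at h2
  have h4 : Complex.normSq (Complex.Gamma z) = Real.pi / Real.cosh (Real.pi * z.im) := by
    exact_mod_cast h2
  rw [Complex.normSq_eq_norm_sq] at h4
  have h5 : Real.exp (Real.pi * |z.im|) ≤ 2 * Real.cosh (Real.pi * z.im) := by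
    rw [← Real.cosh_abs, abs_mul, abs_of_pos Real.pi_pos, Real.cosh_eq]
    have := Real.exp_pos (-(Real.pi * |z.im|))
    linarith
  apply Real.le_sqrt_of_sq_le
  rw [mul_pow, h4, ← Real.exp_nat_mul, div_mul_eq_mul_div, div_le_iff₀ (Real.cosh_pos _)]
  have : ((2 : ℕ) : ℝ) * (Real.pi / 2 * |z.im|) = Real.pi * |z.im| := by push_cast; ring
  rw [this]
  nlinarith [Real.pi_pos]

theorem norm_Gamma_le_Gamma_re (z : ℂ) (hz : 0 < z.re) :
    ‖Complex.Gamma z‖ ≤ Real.Gamma z.re := by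
  rw [Complex.Gamma_eq_integral hz, Real.Gamma_eq_integral hz, Complex.GammaIntegral]
  refine (norm_integral_le_integral_norm _).trans (le_of_eq ?_)
  refine setIntegral_congr_fun measurableSet_Ioi fun t ht => ?_
  simp only [norm_mul]
  rw [Complex.norm_cpow_eq_rpow_re_of_pos ht]
  simp [Complex.norm_exp]

/-- Phragmén-Lindelöf in a strip of width 2: the left edge is controlled by the reflection formula,
the right edge by the functional equation applied twice. The signed exponent σ·Im z replaces |Im z|
because e^{σπy/2} is the modulus of a holomorphic function. -/
theorem norm_Gamma_strip_signed : ∃ C : ℝ, ∀ σ : ℝ, |σ| ≤ 1 → ∀ z : ℂ, 1 / 2 ≤ z.re →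
    z.re ≤ 5 / 2 → ‖Complex.Gamma z‖ * Real.exp (σ * (Real.pi / 2 * z.im)) ≤
      C * (1 + |z.im|) ^ (z.re - 1 / 2) := by
  set K : ℝ := 8 * Real.sqrt (2 * Real.pi) * Real.exp (25 / 4) with hK
  refine ⟨K, fun σ hσ z₀ h1 h2 => ?_⟩
  set A : ℝ := 1 + |z₀.im| with hA
  have hA1 : 1 ≤ A := by have := abs_nonneg z₀.im; linarith
  have hA0 : 0 < A := by linarith
  -- The auxiliary function depends on the target point z₀. The Gaussian factor is at least 1 in
  -- modulus at z₀ and absorbs powers of Im z - Im z₀ on the edges; A^{-z} balances the growth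
  -- exponents 0 and 2 of the two edges.
  let F : ℂ → ℂ := fun z => Complex.Gamma z * Complex.exp (-(Complex.I * σ * (Real.pi / 2) * z)) *
    Complex.exp ((z - z₀.im * Complex.I) ^ 2) * (A : ℂ) ^ (-z)
  have hFn : ∀ z, ‖F z‖ = ‖Complex.Gamma z‖ * Real.exp (σ * (Real.pi / 2 * z.im)) *
      Real.exp (z.re ^ 2 - (z.im - z₀.im) ^ 2) * A ^ (-z.re) := by
    intro z
    simp only [F, norm_mul, Complex.norm_exp, Complex.norm_cpow_eq_rpow_re_of_pos hA0]
    congr 1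
    · congr 1
      · congr 2
        simp [Complex.mul_re, Complex.mul_im]
        ring
      · congr 1
        simp [sq, Complex.mul_re]
  have hsig : ∀ z : ℂ, Real.exp (σ * (Real.pi / 2 * z.im)) ≤ Real.exp (Real.pi / 2 * |z.im|) := by
    intro z
    apply Real.exp_le_exp.2
    calc σ * (Real.pi / 2 * z.im) ≤ |σ * (Real.pi / 2 * z.im)| := le_abs_self _
      _ = |σ| * (Real.pi / 2 * |z.im|) := by
        rw [abs_mul, abs_mul, abs_of_pos Real.pi_div_two_pos]
      _ ≤ 1 * (Real.pi / 2 * |z.im|) := by gcongr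
      _ = _ := one_mul _
  have hGd : ∀ z : ℂ, 0 < z.re → DifferentiableAt ℂ F z := by
    intro z hz
    have hg : DifferentiableAt ℂ Complex.Gamma z := by
      apply Complex.differentiableAt_Gamma
      intro m hm
      rw [hm] at hz
      simp at hz
      have : (0 : ℝ) ≤ m := by positivity
      linarith
    have hAc : (A : ℂ) ≠ 0 := by exact_mod_cast hA0.ne'
    have hp : DifferentiableAt ℂ (fun z : ℂ => (A : ℂ) ^ (-z)) z :=
      differentiableAt_id.neg.const_cpow (Or.inl hAc)
    exact ((hg.mul (by fun_prop)).mul (by fun_prop)).mul hp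
  have hcl : closure (Complex.re ⁻¹' Ioo (1 / 2 : ℝ) (5 / 2)) ⊆ {z : ℂ | 0 < z.re} := by
    have : closure (Complex.re ⁻¹' Ioo (1 / 2 : ℝ) (5 / 2)) ⊆ Complex.re ⁻¹' Icc (1 / 2 : ℝ) (5 / 2) :=
      closure_minimal (preimage_mono Ioo_subset_Icc_self) (isClosed_Icc.preimage Complex.continuous_re)
    intro z hz
    have := (this hz).1
    show 0 < z.re
    linarith
  have hd : DiffContOnCl ℂ F (Complex.re ⁻¹' Ioo (1 / 2 : ℝ) (5 / 2)) :=
    DifferentiableOn.diffContOnCl fun z hz => (hGd z (hcl hz)).differentiableWithinAt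
  have hbound : ‖F z₀‖ ≤ K * A ^ (-(1 / 2) : ℝ) := by
    refine PhragmenLindelof.vertical_strip hd ?_ ?_ ?_ h1 h2
    · obtain ⟨G, hG⟩ := isCompact_Icc.exists_bound_of_continuousOn
        (f := Real.Gamma) (s := Icc (1 / 2 : ℝ) (5 / 2)) (fun x hx => by
          apply ContinuousAt.continuousWithinAt
          apply (Real.differentiableAt_Gamma _).continuousAt
          intro m hm
          have : (0 : ℝ) ≤ m := by positivity
          linarith [hx.1])
      -- The strip has width 2, so every rate below π/2 is admissible; the rate 1 suffices.
      refine ⟨1, ?_, 2, ?_⟩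
      · norm_num
        linarith [Real.pi_gt_three]
      · refine Asymptotics.IsBigO.of_bound (G * Real.exp (25 / 4)) ?_
        rw [Filter.eventually_inf_principal]
        refine Filter.Eventually.of_forall fun z hz => ?_
        have hz1 : 1 / 2 < z.re := hz.1
        have hz2 : z.re < 5 / 2 := hz.2
        have e1 : ‖Complex.Gamma z‖ ≤ G :=
          (norm_Gamma_le_Gamma_re z (by linarith)).trans
            ((le_abs_self _).trans (hG z.re ⟨hz1.le, hz2.le⟩))
        have hG0 : 0 ≤ G := (norm_nonneg _).trans e1
        have e2 : Real.exp (z.re ^ 2 - (z.im - z₀.im) ^ 2) ≤ Real.exp (25 / 4) := by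
          apply Real.exp_le_exp.2
          nlinarith [sq_nonneg (z.im - z₀.im)]
        have e3 : A ^ (-z.re) ≤ 1 := Real.rpow_le_one_of_one_le_of_nonpos hA1 (by linarith)
        have e4 : Real.exp (σ * (Real.pi / 2 * z.im)) ≤ Real.exp (2 * Real.exp (1 * |z.im|)) := by
          refine (hsig z).trans (Real.exp_le_exp.2 ?_)
          have := Real.add_one_le_exp (1 * |z.im|)
          nlinarith [Real.pi_le_four, abs_nonneg z.im]
        rw [hFn, Real.norm_of_nonneg (Real.exp_pos _).le]
        calc _ ≤ G * Real.exp (2 * Real.exp (1 * |z.im|)) * Real.exp (25 / 4) * 1 := by gcongr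
          _ = _ := by ring
    · intro z hz
      rw [hFn, hz]
      have e1 := norm_Gamma_half_le z hz
      have e2 : Real.exp ((1 / 2 : ℝ) ^ 2 - (z.im - z₀.im) ^ 2) ≤ Real.exp (25 / 4) := by
        apply Real.exp_le_exp.2
        nlinarith [sq_nonneg (z.im - z₀.im)]
      have e3 : ‖Complex.Gamma z‖ * Real.exp (σ * (Real.pi / 2 * z.im)) ≤ Real.sqrt (2 * Real.pi) :=
        (mul_le_mul_of_nonneg_left (hsig z) (norm_nonneg _)).trans e1
      gcongr
      rw [hK]
      have := Real.sqrt_nonneg (2 * Real.pi)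
      have := Real.exp_pos (25 / 4)
      calc _ ≤ Real.sqrt (2 * Real.pi) * Real.exp (25 / 4) := by gcongr
        _ ≤ _ := by nlinarith [mul_nonneg (Real.sqrt_nonneg (2 * Real.pi)) (Real.exp_pos (25 / 4)).le]
    · intro z hz
      rw [hFn, hz]
      -- The factors z - 1 and z - 2 of the functional equation are at most 2A(1+d) each; A² is
      -- absorbed by A^{-5/2}, and (1+d)² by the Gaussian e^{-d²}.
      set d := |z.im - z₀.im| with hdd
      have hd0 : 0 ≤ d := abs_nonneg _
      have hw : (z - 2).re = 1 / 2 := by simp [hz]; norm_num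
      have e1 := norm_Gamma_half_le (z - 2) hw
      have him : (z - 2).im = z.im := by simp
      rw [him] at e1
      have hne1 : z - 2 ≠ 0 := fun h => by rw [h] at hw; norm_num at hw
      have hne2 : z - 1 ≠ 0 := fun h => by
        have : z.re = 1 := by rw [sub_eq_zero.1 h]; simp
        rw [hz] at this; norm_num at this
      have hg : Complex.Gamma z = (z - 1) * ((z - 2) * Complex.Gamma (z - 2)) := by
        rw [← Complex.Gamma_add_one _ hne1, show z - 2 + 1 = z - 1 by ring,
          ← Complex.Gamma_add_one _ hne2]
        ring_nf
      have t1 : ‖z - 1‖ ≤ 2 * A * (1 + d) := by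
        have h := Complex.norm_le_abs_re_add_abs_im (z - 1)
        have hr : (z - 1).re = 3 / 2 := by simp [hz]; norm_num
        have hi : (z - 1).im = z.im := by simp
        rw [hr, hi] at h
        have h' : |z.im| ≤ d + |z₀.im| := by
          have := abs_add_le (z.im - z₀.im) z₀.im
          simpa using this
        have : |(3 / 2 : ℝ)| = 3 / 2 := abs_of_pos (by norm_num)
        nlinarith [abs_nonneg z₀.im, mul_nonneg hd0 (abs_nonneg z₀.im)]
      have t2 : ‖z - 2‖ ≤ 2 * A * (1 + d) := by
        have h := Complex.norm_le_abs_re_add_abs_im (z - 2)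
        rw [hw, him] at h
        have h' : |z.im| ≤ d + |z₀.im| := by
          have := abs_add_le (z.im - z₀.im) z₀.im
          simpa using this
        have : |(1 / 2 : ℝ)| = 1 / 2 := abs_of_pos (by norm_num)
        nlinarith [abs_nonneg z₀.im, mul_nonneg hd0 (abs_nonneg z₀.im)]
      have e3 : ‖Complex.Gamma (z - 2)‖ * Real.exp (σ * (Real.pi / 2 * z.im))
          ≤ Real.sqrt (2 * Real.pi) :=
        (mul_le_mul_of_nonneg_left (hsig z) (norm_nonneg _)).trans e1
      have e4 : (1 + d) ^ 2 * Real.exp (-d ^ 2) ≤ 2 := by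
        rw [Real.exp_neg, ← div_eq_mul_inv, div_le_iff₀ (Real.exp_pos _)]
        have := Real.add_one_le_exp (d ^ 2)
        nlinarith [sq_nonneg (d - 1)]
      have e5 : A ^ (-(5 / 2) : ℝ) = A ^ (-(1 / 2) : ℝ) * (A ^ 2)⁻¹ := by
        rw [show (-(5 / 2) : ℝ) = -(1 / 2) + -(2 : ℕ) by norm_num, Real.rpow_add hA0,
          Real.rpow_neg hA0.le (2 : ℕ), Real.rpow_natCast]
      have e6 : Real.exp ((5 / 2 : ℝ) ^ 2 - (z.im - z₀.im) ^ 2) =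
          Real.exp (25 / 4) * Real.exp (-d ^ 2) := by
        rw [← Real.exp_add, hdd, sq_abs]; ring_nf
      have hsq : 0 ≤ A ^ (-(1 / 2) : ℝ) := Real.rpow_nonneg hA0.le _
      rw [hg, norm_mul, norm_mul, e5, e6]
      calc ‖z - 1‖ * (‖z - 2‖ * ‖Complex.Gamma (z - 2)‖) * Real.exp (σ * (Real.pi / 2 * z.im)) *
            (Real.exp (25 / 4) * Real.exp (-d ^ 2)) * (A ^ (-(1 / 2) : ℝ) * (A ^ 2)⁻¹)
          = ‖z - 1‖ * ‖z - 2‖ * (‖Complex.Gamma (z - 2)‖ * Real.exp (σ * (Real.pi / 2 * z.im))) *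
            (Real.exp (25 / 4) * Real.exp (-d ^ 2)) * (A ^ (-(1 / 2) : ℝ) * (A ^ 2)⁻¹) := by ring
        _ ≤ (2 * A * (1 + d)) * (2 * A * (1 + d)) * Real.sqrt (2 * Real.pi) *
            (Real.exp (25 / 4) * Real.exp (-d ^ 2)) * (A ^ (-(1 / 2) : ℝ) * (A ^ 2)⁻¹) := by
          gcongr
        _ = 4 * Real.sqrt (2 * Real.pi) * Real.exp (25 / 4) * A ^ (-(1 / 2) : ℝ) *
            ((1 + d) ^ 2 * Real.exp (-d ^ 2)) := by field_simp; ring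
        _ ≤ 4 * Real.sqrt (2 * Real.pi) * Real.exp (25 / 4) * A ^ (-(1 / 2) : ℝ) * 2 := by gcongr
        _ = _ := by rw [hK]; ring
  rw [hFn] at hbound
  have e1 : (1 : ℝ) ≤ Real.exp (z₀.re ^ 2 - (z₀.im - z₀.im) ^ 2) := by
    apply Real.one_le_exp; nlinarith [sq_nonneg z₀.re]
  set g := ‖Complex.Gamma z₀‖ * Real.exp (σ * (Real.pi / 2 * z₀.im)) with hg
  have hg0 : 0 ≤ g := by positivity
  have e2 : A ^ (z₀.re - 1 / 2) = A ^ (-(1 / 2) : ℝ) * A ^ z₀.re := by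
    rw [← Real.rpow_add hA0]; ring_nf
  have e3 : A ^ (-z₀.re) * A ^ z₀.re = 1 := by
    rw [← Real.rpow_add hA0]; simp
  have hp : 0 ≤ A ^ (-z₀.re) := Real.rpow_nonneg hA0.le _
  have hp' : 0 ≤ A ^ z₀.re := Real.rpow_nonneg hA0.le _
  calc g = g * 1 * A ^ (-z₀.re) * A ^ z₀.re := by rw [mul_assoc, e3]; ring
    _ ≤ g * Real.exp (z₀.re ^ 2 - (z₀.im - z₀.im) ^ 2) * A ^ (-z₀.re) * A ^ z₀.re := by gcongr
    _ ≤ K * A ^ (-(1 / 2) : ℝ) * A ^ z₀.re := by gcongr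
    _ = _ := by rw [e2]; ring

/-- The signed bound is used with σ equal to the sign of Im z. -/
theorem norm_Gamma_mul_exp_le_of_half_le : ∃ C : ℝ, 0 ≤ C ∧ ∀ z : ℂ, 1 / 2 ≤ z.re →
    z.re ≤ 5 / 2 → ‖Complex.Gamma z‖ * Real.exp (Real.pi / 2 * |z.im|) ≤
      C * (1 + |z.im|) ^ (z.re - 1 / 2) := by
  obtain ⟨C, hC⟩ := norm_Gamma_strip_signed
  have key : ∀ z : ℂ, 1 / 2 ≤ z.re →
    z.re ≤ 5 / 2 → ‖Complex.Gamma z‖ * Real.exp (Real.pi / 2 * |z.im|) ≤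
      C * (1 + |z.im|) ^ (z.re - 1 / 2) := by
    intro z h1 h2
    rcases le_total 0 z.im with h | h
    · have := hC 1 (by simp) z h1 h2
      rw [one_mul] at this
      rwa [abs_of_nonneg h] at this ⊢
    · have := hC (-1) (by simp) z h1 h2
      rw [neg_one_mul, ← mul_neg] at this
      rwa [abs_of_nonpos h] at this ⊢
  refine ⟨C, ?_, key⟩
  have := key 1 (by norm_num) (by norm_num)
  simp at this
  linarith

/-- Stirling type upper bound for the Gamma function to the left of the line `Re z = 1/2`. -/
theorem norm_Gamma_mul_exp_le {B : ℝ} (hB : 0 < B) : ∃ C : ℝ, 0 ≤ C ∧ ∀ z : ℂ, -3 / 2 ≤ z.re →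
    z.re ≤ 1 / 2 → B ≤ |z.im| → ‖Complex.Gamma z‖ * Real.exp (Real.pi / 2 * |z.im|) ≤
      C * (1 + |z.im|) ^ (z.re - 1 / 2) := by
  obtain ⟨C, hC0, hC⟩ := norm_Gamma_mul_exp_le_of_half_le
  -- Γ(z+2) = (z+1) z Γ(z), and |Im z| ≥ B makes both |z| and |z+1| at least B/(1+B) times 1+|Im z|.
  refine ⟨C * ((1 + B) / B) ^ 2, by positivity, fun z h1 h2 h3 => ?_⟩
  have him : (z + 2).im = z.im := by simp
  have hre : (z + 2).re = z.re + 2 := by simp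
  have h := hC (z + 2) (by rw [hre]; linarith) (by rw [hre]; linarith)
  rw [him, hre] at h
  have hy : 0 < |z.im| := by linarith
  have hne1 : z ≠ 0 := fun h => by rw [h] at hy; simp at hy
  have hne2 : z + 1 ≠ 0 := fun h => by
    rw [eq_neg_of_add_eq_zero_left h] at hy; simp at hy
  have hg : Complex.Gamma (z + 2) = (z + 1) * (z * Complex.Gamma z) := by
    rw [← Complex.Gamma_add_one _ hne1, ← Complex.Gamma_add_one _ hne2]
    ring_nf
  set Y := 1 + |z.im| with hY
  have hY0 : 0 < Y := by linarith
  have b1 : B / (1 + B) * Y ≤ ‖z‖ := by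
    refine le_trans ?_ (Complex.abs_im_le_norm z)
    rw [div_mul_eq_mul_div, div_le_iff₀ (by linarith)]
    nlinarith
  have b2 : B / (1 + B) * Y ≤ ‖z + 1‖ := by
    refine le_trans ?_ (Complex.abs_im_le_norm (z + 1))
    rw [show (z + 1).im = z.im by simp, div_mul_eq_mul_div, div_le_iff₀ (by linarith)]
    nlinarith
  rw [hg, norm_mul, norm_mul] at h
  have e : Y ^ (z.re + 2 - 1 / 2) = Y ^ (z.re - 1 / 2) * Y ^ 2 := by
    rw [← Real.rpow_natCast Y 2, ← Real.rpow_add hY0]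
    congr 1; push_cast; ring
  rw [e] at h
  set g := ‖Complex.Gamma z‖ * Real.exp (Real.pi / 2 * |z.im|) with hgd
  have hg0 : 0 ≤ g := by positivity
  have h5 : (B / (1 + B) * Y) * (B / (1 + B) * Y) * g ≤ C * (Y ^ (z.re - 1 / 2) * Y ^ 2) := by
    calc _ ≤ ‖z + 1‖ * ‖z‖ * g := by gcongr
      _ = ‖z + 1‖ * (‖z‖ * ‖Complex.Gamma z‖) * Real.exp (Real.pi / 2 * |z.im|) := by
        rw [hgd]; ring
      _ ≤ _ := h
  have h6 : g = (((1 + B) / B) ^ 2 * (Y ^ 2)⁻¹) * ((B / (1 + B) * Y) * (B / (1 + B) * Y) * g) := by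
    field_simp
  rw [h6]
  calc _ ≤ (((1 + B) / B) ^ 2 * (Y ^ 2)⁻¹) * (C * (Y ^ (z.re - 1 / 2) * Y ^ 2)) := by gcongr
    _ = _ := by field_simp

/-! ### Bracket powers and their integrability along the path -/

/-- The Japanese bracket power `(1 + |y|) ^ (-r)`. -/
noncomputable def bracket (r y : ℝ) : ℝ := (1 + |y|) ^ (-r)

theorem bracket_pos (r y : ℝ) : 0 < bracket r y := Real.rpow_pos_of_pos (by positivity) _

theorem bracket_nonneg (r y : ℝ) : 0 ≤ bracket r y := (bracket_pos r y).le

theorem bracket_le_one {r : ℝ} (hr : 0 ≤ r) (y : ℝ) : bracket r y ≤ 1 :=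
  Real.rpow_le_one_of_one_le_of_nonpos (by have := abs_nonneg y; linarith) (by linarith)

theorem continuous_bracket (r : ℝ) : Continuous (bracket r) := by
  unfold bracket
  exact (continuous_const.add continuous_abs).rpow_const fun y => Or.inl
    (show (0 : ℝ) < 1 + |y| by positivity).ne'

theorem bracket_anti {r s : ℝ} (h : r ≤ s) (y : ℝ) : bracket s y ≤ bracket r y :=
  Real.rpow_le_rpow_of_exponent_le (by have := abs_nonneg y; linarith) (by linarith)

theorem bracket_add (r s y : ℝ) : bracket (r + s) y = bracket r y * bracket s y := by
  unfold bracket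
  rw [← Real.rpow_add (by positivity)]
  ring_nf

theorem lintegral_bracket_lt_top {r : ℝ} (hr : 1 < r) (s : ℝ) :
    ∫⁻ y : ℝ, ENNReal.ofReal (bracket r (y + s)) < ⊤ := by
  rw [lintegral_add_right_eq_self (fun y => ENNReal.ofReal (bracket r y)) s]
  exact finite_integral_one_add_norm (E := ℝ) (by simpa using hr)

theorem measurableSet_bentLine (c₁ c₂ B : ℝ) : MeasurableSet (bentLine c₁ c₂ B) := by
  have h1 : Measurable fun z : ℂ => |z.im| := Complex.measurable_im.abs
  refine ((measurableSet_eq_fun Complex.measurable_re measurable_const).inter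
    (measurableSet_le measurable_const h1)).union
    (((measurableSet_Icc.preimage Complex.measurable_re).inter
    (measurableSet_eq_fun h1 measurable_const)).union ?_)
  exact (measurableSet_eq_fun Complex.measurable_re measurable_const).inter
    (measurableSet_le h1 measurable_const)

instance sFinite_bentLineMeasure (c₁ c₂ B : ℝ) : SFinite (bentLineMeasure c₁ c₂ B) := by
  unfold bentLineMeasure
  infer_instance

theorem measurable_vertical (c : ℂ) : Measurable fun y : ℝ => c + y * Complex.I :=
  (Continuous.measurable (by fun_prop))

theorem measurable_horizontal (c : ℂ) : Measurable fun x : ℝ => x + c * Complex.I :=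
  (Continuous.measurable (by fun_prop))

theorem measurable_horizontal' (c : ℂ) : Measurable fun x : ℝ => x - c * Complex.I :=
  (Continuous.measurable (by fun_prop))

theorem lintegral_bentLineMeasure (c₁ c₂ B : ℝ) {q : ℂ → ENNReal} (hq : Measurable q) :
    ∫⁻ z, q z ∂(bentLineMeasure c₁ c₂ B) =
      (∫⁻ y in Iic (-B), q (c₁ + y * Complex.I)) + (∫⁻ x in Icc c₁ c₂, q (x - B * Complex.I))
      + (∫⁻ y in Icc (-B) B, q (c₂ + y * Complex.I))
      + (∫⁻ x in Icc c₁ c₂, q (x + B * Complex.I))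
      + (∫⁻ y in Ici B, q (c₁ + y * Complex.I)) := by
  unfold bentLineMeasure
  rw [lintegral_add_measure, lintegral_add_measure, lintegral_add_measure, lintegral_add_measure,
    lintegral_map hq (measurable_vertical _), lintegral_map hq (measurable_vertical _),
    lintegral_map hq (measurable_vertical _), lintegral_map hq (measurable_horizontal _),
    lintegral_map hq (measurable_horizontal' _)]

theorem ae_mem_bentLine {c₁ c₂ B : ℝ} (hB : 0 ≤ B) :
    ∀ᵐ z ∂(bentLineMeasure c₁ c₂ B), z ∈ bentLine c₁ c₂ B := by
  have hm := measurableSet_bentLine c₁ c₂ B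
  unfold bentLineMeasure
  simp only [ae_add_measure_iff]
  refine ⟨⟨⟨⟨?_, ?_⟩, ?_⟩, ?_⟩, ?_⟩
  · rw [ae_map_iff (p := fun z => z ∈ bentLine c₁ c₂ B) (measurable_vertical _).aemeasurable hm,
    ae_restrict_iff' measurableSet_Iic]
    refine .of_forall fun y hy => Or.inl ⟨by simp, ?_⟩
    have : y ≤ -B := hy
    have h : B ≤ |y| := by rw [abs_of_nonpos (by linarith)]; linarith
    simpa using h
  · rw [ae_map_iff (p := fun z => z ∈ bentLine c₁ c₂ B) (measurable_horizontal' _).aemeasurable hm,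
    ae_restrict_iff' measurableSet_Icc]
    exact .of_forall fun y hy => Or.inr (Or.inl ⟨by simpa using hy, by simp [abs_of_nonneg hB]⟩)
  · rw [ae_map_iff (p := fun z => z ∈ bentLine c₁ c₂ B) (measurable_vertical _).aemeasurable hm,
    ae_restrict_iff' measurableSet_Icc]
    exact .of_forall fun y hy => Or.inr (Or.inr ⟨by simp, by simpa using abs_le.2 hy⟩)
  · rw [ae_map_iff (p := fun z => z ∈ bentLine c₁ c₂ B) (measurable_horizontal _).aemeasurable hm,
    ae_restrict_iff' measurableSet_Icc]
    exact .of_forall fun y hy => Or.inr (Or.inl ⟨by simpa using hy, by simp [abs_of_nonneg hB]⟩)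
  · rw [ae_map_iff (p := fun z => z ∈ bentLine c₁ c₂ B) (measurable_vertical _).aemeasurable hm,
    ae_restrict_iff' measurableSet_Ici]
    refine .of_forall fun y hy => Or.inl ⟨by simp, ?_⟩
    have : B ≤ |y| := le_trans hy (le_abs_self y)
    simpa using this

theorem restrict_bentLineMeasure {c₁ c₂ B : ℝ} (hB : 0 ≤ B) :
    (bentLineMeasure c₁ c₂ B).restrict (bentLine c₁ c₂ B) = bentLineMeasure c₁ c₂ B :=
  Measure.restrict_eq_self_of_ae_mem (ae_mem_bentLine hB)

theorem restrict_prod_bentLineMeasure {c₁ c₂ B : ℝ} (hB : 0 ≤ B) :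
    ((bentLineMeasure c₁ c₂ B).prod (bentLineMeasure c₁ c₂ B)).restrict
      (bentLine c₁ c₂ B ×ˢ bentLine c₁ c₂ B) =
      (bentLineMeasure c₁ c₂ B).prod (bentLineMeasure c₁ c₂ B) := by
  rw [← Measure.prod_restrict, restrict_bentLineMeasure hB]

theorem aestronglyMeasurable_bentLine {c₁ c₂ B : ℝ} (hB : 0 ≤ B) {f : ℂ → ℂ}
    (hf : ContinuousOn f (bentLine c₁ c₂ B)) :
    AEStronglyMeasurable f (bentLineMeasure c₁ c₂ B) := by
  rw [← restrict_bentLineMeasure hB]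
  exact hf.aestronglyMeasurable (measurableSet_bentLine _ _ _)

theorem aestronglyMeasurable_prod_bentLine {c₁ c₂ B : ℝ} (hB : 0 ≤ B) {f : ℂ × ℂ → ℂ}
    (hf : ContinuousOn f (bentLine c₁ c₂ B ×ˢ bentLine c₁ c₂ B)) :
    AEStronglyMeasurable f ((bentLineMeasure c₁ c₂ B).prod (bentLineMeasure c₁ c₂ B)) := by
  rw [← restrict_prod_bentLineMeasure hB]
  exact hf.aestronglyMeasurable
    ((measurableSet_bentLine _ _ _).prod (measurableSet_bentLine _ _ _))

/-- Uniformity in the shift s comes from translation invariance on the vertical pieces and from the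
trivial bound by the length on the horizontal ones. -/
theorem exists_lintegral_bracket_le (c₁ c₂ B : ℝ) {r : ℝ} (hr : 1 < r) :
    ∃ K : ENNReal, K < ⊤ ∧ ∀ s : ℝ,
      ∫⁻ z : ℂ, ENNReal.ofReal (bracket r (z.im + s)) ∂(bentLineMeasure c₁ c₂ B) ≤ K := by
  set J := ∫⁻ y : ℝ, ENNReal.ofReal (bracket r (y + 0)) with hJ
  have hJs : ∀ s, ∫⁻ y : ℝ, ENNReal.ofReal (bracket r (y + s)) = J := fun s => by
    rw [hJ, lintegral_add_right_eq_self (fun y => ENNReal.ofReal (bracket r y)) s,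
      lintegral_add_right_eq_self (fun y => ENNReal.ofReal (bracket r y)) 0]
  have hJt : J < ⊤ := lintegral_bracket_lt_top hr 0
  set V := volume (Icc c₁ c₂) with hV
  have hVt : V < ⊤ := by rw [hV, Real.volume_Icc]; exact ENNReal.ofReal_lt_top
  refine ⟨J + V + J + V + J, by simp [hJt, hVt], fun s => ?_⟩
  have hm : Measurable fun z : ℂ => ENNReal.ofReal (bracket r (z.im + s)) :=
    (((continuous_bracket r).comp (Complex.continuous_im.add continuous_const)).measurable).ennreal_ofReal
  rw [lintegral_bentLineMeasure _ _ _ hm]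
  have hv : ∀ (c : ℝ) (S : Set ℝ),
      ∫⁻ y in S, ENNReal.ofReal (bracket r (((c : ℂ) + y * Complex.I).im + s)) ≤ J := fun c S => by
    refine (setLIntegral_le_lintegral _ _).trans ?_
    rw [← hJs s]
    simp
  have hle : ∀ y, ENNReal.ofReal (bracket r y) ≤ 1 := fun y => by
    rw [← ENNReal.ofReal_one]
    exact ENNReal.ofReal_le_ofReal (bracket_le_one (by linarith) y)
  have hh : ∀ f : ℝ → ℝ, ∫⁻ x in Icc c₁ c₂, ENNReal.ofReal (bracket r (f x)) ≤ V := fun f => by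
    refine (lintegral_mono fun x => hle _).trans ?_
    simp [hV]
  gcongr
  · exact hv _ _
  · exact hh _
  · exact hv _ _
  · exact hh _
  · exact hv _ _

theorem integrable_bracket_bentLine (c₁ c₂ B : ℝ) {r : ℝ} (hr : 1 < r) (s : ℝ) :
    Integrable (fun z : ℂ => bracket r (z.im + s)) (bentLineMeasure c₁ c₂ B) := by
  obtain ⟨K, hK, h⟩ := exists_lintegral_bracket_le c₁ c₂ B hr
  refine ⟨((continuous_bracket r).comp
    (Complex.continuous_im.add continuous_const)).aestronglyMeasurable, ?_⟩
  rw [hasFiniteIntegral_iff_ofReal (.of_forall fun z => bracket_nonneg _ _)]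
  exact (h s).trans_lt hK

theorem integrable_bracket_prod_bentLine (c₁ c₂ B : ℝ) {r : ℝ} (hr : 1 < r) :
    Integrable (fun p : ℂ × ℂ => bracket r p.1.im * bracket r p.2.im)
      ((bentLineMeasure c₁ c₂ B).prod (bentLineMeasure c₁ c₂ B)) := by
  have := integrable_bracket_bentLine c₁ c₂ B hr 0
  simp only [add_zero] at this
  exact this.mul_prod this

/-- Tonelli: the integral over the second variable is bounded uniformly in the first, which acts
only as a shift. -/
theorem integrable_bracket_add_bentLine (c₁ c₂ B : ℝ) {r : ℝ} (hr : 1 < r) :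
    Integrable (fun p : ℂ × ℂ => bracket r p.1.im * bracket r (p.2.im + p.1.im))
      ((bentLineMeasure c₁ c₂ B).prod (bentLineMeasure c₁ c₂ B)) := by
  obtain ⟨K, hK, h⟩ := exists_lintegral_bracket_le c₁ c₂ B hr
  have hc : Continuous fun p : ℂ × ℂ => bracket r p.1.im * bracket r (p.2.im + p.1.im) :=
    ((continuous_bracket r).comp (by fun_prop)).mul ((continuous_bracket r).comp (by fun_prop))
  refine ⟨hc.aestronglyMeasurable, ?_⟩
  rw [hasFiniteIntegral_iff_ofReal
    (.of_forall fun p => mul_nonneg (bracket_nonneg _ _) (bracket_nonneg _ _)),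
    lintegral_prod _ hc.measurable.ennreal_ofReal.aemeasurable]
  calc _ ≤ ∫⁻ z : ℂ, ENNReal.ofReal (bracket r (z.im + 0)) * K ∂(bentLineMeasure c₁ c₂ B) := by
        refine lintegral_mono fun z => ?_
        simp only [ENNReal.ofReal_mul (bracket_nonneg _ _), add_zero]
        rw [lintegral_const_mul]
        · gcongr
          exact h _
        · exact (((continuous_bracket r).comp
            (Complex.continuous_im.add continuous_const)).measurable).ennreal_ofReal
    _ = (∫⁻ z : ℂ, ENNReal.ofReal (bracket r (z.im + 0)) ∂(bentLineMeasure c₁ c₂ B)) * K := by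
        rw [lintegral_mul_const']
        exact hK.ne
    _ ≤ K * K := by gcongr; exact h 0
    _ < ⊤ := ENNReal.mul_lt_top hK hK

/-- The dominating function for double integrals along the path. -/
noncomputable def bracketTriple (r y v : ℝ) : ℝ :=
  bracket r y * bracket r v + bracket r y * bracket r (v + y) + bracket r v * bracket r (y + v)

theorem integrable_bracketTriple (c₁ c₂ B : ℝ) {r : ℝ} (hr : 1 < r) :
    Integrable (fun p : ℂ × ℂ => bracketTriple r p.1.im p.2.im)
      ((bentLineMeasure c₁ c₂ B).prod (bentLineMeasure c₁ c₂ B)) := by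
  have h := integrable_bracket_add_bentLine c₁ c₂ B hr
  exact ((integrable_bracket_prod_bentLine c₁ c₂ B hr).add h).add h.swap

theorem integrable_bracketTriple_right (c₁ c₂ B : ℝ) {r : ℝ} (hr : 1 < r) (y : ℝ) :
    Integrable (fun w : ℂ => bracketTriple r y w.im) (bentLineMeasure c₁ c₂ B) := by
  have h0 := integrable_bracket_bentLine c₁ c₂ B hr 0
  simp only [add_zero] at h0
  have h1 := integrable_bracket_bentLine c₁ c₂ B hr y
  have h2 : Integrable (fun w : ℂ => bracket r w.im * bracket r (y + w.im))
      (bentLineMeasure c₁ c₂ B) := by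
    refine h0.mono' (Continuous.aestronglyMeasurable (((continuous_bracket r).comp
      (by fun_prop)).mul ((continuous_bracket r).comp (by fun_prop)))) (.of_forall fun w => ?_)
    rw [Real.norm_of_nonneg (mul_nonneg (bracket_nonneg _ _) (bracket_nonneg _ _))]
    exact mul_le_of_le_one_right (bracket_nonneg _ _) (bracket_le_one (by linarith) _)
  exact ((h0.const_mul _).add (h1.const_mul _)).add h2

/-! ### Contour integrals as integrals against arc length -/

/-- The unit tangent vector of the path, away from its corners. -/
noncomputable def bentTangent (c₁ c₂ : ℝ) (z : ℂ) : ℂ :=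
  open Classical in
  if z.re = c₁ ∨ z.re = c₂ then Complex.I else if z.im < 0 then 1 else -1

theorem measurable_bentTangent (c₁ c₂ : ℝ) : Measurable (bentTangent c₁ c₂) := by
  unfold bentTangent
  refine Measurable.ite ?_ measurable_const (Measurable.ite ?_ measurable_const measurable_const)
  · exact (measurableSet_eq_fun Complex.measurable_re measurable_const).union
      (measurableSet_eq_fun Complex.measurable_re measurable_const)
  · exact measurableSet_lt Complex.measurable_im measurable_const

theorem norm_bentTangent (c₁ c₂ : ℝ) (z : ℂ) : ‖bentTangent c₁ c₂ z‖ = 1 := by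
  unfold bentTangent
  split_ifs <;> simp

theorem MeasureTheory.Integrable.bentTangent_mul {c₁ c₂ : ℝ} {μ : Measure ℂ} {f : ℂ → ℂ}
    (hf : Integrable f μ) :
    Integrable (fun z => bentTangent c₁ c₂ z * f z) μ :=
  hf.bdd_mul (measurable_bentTangent c₁ c₂).aestronglyMeasurable
    (.of_forall fun z => (norm_bentTangent c₁ c₂ z).le)

/-- Writing dz as tangent times arc length makes Fubini and dominated convergence for a positive
measure available to the oriented contour integral. -/
theorem bentLineIntegral_eq {c₁ c₂ B : ℝ} (hc : c₁ ≤ c₂) (hB : 0 < B) {f : ℂ → ℂ}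
    (hf : Integrable f (bentLineMeasure c₁ c₂ B)) :
    bentLineIntegral c₁ c₂ B f = (1 / (2 * Real.pi * Complex.I) : ℂ) *
      ∫ z, bentTangent c₁ c₂ z * f z ∂(bentLineMeasure c₁ c₂ B) := by
  have hg := hf.bentTangent_mul (c₁ := c₁) (c₂ := c₂)
  unfold bentLineIntegral
  congr 1
  unfold bentLineMeasure at hg ⊢
  simp only [integrable_add_measure] at hg
  obtain ⟨⟨⟨⟨h1, h2⟩, h3⟩, h4⟩, h5⟩ := hg
  rw [integral_add_measure (((h1.add_measure h2).add_measure h3).add_measure h4) h5,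
    integral_add_measure ((h1.add_measure h2).add_measure h3) h4,
    integral_add_measure (h1.add_measure h2) h3, integral_add_measure h1 h2,
    integral_map (measurable_vertical _).aemeasurable h1.1,
    integral_map (measurable_horizontal' _).aemeasurable h2.1,
    integral_map (measurable_vertical _).aemeasurable h3.1,
    integral_map (measurable_horizontal _).aemeasurable h4.1,
    integral_map (measurable_vertical _).aemeasurable h5.1]
  -- At the corners `bentTangent` takes the vertical value; passing to the open interval discards
  -- these null sets on the horizontal segments.
  have hne : ∀ x ∈ Ioo c₁ c₂, ∀ b : ℝ, bentTangent c₁ c₂ (x + b * Complex.I) =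
      if b < 0 then 1 else -1 := fun x hx b => by
    have : ¬ (x = c₁ ∨ x = c₂) := by
      rintro (h | h)
      · exact absurd hx.1 (by simp [h])
      · exact absurd hx.2 (by simp [h])
    simp [bentTangent, this]
  congr 1
  · congr 1
    · congr 1
      · congr 1
        · refine integral_congr_ae (.of_forall fun y => ?_)
          simp [bentTangent, mul_comm]
        · rw [intervalIntegral.integral_of_le hc, integral_Icc_eq_integral_Ioo,
            integral_Ioc_eq_integral_Ioo]
          refine setIntegral_congr_fun measurableSet_Ioo fun x hx => ?_
          have := hne x hx (-B)
          simp only [Complex.ofReal_neg, neg_mul, ← sub_eq_add_neg] at this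
          simp [this, hB]
      · rw [intervalIntegral.integral_of_le (by linarith), ← integral_Icc_eq_integral_Ioc]
        refine integral_congr_ae (.of_forall fun y => ?_)
        simp [bentTangent, mul_comm]
    · rw [intervalIntegral.integral_of_ge hc, integral_Icc_eq_integral_Ioo,
        integral_Ioc_eq_integral_Ioo, ← integral_neg]
      refine setIntegral_congr_fun measurableSet_Ioo fun x hx => ?_
      simp [hne x hx B, hB.le]
  · refine integral_congr_ae (.of_forall fun y => ?_)
    simp [bentTangent, mul_comm]

/-! ### The Gamma integral with a complex rate -/

theorem integrableOn_rpow_mul_exp {a b : ℝ} (ha : -1 < a) (hb : 0 < b) :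
    IntegrableOn (fun t : ℝ => t ^ a * Real.exp (-(b * t))) (Ioi 0) := by
  have := integrableOn_rpow_mul_exp_neg_mul_rpow (s := a) (p := 1) ha one_pos hb
  simpa using this

theorem norm_cpow_mul_cexp (a s : ℂ) {t : ℝ} (ht : t ∈ Ioi (0 : ℝ)) :
    ‖(t : ℂ) ^ (a - 1) * Complex.exp (-(s * t))‖ = t ^ (a.re - 1) * Real.exp (-(s.re * t)) := by
  rw [norm_mul, Complex.norm_cpow_eq_rpow_re_of_pos ht, Complex.norm_exp]
  simp

theorem continuousOn_cpow_mul_cexp (a s : ℂ) :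
    ContinuousOn (fun t : ℝ => (t : ℂ) ^ (a - 1) * Complex.exp (-(s * t))) (Ioi 0) := by
  refine ContinuousOn.mul (fun t ht => ?_) (by fun_prop)
  exact (Complex.continuousAt_ofReal_cpow_const _ _ (Or.inr (ne_of_gt ht))).continuousWithinAt

theorem integrableOn_cpow_mul_cexp {a s : ℂ} (ha : 0 < a.re) (hs : 0 < s.re) :
    IntegrableOn (fun t : ℝ => (t : ℂ) ^ (a - 1) * Complex.exp (-(s * t))) (Ioi 0) := by
  refine (integrableOn_rpow_mul_exp (a := a.re - 1) (by linarith) hs).mono'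
    ((continuousOn_cpow_mul_cexp a s).aestronglyMeasurable measurableSet_Ioi) ?_
  filter_upwards [ae_restrict_mem measurableSet_Ioi] with t ht
  rw [norm_cpow_mul_cexp a s ht]

theorem differentiableAt_integral_cpow_mul_cexp {a s : ℂ} (ha : 0 < a.re) (hs : 0 < s.re) :
    DifferentiableAt ℂ
      (fun s : ℂ => ∫ t : ℝ in Ioi 0, (t : ℂ) ^ (a - 1) * Complex.exp (-(s * t))) s := by
  have hball : ∀ w ∈ Metric.ball s (s.re / 2), s.re / 2 < w.re := fun w hw => by
    have h1 : |(w - s).re| < s.re / 2 :=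
      (Complex.abs_re_le_norm _).trans_lt (by simpa [dist_eq_norm] using hw)
    have := (abs_lt.1 h1).1
    simp at this
    linarith
  refine (hasDerivAt_integral_of_dominated_loc_of_deriv_le (𝕜 := ℂ)
    (F' := fun w t => (t : ℂ) ^ (a - 1) * (Complex.exp (-(w * t)) * (-(t : ℂ))))
    (bound := fun t => t ^ a.re * Real.exp (-(s.re / 2 * t)))
    (s := Metric.ball s (s.re / 2)) (Metric.ball_mem_nhds _ (by linarith)) ?_ ?_ ?_ ?_ ?_ ?_).2.differentiableAt
  · exact .of_forall fun w =>
      (continuousOn_cpow_mul_cexp a w).aestronglyMeasurable measurableSet_Ioi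
  · exact integrableOn_cpow_mul_cexp ha hs
  · refine ContinuousOn.aestronglyMeasurable (ContinuousOn.mul (fun t ht => ?_) (by fun_prop))
      measurableSet_Ioi
    exact (Complex.continuousAt_ofReal_cpow_const _ _ (Or.inr (ne_of_gt ht))).continuousWithinAt
  · filter_upwards [ae_restrict_mem measurableSet_Ioi] with t ht w hw
    have ht' : 0 < t := ht
    rw [← mul_assoc, norm_mul, norm_cpow_mul_cexp a w ht, norm_neg, Complex.norm_real,
      Real.norm_of_nonneg ht'.le]
    have h1 : t ^ a.re = t ^ (a.re - 1) * t := by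
      rw [← Real.rpow_add_one ht'.ne']; ring_nf
    have h2 : Real.exp (-(w.re * t)) ≤ Real.exp (-(s.re / 2 * t)) := by
      apply Real.exp_le_exp.2
      have := hball w hw
      nlinarith
    rw [h1]
    have := Real.rpow_nonneg ht'.le (a.re - 1)
    calc _ = t ^ (a.re - 1) * t * Real.exp (-(w.re * t)) := by ring
      _ ≤ _ := by gcongr
  · exact integrableOn_rpow_mul_exp (by linarith) (by linarith)
  · refine .of_forall fun t w hw => ?_
    have h1 : HasDerivAt (fun w : ℂ => -(w * t)) (-(t : ℂ)) w := by
      simpa using ((hasDerivAt_id w).mul_const (t : ℂ)).fun_neg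
    exact (h1.cexp).const_mul _

/-- The Gamma integral with a complex rate. -/
theorem integral_cpow_mul_cexp_neg_mul {a s : ℂ} (ha : 0 < a.re) (hs : 0 < s.re) :
    ∫ t : ℝ in Ioi 0, (t : ℂ) ^ (a - 1) * Complex.exp (-(s * t)) = s ^ (-a) * Complex.Gamma a := by
  set U : Set ℂ := {s | 0 < s.re} with hU
  have hUo : IsOpen U := isOpen_lt continuous_const Complex.continuous_re
  have hUc : IsPreconnected U := (convex_halfSpace_re_gt 0).isPreconnected
  have hf : AnalyticOnNhd ℂ
      (fun s : ℂ => ∫ t : ℝ in Ioi 0, (t : ℂ) ^ (a - 1) * Complex.exp (-(s * t))) U :=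
    DifferentiableOn.analyticOnNhd (fun w hw =>
      (differentiableAt_integral_cpow_mul_cexp ha hw).differentiableWithinAt) hUo
  have hg : AnalyticOnNhd ℂ (fun s : ℂ => s ^ (-a) * Complex.Gamma a) U :=
    DifferentiableOn.analyticOnNhd (fun w hw =>
      ((differentiableAt_id.cpow_const (Or.inl hw)).mul_const _).differentiableWithinAt) hUo
  have h1 : (1 : ℂ) ∈ U := by simp [hU]
  -- Identity theorem: both sides are holomorphic in s on the half-plane and agree at positive real
  -- s, which accumulate at 1.
  refine hf.eqOn_of_preconnected_of_frequently_eq hg hUc h1 ?_ (show s ∈ U from hs)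
  have hev : ∃ᶠ r : ℝ in nhdsWithin 1 {1}ᶜ,
      (∫ t : ℝ in Ioi 0, (t : ℂ) ^ (a - 1) * Complex.exp (-((r : ℂ) * t))) =
        (r : ℂ) ^ (-a) * Complex.Gamma a := by
    apply Filter.Eventually.frequently
    filter_upwards [nhdsWithin_le_nhds (lt_mem_nhds (zero_lt_one' ℝ))] with r hr
    rw [Complex.integral_cpow_mul_exp_neg_mul_Ioi ha hr, one_div, Complex.inv_cpow _ _
      (by rw [Complex.arg_ofReal_of_nonneg hr.le]; exact Real.pi_pos.ne), Complex.cpow_neg]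
  have ht : Filter.Tendsto (fun r : ℝ => (r : ℂ)) (nhdsWithin 1 {1}ᶜ) (nhdsWithin 1 {1}ᶜ) := by
    refine tendsto_nhdsWithin_of_tendsto_nhds_of_eventually_within _ ?_ ?_
    · exact (Complex.continuous_ofReal.tendsto' 1 1 (by simp)).mono_left nhdsWithin_le_nhds
    · filter_upwards [self_mem_nhdsWithin] with r hr
      simpa using hr
  exact ht.frequently hev

/-! ### Straightening the path to a vertical line -/

/-- Cauchy's theorem for a half strip. -/
theorem integral_halfStrip {f : ℂ → ℂ} {c₁ c₂ B : ℝ} (hc : c₁ ≤ c₂)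
    (hd : ∀ z : ℂ, c₁ ≤ z.re → z.re ≤ c₂ → B ≤ z.im → DifferentiableAt ℂ f z)
    (h1 : IntegrableOn (fun y : ℝ => f (c₁ + y * Complex.I)) (Ici B))
    (h2 : IntegrableOn (fun y : ℝ => f (c₂ + y * Complex.I)) (Ici B))
    {g : ℝ → ℝ} (hg : Filter.Tendsto g Filter.atTop (nhds 0))
    (hfg : ∀ z : ℂ, c₁ ≤ z.re → z.re ≤ c₂ → B ≤ z.im → ‖f z‖ ≤ g z.im) :
    ∫ y in Ici B, f (c₂ + y * Complex.I) * Complex.I =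
      (∫ x in c₂..c₁, f (x + B * Complex.I)) + ∫ y in Ici B, f (c₁ + y * Complex.I) * Complex.I := by
  have hrect : ∀ T, B ≤ T → (∫ x in c₁..c₂, f (x + B * Complex.I))
      - (∫ x in c₁..c₂, f (x + T * Complex.I))
      + Complex.I * (∫ y in B..T, f (c₂ + y * Complex.I))
      - Complex.I * (∫ y in B..T, f (c₁ + y * Complex.I)) = 0 := by
    intro T hT
    have := Complex.integral_boundary_rect_eq_zero_of_differentiableOn f
      (c₁ + B * Complex.I) (c₂ + T * Complex.I) (by
        intro z hz
        rw [Complex.mem_reProdIm] at hz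
        simp only [Complex.add_re, Complex.ofReal_re, Complex.mul_re, Complex.I_re, mul_zero,
          Complex.ofReal_im, Complex.I_im, mul_one, sub_self, add_zero, Complex.add_im,
          Complex.mul_im, zero_add, uIcc_of_le hc, uIcc_of_le hT] at hz
        exact (hd z hz.1.1 hz.1.2 hz.2.1).differentiableWithinAt)
    simpa using this
  have l1 := intervalIntegral_tendsto_integral_Ioi B
    ((integrableOn_Ici_iff_integrableOn_Ioi).1 h1) Filter.tendsto_id
  have l2 := intervalIntegral_tendsto_integral_Ioi B
    ((integrableOn_Ici_iff_integrableOn_Ioi).1 h2) Filter.tendsto_id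
  have l3 : Filter.Tendsto (fun T : ℝ => ∫ x in c₁..c₂, f (x + T * Complex.I))
      Filter.atTop (nhds 0) := by
    refine squeeze_zero_norm' (a := fun T => g T * |c₂ - c₁|) ?_ (by simpa using hg.mul_const _)
    filter_upwards [Filter.eventually_ge_atTop B] with T hT
    refine intervalIntegral.norm_integral_le_of_norm_le_const fun x hx => ?_
    rw [uIoc_of_le hc] at hx
    have := hfg (x + T * Complex.I) (by simpa using hx.1.le) (by simpa using hx.2) (by simpa using hT)
    simpa using this
  have l4 := ((l3.const_sub (∫ x in c₁..c₂, f (x + B * Complex.I))).add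
    (l2.const_mul Complex.I)).sub (l1.const_mul Complex.I)
  have l5 := l4.congr' (f₂ := fun _ => 0) (by
    filter_upwards [Filter.eventually_ge_atTop B] with T hT
    exact hrect T hT)
  have := tendsto_nhds_unique l5 tendsto_const_nhds
  rw [integral_Ici_eq_integral_Ioi, integral_Ici_eq_integral_Ioi, integral_mul_const,
    integral_mul_const, intervalIntegral.integral_symm]
  linear_combination this

/-- The path and the line Re z = c₂ differ by the boundaries of two half strips with |Im z| ≥ B, so
no holomorphy is needed for |Im z| < B, where Γ may have poles. The lower half strip is reduced to
the upper one by z ↦ -z. -/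
theorem bentLineIntegral_eq_vertical {f : ℂ → ℂ} {c₁ c₂ B : ℝ} (hc : c₁ ≤ c₂) (hB : 0 < B)
    (hd : ∀ z : ℂ, c₁ ≤ z.re → z.re ≤ c₂ → B ≤ |z.im| → DifferentiableAt ℂ f z)
    (h1 : IntegrableOn (fun y : ℝ => f (c₁ + y * Complex.I)) (Ici B))
    (h1' : IntegrableOn (fun y : ℝ => f (c₁ + y * Complex.I)) (Iic (-B)))
    (h2 : Integrable (fun y : ℝ => f (c₂ + y * Complex.I)))
    {g : ℝ → ℝ} (hg : Filter.Tendsto g Filter.atTop (nhds 0))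
    (hfg : ∀ z : ℂ, c₁ ≤ z.re → z.re ≤ c₂ → B ≤ |z.im| → ‖f z‖ ≤ g |z.im|) :
    bentLineIntegral c₁ c₂ B f = 1 / (2 * Real.pi) * ∫ y : ℝ, f (c₂ + y * Complex.I) := by
  have up := integral_halfStrip hc (fun z a b c => hd z a b (c.trans (le_abs_self _))) h1
    h2.integrableOn hg (fun z a b c => by
      have := hfg z a b (c.trans (le_abs_self _))
      rwa [abs_of_nonneg (by linarith)] at this)
  have refl_int : ∀ (c : ℝ), IntegrableOn (fun y : ℝ => f (c + y * Complex.I)) (Iic (-B)) →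
      IntegrableOn (fun y : ℝ => f (-((-c : ℝ) + y * Complex.I))) (Ici B) := fun c h => by
    have := (integrableOn_Iic_iff_integrableOn_Iio).1 h
    rw [integrableOn_Ici_iff_integrableOn_Ioi]
    have h3 := this.comp_neg
    simp only [neg_Iio, neg_neg] at h3
    refine h3.congr (.of_forall fun y => ?_)
    simp; ring_nf
  have refl_eq : ∀ c : ℝ, ∫ y in Ici B, f (-((-c : ℝ) + y * Complex.I)) * Complex.I =
      ∫ y in Iic (-B), f (c + y * Complex.I) * Complex.I := fun c => by
    rw [integral_Ici_eq_integral_Ioi, ← integral_comp_neg_Ioi]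
    refine integral_congr_ae (.of_forall fun y => ?_)
    simp; ring_nf
  have down := integral_halfStrip (f := fun z => f (-z)) (c₁ := -c₂) (c₂ := -c₁) (B := B)
    (by linarith)
    (fun z a b c => by
      have hh : B ≤ |(-z).im| := by
        rw [Complex.neg_im, abs_neg]; exact c.trans (le_abs_self _)
      exact DifferentiableAt.comp z (hd (-z) (by rw [Complex.neg_re]; linarith)
        (by rw [Complex.neg_re]; linarith) hh) differentiable_neg.differentiableAt)
    (refl_int c₂ h2.integrableOn) (refl_int c₁ h1') hg (fun z a b c => by
      have hh : B ≤ |(-z).im| := by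
        rw [Complex.neg_im, abs_neg]; exact c.trans (le_abs_self _)
      have := hfg (-z) (by rw [Complex.neg_re]; linarith) (by rw [Complex.neg_re]; linarith) hh
      rwa [Complex.neg_im, abs_neg, abs_of_nonneg (by linarith)] at this)
  rw [refl_eq, refl_eq] at down
  have hx : ∫ x in (-c₁)..(-c₂), f (-(x + B * Complex.I)) =
      ∫ x in c₂..c₁, f (x - B * Complex.I) := by
    rw [← intervalIntegral.integral_comp_neg]
    simp only [neg_add, Complex.ofReal_neg, sub_eq_add_neg, neg_neg]
  rw [hx, intervalIntegral.integral_symm] at down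
  have hsplit : ∫ y : ℝ, f (c₂ + y * Complex.I) =
      (∫ y in Iic (-B), f (c₂ + y * Complex.I)) + (∫ y in (-B)..B, f (c₂ + y * Complex.I))
        + ∫ y in Ici B, f (c₂ + y * Complex.I) := by
    rw [intervalIntegral.integral_of_le (by linarith), integral_Ici_eq_integral_Ioi,
      ← intervalIntegral.integral_Iic_add_Ioi h2.integrableOn h2.integrableOn (b := B),
      ← Iic_union_Ioc_eq_Iic (show -B ≤ B by linarith),
      setIntegral_union (Iic_disjoint_Ioc le_rfl) measurableSet_Ioc h2.integrableOn h2.integrableOn]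
  simp only [integral_mul_const] at up down
  unfold bentLineIntegral
  simp only [integral_mul_const, intervalIntegral.integral_mul_const]
  have key : ∀ X S : ℂ, X = S * Complex.I →
      (1 / (2 * Real.pi * Complex.I) : ℂ) * X = 1 / (2 * Real.pi) * S := by
    rintro X S rfl
    have hI := Complex.I_ne_zero
    have hpi : (Real.pi : ℂ) ≠ 0 := by exact_mod_cast Real.pi_ne_zero
    field_simp
  apply key
  rw [hsplit]
  linear_combination down - up

/-! ### The exponential as a Mellin-Barnes integral along the path -/

theorem differentiableAt_Gamma_of_im {z : ℂ} (h : z.im ≠ 0 ∨ 0 < z.re) :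
    DifferentiableAt ℂ Complex.Gamma z := by
  apply Complex.differentiableAt_Gamma
  rintro m rfl
  rcases h with h | h
  · simp at h
  · have : (0 : ℝ) ≤ m := by positivity
    simp at h
    linarith

/-- The closed region swept out between the path and the vertical line through `c₂`. -/
def bentRegion (c₁ c₂ B : ℝ) : Set ℂ :=
  {z | c₁ ≤ z.re ∧ z.re ≤ c₂ ∧ (B ≤ |z.im| ∨ z.re = c₂)}

theorem bentLine_subset_bentRegion {c₁ c₂ B : ℝ} (hc : c₁ ≤ c₂) :
    bentLine c₁ c₂ B ⊆ bentRegion c₁ c₂ B := by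
  rintro z (⟨h1, h2⟩ | ⟨h1, h2⟩ | ⟨h1, h2⟩)
  · exact ⟨h1.ge, h1.trans_le hc, Or.inl h2⟩
  · exact ⟨h1.1, h1.2, Or.inl h2.ge⟩
  · exact ⟨hc.trans h1.ge, h1.le, Or.inr h1⟩

theorem differentiableAt_Gamma_of_mem_bentRegion {c₁ c₂ B : ℝ} (hc₂ : 0 < c₂) (hB : 0 < B) {z : ℂ}
    (hz : z ∈ bentRegion c₁ c₂ B) : DifferentiableAt ℂ Complex.Gamma z := by
  apply differentiableAt_Gamma_of_im
  rcases hz.2.2 with h | h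
  · left
    intro h0
    rw [h0, abs_zero] at h
    linarith
  · right; linarith

/-- The part with |Im z| < B is a compact piece of the line Re z = c₂ > 0, where continuity gives
the bound; elsewhere it is the Stirling bound. -/
theorem exists_norm_Gamma_le_bentRegion {c₁ c₂ B : ℝ} (hc₁ : -3 / 2 < c₁) (hc₂ : 0 < c₂)
    (hc₂' : c₂ < 1 / 2) (hB : 0 < B) : ∃ C : ℝ, 0 ≤ C ∧ ∀ z ∈ bentRegion c₁ c₂ B,
      ‖Complex.Gamma z‖ * Real.exp (Real.pi / 2 * |z.im|) ≤ C * (1 + |z.im|) ^ (z.re - 1 / 2) := by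
  obtain ⟨C, hC0, hC⟩ := norm_Gamma_mul_exp_le hB
  obtain ⟨D, hD⟩ := (isCompact_Icc (a := -B) (b := B)).exists_bound_of_continuousOn
    (f := fun y : ℝ => ‖Complex.Gamma (c₂ + y * Complex.I)‖ * Real.exp (Real.pi / 2 * |y|) /
      (1 + |y|) ^ (c₂ - 1 / 2)) (by
      apply Continuous.continuousOn
      refine Continuous.div (Continuous.mul (Continuous.norm ?_) (by fun_prop)) ?_ ?_
      · rw [continuous_iff_continuousAt]
        intro y
        have : ContinuousAt Complex.Gamma (c₂ + y * Complex.I) :=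
          (differentiableAt_Gamma_of_im (Or.inr (by simpa using hc₂))).continuousAt
        exact ContinuousAt.comp (f := fun y : ℝ => (c₂ : ℂ) + y * Complex.I) this (by fun_prop)
      · exact (continuous_const.add continuous_abs).rpow_const fun y => Or.inl
          (show (0 : ℝ) < 1 + |y| by positivity).ne'
      · intro y
        exact (Real.rpow_pos_of_pos (by positivity) _).ne')
  refine ⟨max C D, le_max_of_le_left hC0, fun z hz => ?_⟩
  have hp : 0 < (1 + |z.im|) ^ (z.re - 1 / 2) := Real.rpow_pos_of_pos (by positivity) _
  by_cases h : B ≤ |z.im|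
  · exact (hC z (by linarith [hz.1]) (by linarith [hz.2.1]) h).trans
      (mul_le_mul_of_nonneg_right (le_max_left _ _) hp.le)
  · have hre : z.re = c₂ := hz.2.2.resolve_left h
    have h1 := hD z.im (abs_le.1 (not_le.1 h).le)
    have h2 : (c₂ + z.im * Complex.I : ℂ) = z := by
      rw [← hre, Complex.re_add_im]
    rw [h2, ← hre, Real.norm_of_nonneg (by positivity), div_le_iff₀ hp] at h1
    exact h1.trans (mul_le_mul_of_nonneg_right (le_max_right _ _) hp.le)

/-- On the half-lines the Stirling exponent is exactly c₁ - 1/2. The remaining pieces lie in |Im z|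
≤ B and cost only the constant (1+B)^{1/2-c₁}. -/
theorem exists_norm_Gamma_le_bentLine {c₁ c₂ B : ℝ} (hc₁ : -3 / 2 < c₁) (hc₁' : c₁ < 0)
    (hc₂ : 0 < c₂) (hc₂' : c₂ < 1 / 2) (hB : 0 < B) : ∃ C : ℝ, 0 ≤ C ∧ ∀ z ∈ bentLine c₁ c₂ B,
      ‖Complex.Gamma z‖ * Real.exp (Real.pi / 2 * |z.im|) ≤ C * bracket (1 / 2 - c₁) z.im := by
  obtain ⟨C, hC0, hC⟩ := exists_norm_Gamma_le_bentRegion hc₁ hc₂ hc₂' hB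
  refine ⟨C * (1 + B) ^ (1 / 2 - c₁), by positivity, fun z hz => ?_⟩
  have h := hC z (bentLine_subset_bentRegion (by linarith) hz)
  refine h.trans ?_
  rw [mul_assoc]
  refine mul_le_mul_of_nonneg_left ?_ hC0
  have hB1 : 1 ≤ (1 + B) ^ (1 / 2 - c₁) := Real.one_le_rpow (by linarith) (by linarith)
  by_cases hre : z.re = c₁
  · unfold bracket
    rw [hre, neg_sub]
    exact le_mul_of_one_le_left (Real.rpow_nonneg (by positivity) _) hB1
  · have him : |z.im| ≤ B := by
      rcases hz with ⟨h1, h2⟩ | ⟨h1, h2⟩ | ⟨h1, h2⟩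
      · exact absurd h1 hre
      · exact h2.le
      · exact h2
    have hle := (bentLine_subset_bentRegion (by linarith) hz).2.1
    have e1 : (1 + |z.im|) ^ (z.re - 1 / 2) ≤ 1 :=
      Real.rpow_le_one_of_one_le_of_nonpos (by linarith [abs_nonneg z.im]) (by linarith)
    refine e1.trans ?_
    unfold bracket
    rw [Real.rpow_neg (by positivity), ← div_eq_mul_inv,
      one_le_div (Real.rpow_pos_of_pos (by positivity) _)]
    exact Real.rpow_le_rpow (by positivity) (by linarith) (by linarith)

theorem exp_neg_mul_abs_le {δ : ℝ} (hδ : 0 < δ) (y : ℝ) :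
    Real.exp (-(δ * |y|)) ≤ (2 + 4 / δ ^ 2) * bracket 2 y := by
  have h := Real.quadratic_le_exp_of_nonneg (x := δ * |y|) (by positivity)
  have hy := abs_nonneg y
  unfold bracket
  rw [Real.rpow_neg (by positivity), Real.exp_neg, ← div_eq_mul_inv,
    le_div_iff₀ (by positivity), inv_mul_le_iff₀ (Real.exp_pos _),
    show (2 : ℝ) = (2 : ℕ) by norm_num, Real.rpow_natCast]
  push_cast
  have e1 : (1 + |y|) ^ 2 ≤ (2 + 4 / δ ^ 2) * (1 + (δ * |y|) ^ 2 / 2) := by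
    have : (2 + 4 / δ ^ 2) * (1 + (δ * |y|) ^ 2 / 2) =
      2 + 2 * |y| ^ 2 + δ ^ 2 * |y| ^ 2 + 4 / δ ^ 2 := by field_simp; ring
    rw [this]
    have h1 : 0 ≤ δ ^ 2 * |y| ^ 2 := by positivity
    have h2 : 0 ≤ 4 / δ ^ 2 := by positivity
    nlinarith [sq_nonneg (|y| - 1)]
  rw [mul_comm (Real.exp _)]
  refine e1.trans (mul_le_mul_of_nonneg_left ?_ (by positivity))
  have : 0 ≤ δ * |y| := by positivity
  linarith

/-- A power of t is monotone in its exponent, in a direction that depends on whether t ≥ 1; the sum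
of the two endpoint values covers both cases. -/
theorem rpow_neg_le_add {t c₁ c₂ x : ℝ} (ht : 0 < t) (h1 : c₁ ≤ x) (h2 : x ≤ c₂) :
    t ^ (-x) ≤ t ^ (-c₁) + t ^ (-c₂) := by
  have p1 := Real.rpow_nonneg ht.le (-c₁)
  have p2 := Real.rpow_nonneg ht.le (-c₂)
  rcases le_total 1 t with h | h
  · have := Real.rpow_le_rpow_of_exponent_le h (show -x ≤ -c₁ by linarith)
    linarith
  · have := Real.rpow_le_rpow_of_exponent_ge ht h (show -c₂ ≤ -x by linarith)
    linarith

theorem norm_cpow_neg {s : ℂ} (hs : s ≠ 0) (z : ℂ) :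
    ‖s ^ (-z)‖ = ‖s‖ ^ (-z.re) * Real.exp (s.arg * z.im) := by
  rw [Complex.norm_cpow_of_ne_zero hs, div_eq_mul_inv, ← Real.exp_neg]
  simp

theorem norm_cpow_neg_le {s : ℂ} (hs : s ≠ 0) {c₁ c₂ : ℝ} {z : ℂ} (h1 : c₁ ≤ z.re)
    (h2 : z.re ≤ c₂) :
    ‖s ^ (-z)‖ ≤ (‖s‖ ^ (-c₁) + ‖s‖ ^ (-c₂)) * Real.exp (|s.arg| * |z.im|) := by
  rw [norm_cpow_neg hs]
  have h3 : s.arg * z.im ≤ |s.arg| * |z.im| := by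
    rw [← abs_mul]; exact le_abs_self _
  have := rpow_neg_le_add (norm_pos_iff.2 hs) h1 h2
  gcongr

/-- The gap δ = π/2 - |arg s| is positive, so the decay of Γ beats the growth of s^{-z} by
e^{-δ|y|}. The weaker quadratic decay recorded here is all that is needed later. -/
theorem exists_norm_Gamma_mul_cpow_le {c₁ c₂ B : ℝ} (hc₁ : -3 / 2 < c₁) (hc₂ : 0 < c₂)
    (hc₂' : c₂ < 1 / 2) (hB : 0 < B) {s : ℂ} (hs : 0 < s.re) : ∃ C : ℝ, 0 ≤ C ∧
      ∀ z ∈ bentRegion c₁ c₂ B, ‖Complex.Gamma z * s ^ (-z)‖ ≤ C * bracket 2 z.im := by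
  obtain ⟨C, hC0, hC⟩ := exists_norm_Gamma_le_bentRegion hc₁ hc₂ hc₂' hB
  have hs0 : s ≠ 0 := fun h => by simp [h] at hs
  have harg : |s.arg| < Real.pi / 2 := Complex.abs_arg_lt_pi_div_two_iff.2 (Or.inl hs)
  set δ := Real.pi / 2 - |s.arg| with hδ
  have hδ0 : 0 < δ := by linarith
  set M := ‖s‖ ^ (-c₁) + ‖s‖ ^ (-c₂)
  have hM : 0 ≤ M := by positivity
  refine ⟨C * M * (2 + 4 / δ ^ 2), by positivity, fun z hz => ?_⟩
  have h1 := hC z hz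
  have h2 := norm_cpow_neg_le hs0 hz.1 hz.2.1
  have e1 : (1 + |z.im|) ^ (z.re - 1 / 2) ≤ 1 :=
    Real.rpow_le_one_of_one_le_of_nonpos (by linarith [abs_nonneg z.im]) (by linarith [hz.2.1])
  have h3 : ‖Complex.Gamma z‖ * Real.exp (Real.pi / 2 * |z.im|) ≤ C :=
    h1.trans (mul_le_of_le_one_right hC0 e1)
  rw [norm_mul]
  calc ‖Complex.Gamma z‖ * ‖s ^ (-z)‖
      ≤ ‖Complex.Gamma z‖ * (M * Real.exp (|s.arg| * |z.im|)) := by gcongr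
    _ = (‖Complex.Gamma z‖ * Real.exp (Real.pi / 2 * |z.im|)) * M * Real.exp (-(δ * |z.im|)) := by
        have : Real.exp (|s.arg| * |z.im|) =
            Real.exp (Real.pi / 2 * |z.im|) * Real.exp (-(δ * |z.im|)) := by
          rw [← Real.exp_add, hδ]; ring_nf
        rw [this]; ring
    _ ≤ C * M * ((2 + 4 / δ ^ 2) * bracket 2 z.im) := by
        gcongr
        exact exp_neg_mul_abs_le hδ0 _
    _ = _ := by ring

theorem integrable_bracket {r : ℝ} (hr : 1 < r) : Integrable (bracket r) := by
  exact integrable_one_add_norm (E := ℝ) (by simpa using hr)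

theorem tendsto_bracket_atTop : Filter.Tendsto (bracket 2) Filter.atTop (nhds 0) := by
  have h1 : Filter.Tendsto (fun y : ℝ => 1 + |y|) Filter.atTop Filter.atTop :=
    Filter.tendsto_atTop_add_const_left _ _ Filter.tendsto_abs_atTop_atTop
  exact (tendsto_rpow_neg_atTop (show (0 : ℝ) < 2 by norm_num)).comp h1

theorem differentiableAt_Gamma_mul_cpow {c₁ c₂ B : ℝ} (hc₂ : 0 < c₂) (hB : 0 < B) {s : ℂ}
    (hs : s ≠ 0) : ∀ z ∈ bentRegion c₁ c₂ B,
      DifferentiableAt ℂ (fun z => Complex.Gamma z * s ^ (-z)) z := fun _ hz =>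
  (differentiableAt_Gamma_of_mem_bentRegion hc₂ hB hz).mul
    (differentiableAt_id.neg.const_cpow (Or.inl hs))

/-- The exponential function as an inverse Mellin transform along the bent path. -/
theorem exp_neg_eq_bentLineIntegral {c₁ c₂ B : ℝ} (hc₁ : -3 / 2 < c₁) (hc₁' : c₁ < 0)
    (hc₂ : 0 < c₂) (hc₂' : c₂ < 1 / 2) (hB : 0 < B) {s : ℂ} (hs : 0 < s.re) :
    Integrable (fun z => Complex.Gamma z * s ^ (-z)) (bentLineMeasure c₁ c₂ B) ∧
    Complex.exp (-s) = bentLineIntegral c₁ c₂ B (fun z => Complex.Gamma z * s ^ (-z)) := by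
  have hs0 : s ≠ 0 := fun h => by simp [h] at hs
  have hd := differentiableAt_Gamma_mul_cpow (c₁ := c₁) hc₂ hB hs0
  obtain ⟨C, hC0, hC⟩ := exists_norm_Gamma_mul_cpow_le hc₁ hc₂ hc₂' hB hs
  have hsub := bentLine_subset_bentRegion (B := B) (hc₁'.trans hc₂).le
  have key : ∀ (c : ℝ) (S : Set ℝ), MeasurableSet S →
      (∀ y ∈ S, (c + y * Complex.I : ℂ) ∈ bentRegion c₁ c₂ B) →
      IntegrableOn (fun y : ℝ => Complex.Gamma (c + y * Complex.I) * s ^ (-(c + y * Complex.I)))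
        S := by
    intro c S hS h
    refine ((integrable_bracket one_lt_two).const_mul C).integrableOn.mono'
      (ContinuousOn.aestronglyMeasurable (fun y hy => ?_) hS) ?_
    · exact ContinuousAt.continuousWithinAt (ContinuousAt.comp
        (f := fun y : ℝ => (c : ℂ) + y * Complex.I) (hd _ (h y hy)).continuousAt (by fun_prop))
    · filter_upwards [ae_restrict_mem hS] with y hy
      simpa using hC _ (h y hy)
  constructor
  · have := integrable_bracket_bentLine c₁ c₂ B one_lt_two 0
    simp only [add_zero] at this
    refine (this.const_mul C).mono' (aestronglyMeasurable_bentLine hB.le fun z hz =>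
      (hd z (hsub hz)).continuousAt.continuousWithinAt) ?_
    filter_upwards [ae_mem_bentLine hB.le] with z hz
    exact hC z (hsub hz)
  · have hvert : Integrable
        (fun y : ℝ => Complex.Gamma (c₂ + y * Complex.I) * s ^ (-(c₂ + y * Complex.I))) := by
      rw [← integrableOn_univ]
      exact key c₂ univ MeasurableSet.univ fun y _ =>
        ⟨by simp; linarith, by simp, Or.inr (by simp)⟩
    -- On Re z = c₂ > 0 the integrand is the Mellin transform of t ↦ e^{-st}, so Mellin inversion at
    -- t = 1 gives e^{-s}.
    rw [bentLineIntegral_eq_vertical (g := fun y => C * bracket 2 y) (hc₁'.trans hc₂).le hB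
      (fun z h1 h2 h3 => hd z ⟨h1, h2, Or.inl h3⟩)
      (key c₁ _ measurableSet_Ici fun y hy =>
        ⟨by simp, by simp; linarith, Or.inl (by simpa using le_trans hy (le_abs_self y))⟩)
      (key c₁ _ measurableSet_Iic fun y hy =>
        ⟨by simp, by simp; linarith, Or.inl (by
          have : B ≤ |y| := (le_neg.1 hy).trans (neg_le_abs y)
          simpa using this)⟩)
      hvert (by simpa using tendsto_bracket_atTop.const_mul C)
      (fun z h1 h2 h3 => by
        have := hC z ⟨h1, h2, Or.inl h3⟩
        unfold bracket at this ⊢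
        rwa [abs_abs])]
    set f : ℝ → ℂ := fun t => Complex.exp (-(s * t)) with hf
    have hm : ∀ z : ℂ, 0 < z.re → mellin f z = Complex.Gamma z * s ^ (-z) := fun z hz => by
      rw [mellin, ← integral_cpow_mul_cexp_neg_mul hz hs |>.trans (mul_comm _ _)]
      rfl
    have hm' : ∀ y : ℝ, mellin f (c₂ + y * Complex.I) =
        Complex.Gamma (c₂ + y * Complex.I) * s ^ (-(c₂ + y * Complex.I)) := fun y =>
      hm _ (by simpa using hc₂)
    have hinv := mellinInv_mellin_eq c₂ f one_pos
      (integrableOn_cpow_mul_cexp (a := c₂) (by simpa using hc₂) hs)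
      (by
        unfold Complex.VerticalIntegrable
        simp only [hm']
        exact hvert)
      (by fun_prop)
    rw [mellinInv] at hinv
    have hf1 : f 1 = Complex.exp (-s) := by simp [hf]
    simp only [hm', Complex.ofReal_one, Complex.one_cpow, one_smul] at hinv
    rw [hf1] at hinv
    rw [← hinv, Complex.real_smul]
    push_cast
    rfl

/-! ### Decay of Fourier transforms -/

/-- The Fourier transform `∫ f(ν) exp(-iνt) dν` of a real function. -/
noncomputable def realFourier (f : ℝ → ℝ) (t : ℝ) : ℂ :=
  ∫ ν : ℝ, (f ν : ℂ) * Complex.exp (-(Complex.I * ν * t))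

theorem norm_exp_neg_I_mul (ν t : ℝ) : ‖Complex.exp (-(Complex.I * ν * t))‖ = 1 := by
  rw [Complex.norm_exp]
  simp

theorem integrable_mul_exp {f : ℝ → ℝ} (hf : Integrable f) (t : ℝ) :
    Integrable fun ν : ℝ => (f ν : ℂ) * Complex.exp (-(Complex.I * ν * t)) := by
  refine hf.ofReal.mul_bdd (c := 1) (Continuous.aestronglyMeasurable (by fun_prop)) ?_
  exact .of_forall fun ν => (norm_exp_neg_I_mul ν t).le

theorem norm_realFourier_le (f : ℝ → ℝ) (t : ℝ) : ‖realFourier f t‖ ≤ ∫ ν, |f ν| := by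
  refine (norm_integral_le_integral_norm _).trans (le_of_eq ?_)
  simp [norm_exp_neg_I_mul]

theorem realFourier_add {f g : ℝ → ℝ} (hf : Integrable f) (hg : Integrable g) (t : ℝ) :
    realFourier (fun ν => f ν + g ν) t = realFourier f t + realFourier g t := by
  unfold realFourier
  rw [← integral_add (integrable_mul_exp hf t) (integrable_mul_exp hg t)]
  simp [add_mul]

theorem realFourier_const_mul (c : ℝ) (f : ℝ → ℝ) (t : ℝ) :
    realFourier (fun ν => c * f ν) t = c * realFourier f t := by
  unfold realFourier
  rw [← integral_const_mul]
  simp [mul_assoc]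

theorem realFourier_congr {f g : ℝ → ℝ} (h : f =ᵐ[volume] g) (t : ℝ) :
    realFourier f t = realFourier g t := by
  refine integral_congr_ae ?_
  filter_upwards [h] with ν hν
  rw [hν]

theorem integral_eq_interval_of_vanish {f : ℝ → ℂ} (h : ∀ x ∉ Icc (-1 : ℝ) 1, f x = 0) :
    ∫ x, f x = ∫ x in (-2 : ℝ)..2, f x := by
  rw [intervalIntegral.integral_of_le (by norm_num), setIntegral_eq_integral_of_forall_compl_eq_zero]
  intro x hx
  apply h
  intro hx'
  exact hx ⟨by linarith [hx'.1], by linarith [hx'.2]⟩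

theorem integrable_of_vanish {f : ℝ → ℝ} (h : ∀ x ∉ Icc (-1 : ℝ) 1, f x = 0)
    (hf : IntervalIntegrable f volume (-2) 2) : Integrable f := by
  rw [intervalIntegrable_iff_integrableOn_Ioc_of_le (by norm_num)] at hf
  refine (integrableOn_iff_integrable_of_support_subset fun x hx => ?_).1 hf
  by_contra h'
  refine hx (h x fun hx' => h' ⟨by linarith [hx'.1], by linarith [hx'.2]⟩)

theorem deriv_vanish {f : ℝ → ℝ} (h : ∀ x ∉ Icc (-1 : ℝ) 1, f x = 0) :
    ∀ x ∉ Icc (-1 : ℝ) 1, deriv f x = 0 := by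
  intro x hx
  have : f =ᶠ[nhds x] fun _ => 0 := by
    filter_upwards [isClosed_Icc.isOpen_compl.mem_nhds hx] with y hy
    exact h y hy
  rw [this.deriv_eq]
  simp

theorem absolutelyContinuous_of_contDiff {f : ℝ → ℝ} (hf : ContDiff ℝ 1 f) (a b : ℝ) :
    AbsolutelyContinuousOnInterval f a b := by
  obtain ⟨K, hK⟩ := (isCompact_uIcc (a := a) (b := b)).exists_bound_of_continuousOn
    (hf.continuous_deriv le_rfl).continuousOn
  refine LipschitzOnWith.absolutelyContinuousOnInterval (K := K.toNNReal) ?_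
  refine Convex.lipschitzOnWith_of_nnnorm_deriv_le
    (fun x _ => (hf.differentiable one_ne_zero).differentiableAt) (fun x hx => ?_) (convex_uIcc a b)
  rw [← NNReal.coe_le_coe, coe_nnnorm]
  exact (hK x hx).trans (Real.le_coe_toNNReal K)

/-- Integration by parts for Fourier transforms of absolutely continuous functions. -/
theorem I_mul_realFourier {f : ℝ → ℝ} (h0 : ∀ x ∉ Icc (-1 : ℝ) 1, f x = 0)
    (hf : AbsolutelyContinuousOnInterval f (-2) 2) (t : ℝ) :
    Complex.I * t * realFourier f t = realFourier (deriv f) t := by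
  -- The kernel is split into cosine and sine so that integration by parts concerns real absolutely
  -- continuous functions. At ±2, outside [-1, 1], the boundary terms vanish.
  have hcos : AbsolutelyContinuousOnInterval (fun x => Real.cos (t * x)) (-2) 2 :=
    absolutelyContinuous_of_contDiff (by fun_prop) _ _
  have hsin : AbsolutelyContinuousOnInterval (fun x => Real.sin (t * x)) (-2) 2 :=
    absolutelyContinuous_of_contDiff (by fun_prop) _ _
  have dcos : deriv (fun x => Real.cos (t * x)) = fun x => -t * Real.sin (t * x) := by
    ext x
    have := ((hasDerivAt_id x).const_mul t).cos
    simpa [mul_comm] using this.deriv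
  have dsin : deriv (fun x => Real.sin (t * x)) = fun x => t * Real.cos (t * x) := by
    ext x
    have := ((hasDerivAt_id x).const_mul t).sin
    simpa [mul_comm] using this.deriv
  have f2 : f 2 = 0 := h0 2 (by norm_num)
  have f2' : f (-2) = 0 := h0 (-2) (by norm_num)
  have e1 := hf.integral_mul_deriv_eq_deriv_mul hcos
  have e2 := hf.integral_mul_deriv_eq_deriv_mul hsin
  rw [dcos, f2, f2'] at e1
  rw [dsin, f2, f2'] at e2
  have key : ∀ g : ℝ → ℝ, (∀ x ∉ Icc (-1 : ℝ) 1, g x = 0) → IntervalIntegrable g volume (-2) 2 →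
      realFourier g t = ((∫ x in (-2 : ℝ)..2, g x * Real.cos (t * x) : ℝ) : ℂ)
        - Complex.I * ((∫ x in (-2 : ℝ)..2, g x * Real.sin (t * x) : ℝ) : ℂ) := by
    intro g hg hgi
    have i1 : IntervalIntegrable (fun x => ((g x * Real.cos (t * x) : ℝ) : ℂ)) volume (-2) 2 :=
      have h := hgi.mul_continuousOn (Continuous.continuousOn (f := fun x => Real.cos (t * x)) (by fun_prop))
      ⟨h.1.ofReal, h.2.ofReal⟩
    have i2 : IntervalIntegrable (fun x => ((g x * Real.sin (t * x) : ℝ) : ℂ)) volume (-2) 2 :=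
      have h := hgi.mul_continuousOn (Continuous.continuousOn (f := fun x => Real.sin (t * x)) (by fun_prop))
      ⟨h.1.ofReal, h.2.ofReal⟩
    unfold realFourier
    rw [integral_eq_interval_of_vanish (fun x hx => by simp [hg x hx]),
      ← intervalIntegral.integral_ofReal, ← intervalIntegral.integral_ofReal,
      ← intervalIntegral.integral_const_mul, ← intervalIntegral.integral_sub i1 (i2.const_mul _)]
    refine intervalIntegral.integral_congr fun x _ => ?_
    rw [show -(Complex.I * x * t) = ((-(t * x) : ℝ) : ℂ) * Complex.I by push_cast; ring,
      Complex.exp_mul_I, ← Complex.ofReal_cos, ← Complex.ofReal_sin, Real.cos_neg, Real.sin_neg]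
    push_cast
    ring
  rw [key f h0 (hf.continuousOn.intervalIntegrable), key _ (deriv_vanish h0)
    hf.intervalIntegrable_deriv]
  have e1' : t * (∫ x in (-2 : ℝ)..2, f x * Real.sin (t * x)) =
      ∫ x in (-2 : ℝ)..2, deriv f x * Real.cos (t * x) := by
    rw [← intervalIntegral.integral_const_mul, ← neg_inj, ← intervalIntegral.integral_neg]
    have : ∀ x, -(t * (f x * Real.sin (t * x))) = f x * (-t * Real.sin (t * x)) := fun x => by ring
    simp only [this]
    linarith
  have e2' : t * (∫ x in (-2 : ℝ)..2, f x * Real.cos (t * x)) =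
      -∫ x in (-2 : ℝ)..2, deriv f x * Real.sin (t * x) := by
    rw [← intervalIntegral.integral_const_mul]
    have : ∀ x, (t * (f x * Real.cos (t * x))) = f x * (t * Real.cos (t * x)) := fun x => by ring
    simp only [this]
    linarith
  rw [← e1']
  have e2'' := congrArg (fun r : ℝ => (r : ℂ)) e2'
  push_cast at e2'' ⊢
  linear_combination Complex.I * e2'' - (t : ℂ) *
    ((∫ x in (-2 : ℝ)..2, f x * Real.sin (t * x) : ℝ) : ℂ) * Complex.I_sq

/-- The first difference of `f` is Lipschitz in mean. -/
def LipschitzInMean (f : ℝ → ℝ) : Prop :=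
  ∃ K : ℝ, ∀ δ : ℝ, 0 ≤ δ → δ ≤ 4 → ∫ ν, |f (ν + δ) - f ν| ≤ K * δ

/-- A shift by δ = π/t changes the sign of e^{-iνt}, so twice the transform is, up to sign, the
transform of a first difference of f. For t ≥ 1 such shifts are at most π ≤ 4, which is why the
range δ ≤ 4 suffices. -/
theorem LipschitzInMean.exists_norm_realFourier_le {f : ℝ → ℝ} (hf : Integrable f)
    (h : LipschitzInMean f) : ∃ C : ℝ, ∀ t : ℝ, 1 ≤ t → ‖realFourier f t‖ ≤ C / t := by
  obtain ⟨K, hK⟩ := h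
  refine ⟨K * Real.pi / 2, fun t ht => ?_⟩
  have ht0 : 0 < t := by linarith
  set δ := Real.pi / t with hδ
  have hδ0 : 0 ≤ δ := by positivity
  have hδ4 : δ ≤ 4 := by
    rw [hδ, div_le_iff₀ ht0]; nlinarith [Real.pi_le_four]
  have hs : realFourier f t = -∫ ν : ℝ, (f (ν + δ) : ℂ) * Complex.exp (-(Complex.I * ν * t)) := by
    unfold realFourier
    rw [← integral_add_right_eq_self (fun ν : ℝ => (f ν : ℂ) * Complex.exp (-(Complex.I * ν * t))) δ,
      ← integral_neg]
    refine integral_congr_ae (.of_forall fun ν => ?_)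
    beta_reduce
    have : Complex.exp (-(Complex.I * ((ν + δ : ℝ) : ℂ) * t)) =
        -Complex.exp (-(Complex.I * ν * t)) := by
      have h1 : -(Complex.I * ((ν + δ : ℝ) : ℂ) * t) =
          -(Complex.I * ν * t) - Real.pi * Complex.I := by
        have : (δ : ℂ) * t = Real.pi := by
          rw [← Complex.ofReal_mul, hδ, div_mul_cancel₀ _ ht0.ne']
        push_cast
        linear_combination -Complex.I * this
      rw [h1, Complex.exp_sub, Complex.exp_pi_mul_I]
      rw [div_neg, div_one]
    rw [this]
    ring
  have hfs : Integrable fun ν => f (ν + δ) := hf.comp_add_right δ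
  have h2 : 2 * realFourier f t = -realFourier (fun ν => f (ν + δ) + -1 * f ν) t := by
    rw [realFourier_add hfs (hf.const_mul _), realFourier_const_mul]
    have : realFourier (fun ν => f (ν + δ)) t = - realFourier f t := by
      rw [hs, neg_neg]; rfl
    rw [this]
    push_cast
    ring
  have h3 : 2 * ‖realFourier f t‖ ≤ K * δ := by
    calc 2 * ‖realFourier f t‖ = ‖2 * realFourier f t‖ := by simp
      _ ≤ ∫ ν, |f (ν + δ) + -1 * f ν| := by
        rw [h2, norm_neg]; exact norm_realFourier_le _ _
      _ = ∫ ν, |f (ν + δ) - f ν| := by simp [sub_eq_add_neg]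
      _ ≤ _ := hK δ hδ0 hδ4
  have : K * Real.pi / 2 / t = K * δ / 2 := by rw [hδ]; ring
  rw [this]
  linarith

/-- The discrete product rule; |ν+δ| ≤ 5 = 1 + 4 whenever one of the two points lies in [-1, 1]. -/
theorem LipschitzInMean.mul_id {f : ℝ → ℝ} (hf : Integrable f)
    (h0 : ∀ x ∉ Icc (-1 : ℝ) 1, f x = 0) (h : LipschitzInMean f) :
    LipschitzInMean fun ν => ν * f ν := by
  obtain ⟨K, hK⟩ := h
  refine ⟨5 * K + ∫ ν, |f ν|, fun δ hδ0 hδ4 => ?_⟩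
  have hfs : Integrable fun ν => f (ν + δ) := hf.comp_add_right δ
  have hd : Integrable fun ν => |f (ν + δ) - f ν| := (hfs.sub hf).abs
  calc ∫ ν, |(ν + δ) * f (ν + δ) - ν * f ν|
      ≤ ∫ ν, (5 * |f (ν + δ) - f ν| + δ * |f ν|) := by
        refine integral_mono_of_nonneg (.of_forall fun ν => abs_nonneg _)
          ((hd.const_mul _).add (hf.abs.const_mul _)) (.of_forall fun ν => ?_)
        simp only
        by_cases hν : ν + δ ∈ Icc (-1 : ℝ) 1 ∨ ν ∈ Icc (-1 : ℝ) 1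
        · have hb : |ν + δ| ≤ 5 := by
            rw [abs_le]
            rcases hν with hν | hν
            · exact ⟨by linarith [hν.1], by linarith [hν.2]⟩
            · exact ⟨by linarith [hν.1], by linarith [hν.2]⟩
          have : (ν + δ) * f (ν + δ) - ν * f ν = (ν + δ) * (f (ν + δ) - f ν) + δ * f ν := by ring
          rw [this]
          refine (abs_add_le _ _).trans ?_
          rw [abs_mul, abs_mul, abs_of_nonneg hδ0]
          gcongr
        · push Not at hν
          rw [h0 _ hν.1, h0 _ hν.2]
          simp
    _ = 5 * (∫ ν, |f (ν + δ) - f ν|) + δ * ∫ ν, |f ν| := by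
        rw [integral_add (hd.const_mul _) (hf.abs.const_mul _), integral_const_mul,
          integral_const_mul]
    _ ≤ 5 * (K * δ) + δ * ∫ ν, |f ν| := by gcongr; exact hK δ hδ0 hδ4
    _ = _ := by ring

/-- The integral telescopes to one over [b, b+δ] minus one over [a, a+δ], each estimated by
monotonicity. -/
theorem Monotone.integral_shift_sub_le {p : ℝ → ℝ} (hp : Monotone p) {a b δ : ℝ}
    (hδ : 0 ≤ δ) : ∫ ν in a..b, (p (ν + δ) - p ν) ≤ δ * (p (b + δ) - p a) := by
  have hi : ∀ u v, IntervalIntegrable p volume u v := fun u v => hp.intervalIntegrable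
  have hs : IntervalIntegrable (fun ν => p (ν + δ)) volume a b :=
    (hp.comp (fun x y h => by simpa using h)).intervalIntegrable
  rw [intervalIntegral.integral_sub hs (hi _ _), intervalIntegral.integral_comp_add_right]
  have e : (∫ x in (a + δ)..(b + δ), p x) - ∫ x in a..b, p x =
      (∫ x in b..(b + δ), p x) - ∫ x in a..(a + δ), p x := by
    have h1 := intervalIntegral.integral_add_adjacent_intervals (hi a (a + δ)) (hi (a + δ) (b + δ))
    have h2 := intervalIntegral.integral_add_adjacent_intervals (hi a b) (hi b (b + δ))
    linarith
  rw [e]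
  have u1 : ∫ x in b..(b + δ), p x ≤ δ * p (b + δ) := by
    calc _ ≤ ∫ x in b..(b + δ), p (b + δ) :=
          intervalIntegral.integral_mono_on (by linarith) (hi _ _) (by simp)
            fun x hx => hp hx.2
      _ = _ := by simp
  have u2 : δ * p a ≤ ∫ x in a..(a + δ), p x := by
    calc _ = ∫ x in a..(a + δ), p a := by simp
      _ ≤ _ := intervalIntegral.integral_mono_on (by linarith) (by simp) (hi _ _)
            fun x hx => hp hx.1
  linarith

/-- Jordan decomposition g = p - q reduces the claim to monotone functions. The difference vanishes
outside (-6, 2] because δ ≤ 4, and 6 = 2 + 4 is the largest shifted argument. -/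
theorem lipschitzInMean_of_boundedVariation {f g : ℝ → ℝ}
    (h0 : ∀ x ∉ Icc (-1 : ℝ) 1, f x = 0) (hg : BoundedVariationOn g univ)
    (hfg : f =ᵐ[volume] g) : LipschitzInMean f := by
  obtain ⟨p, q, hp, hq, hpq⟩ := hg.locallyBoundedVariationOn.exists_monotoneOn_sub_monotoneOn
  rw [monotoneOn_univ] at hp hq
  refine ⟨(p 6 - p (-6)) + (q 6 - q (-6)), fun δ hδ0 hδ4 => ?_⟩
  have hshift : (fun ν => f (ν + δ)) =ᵐ[volume] fun ν => g (ν + δ) :=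
    (measurePreserving_add_right volume δ).quasiMeasurePreserving.ae_eq hfg
  have his : ∀ {r : ℝ → ℝ}, Monotone r → IntervalIntegrable (fun ν => r (ν + δ) - r ν)
      volume (-6) 2 := fun {r} hr =>
    ((hr.comp (fun x y h => by simpa using h)).intervalIntegrable (u := fun ν => r (ν + δ))).sub
      hr.intervalIntegrable
  have hmon : ∀ {r : ℝ → ℝ}, Monotone r → ∫ ν in (-6 : ℝ)..2, (r (ν + δ) - r ν) ≤
      δ * (r 6 - r (-6)) := fun {r} hr => by
    refine (hr.integral_shift_sub_le hδ0).trans ?_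
    gcongr
    exact hr (by linarith)
  calc ∫ ν, |f (ν + δ) - f ν| = ∫ ν in Ioc (-6 : ℝ) 2, |f (ν + δ) - f ν| := by
        rw [setIntegral_eq_integral_of_forall_compl_eq_zero]
        intro x hx
        rw [h0 x (fun h => hx ⟨by linarith [h.1], by linarith [h.2]⟩),
          h0 (x + δ) (fun h => hx ⟨by linarith [h.1], by linarith [h.2]⟩)]
        simp
    _ = ∫ ν in (-6 : ℝ)..2, |f (ν + δ) - f ν| := by
        rw [intervalIntegral.integral_of_le (by norm_num)]
    _ ≤ ∫ ν in (-6 : ℝ)..2, ((p (ν + δ) - p ν) + (q (ν + δ) - q ν)) := by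
        rw [intervalIntegral.integral_of_le (by norm_num),
          intervalIntegral.integral_of_le (by norm_num)]
        refine integral_mono_of_nonneg (.of_forall fun ν => abs_nonneg _) ?_ ?_
        · have := (his hp).add (his hq)
          rwa [intervalIntegrable_iff_integrableOn_Ioc_of_le (by norm_num)] at this
        · filter_upwards [ae_restrict_of_ae hshift, ae_restrict_of_ae hfg] with ν h1 h2
          rw [h1, h2, hpq]
          have m1 := hp (show ν ≤ ν + δ by linarith)
          have m2 := hq (show ν ≤ ν + δ by linarith)
          simp only [Pi.sub_apply]
          rw [abs_le]
          constructor <;> linarith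
    _ = (∫ ν in (-6 : ℝ)..2, (p (ν + δ) - p ν)) + ∫ ν in (-6 : ℝ)..2, (q (ν + δ) - q ν) :=
        intervalIntegral.integral_add (his hp) (his hq)
    _ ≤ δ * (p 6 - p (-6)) + δ * (q 6 - q (-6)) := add_le_add (hmon hp) (hmon hq)
    _ = _ := by ring

/-- The Fourier transform of `f` is `O(t ^ (-n))` at infinity. -/
def FourierDecay (n : ℕ) (f : ℝ → ℝ) : Prop :=
  ∃ C : ℝ, ∀ t : ℝ, 1 ≤ t → ‖realFourier f t‖ ≤ C / t ^ n

theorem FourierDecay.of_succ {n : ℕ} {f : ℝ → ℝ} (h : FourierDecay (n + 1) f) :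
    FourierDecay n f := by
  obtain ⟨C, hC⟩ := h
  refine ⟨C, fun t ht => (hC t ht).trans ?_⟩
  have hC0 : 0 ≤ C := by simpa using (norm_nonneg _).trans (hC 1 le_rfl)
  gcongr
  omega

theorem FourierDecay.of_deriv {n : ℕ} {f : ℝ → ℝ} (h0 : ∀ x ∉ Icc (-1 : ℝ) 1, f x = 0)
    (hf : AbsolutelyContinuousOnInterval f (-2) 2) (h : FourierDecay n (deriv f)) :
    FourierDecay (n + 1) f := by
  obtain ⟨C, hC⟩ := h
  refine ⟨C, fun t ht => ?_⟩
  have ht0 : 0 < t := by linarith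
  have h1 := hC t ht
  rw [← I_mul_realFourier h0 hf t, norm_mul, norm_mul, Complex.norm_I, one_mul, Complex.norm_real,
    Real.norm_of_nonneg ht0.le, le_div_iff₀ (by positivity)] at h1
  rw [le_div_iff₀ (by positivity), pow_succ]
  linarith

theorem pow_mul_vanish {f : ℝ → ℝ} (h0 : ∀ x ∉ Icc (-1 : ℝ) 1, f x = 0) (j : ℕ) :
    ∀ x ∉ Icc (-1 : ℝ) 1, x ^ j * f x = 0 := fun x hx => by rw [h0 x hx, mul_zero]

theorem integrable_pow_mul {f : ℝ → ℝ} (h0 : ∀ x ∉ Icc (-1 : ℝ) 1, f x = 0)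
    (hf : IntervalIntegrable f volume (-2) 2) (j : ℕ) : Integrable fun x => x ^ j * f x :=
  integrable_of_vanish (pow_mul_vanish h0 j)
    (hf.continuousOn_mul (Continuous.continuousOn (by fun_prop)))

/-- Almost everywhere (x^{j+1} f)' = (j+1) x^j f + x^{j+1} f'. The first term is covered by
induction on j, with one order of decay to spare, the second by the hypothesis; hence all powers are
carried along together. -/
theorem FourierDecay.pow_mul_of_deriv {n : ℕ} {f : ℝ → ℝ} (h0 : ∀ x ∉ Icc (-1 : ℝ) 1, f x = 0)
    (hf : AbsolutelyContinuousOnInterval f (-2) 2)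
    (h : ∀ j : ℕ, FourierDecay n fun x => x ^ j * deriv f x) (j : ℕ) :
    FourierDecay (n + 1) fun x => x ^ j * f x := by
  have hd0 := deriv_vanish h0
  induction j with
  | zero =>
    simp only [pow_zero, one_mul]
    refine FourierDecay.of_deriv h0 hf ?_
    simpa using h 0
  | succ j ih =>
    refine FourierDecay.of_deriv (pow_mul_vanish h0 _)
      ((absolutelyContinuous_of_contDiff (f := fun x : ℝ => x ^ (j + 1))
        (by fun_prop) _ _).fun_mul hf) ?_
    have hae : deriv (fun x : ℝ => x ^ (j + 1) * f x) =ᵐ[volume]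
        fun x => ((j : ℝ) + 1) * (x ^ j * f x) + x ^ (j + 1) * deriv f x := by
      filter_upwards [hf.ae_differentiableAt] with x hx
      by_cases hx1 : x ∈ Icc (-1 : ℝ) 1
      · have hx2 : DifferentiableAt ℝ f x := hx (by
          rw [uIcc_of_le (by norm_num)]
          exact ⟨by linarith [hx1.1], by linarith [hx1.2]⟩)
        have := ((hasDerivAt_pow (j + 1) x).fun_mul hx2.hasDerivAt).deriv
        rw [this]
        push_cast
        ring_nf
      · rw [deriv_vanish (pow_mul_vanish h0 (j + 1)) x hx1, h0 x hx1, hd0 x hx1]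
        simp
    obtain ⟨C₁, hC₁⟩ := ih.of_succ
    obtain ⟨C₂, hC₂⟩ := h (j + 1)
    refine ⟨(j + 1) * C₁ + C₂, fun t ht => ?_⟩
    rw [realFourier_congr hae,
      realFourier_add ((integrable_pow_mul h0 hf.continuousOn.intervalIntegrable j).const_mul _)
        (integrable_pow_mul hd0 hf.intervalIntegrable_deriv (j + 1)), realFourier_const_mul]
    refine (norm_add_le _ _).trans ?_
    rw [norm_mul, Complex.norm_real, Real.norm_of_nonneg (by positivity), add_div, mul_div_assoc]
    gcongr
    · exact hC₁ t ht
    · exact hC₂ t ht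

theorem IsSmoothSieving.vanish {E : ℝ → ℝ} (hE : IsSmoothSieving E) :
    ∀ x ∉ Icc (-1 : ℝ) 1, E x = 0 := fun x hx => by
  rw [← hE.support] at hx
  exact image_eq_zero_of_notMem_tsupport hx

/-- Bounded variation gives one order of decay for E''', and each of E'', E', E adds one more by
integration by parts. The powers of x serve to differentiate the transform. -/
theorem IsSmoothSieving.fourierDecay {E : ℝ → ℝ} (hE : IsSmoothSieving E) (j : ℕ) :
    FourierDecay 4 fun x => x ^ j * E x := by
  have h0 := hE.vanish
  have h1 := deriv_vanish h0
  have h2 := deriv_vanish h1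
  have h3 := deriv_vanish h2
  have a0 := hE.absCont (-2) 2
  have a1 := hE.absCont_deriv (-2) 2
  have a2 := hE.absCont_deriv_two (-2) 2
  obtain ⟨g, hg, hfg⟩ := hE.boundedVariation
  have hi := fun j => integrable_pow_mul h3 a2.intervalIntegrable_deriv j
  have hL : ∀ j : ℕ, LipschitzInMean fun x => x ^ j * deriv (deriv (deriv E)) x := by
    intro j
    induction j with
    | zero =>
      simp only [pow_zero, one_mul]
      exact lipschitzInMean_of_boundedVariation h3 hg hfg
    | succ j ih =>
      have := ih.mul_id (hi j) (pow_mul_vanish h3 j)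
      simpa only [pow_succ', mul_assoc] using this
  have d3 : ∀ j : ℕ, FourierDecay 1 fun x => x ^ j * deriv (deriv (deriv E)) x := fun j => by
    obtain ⟨C, hC⟩ := (hL j).exists_norm_realFourier_le (hi j)
    exact ⟨C, by simpa using hC⟩
  have d2 := FourierDecay.pow_mul_of_deriv h2 a2 d3
  have d1 := FourierDecay.pow_mul_of_deriv h1 a1 d2
  exact FourierDecay.pow_mul_of_deriv h0 a0 d1 j

theorem FourierDecay.exists_bracket_le {f : ℝ → ℝ} (h : FourierDecay 4 f) :
    ∃ C : ℝ, 0 ≤ C ∧ ∀ t : ℝ, 0 < t → ‖realFourier f t‖ ≤ C * bracket 4 t := by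
  obtain ⟨C, hC⟩ := h
  set D := ∫ ν, |f ν| with hD
  have hD0 : 0 ≤ D := integral_nonneg fun ν => abs_nonneg _
  have hC0 : 0 ≤ C := by simpa using (norm_nonneg _).trans (hC 1 le_rfl)
  -- 16 = 2⁴, from 1+t ≤ 2t for t ≥ 1 and 1+t ≤ 2 for t ≤ 1, where the L¹ norm D bounds the
  -- transform.
  refine ⟨16 * (C + D), by positivity, fun t ht => ?_⟩
  have hb : bracket 4 t = ((1 + t) ^ 4)⁻¹ := by
    unfold bracket
    rw [abs_of_pos ht, Real.rpow_neg (by positivity), show (4 : ℝ) = (4 : ℕ) by norm_num,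
      Real.rpow_natCast]
  rw [hb, ← div_eq_mul_inv, le_div_iff₀ (by positivity)]
  rcases le_total 1 t with h1 | h1
  · have h2 := hC t h1
    rw [le_div_iff₀ (by positivity)] at h2
    have h3 : (1 + t) ^ 4 ≤ (2 * t) ^ 4 := by gcongr; linarith
    calc _ ≤ ‖realFourier f t‖ * (2 * t) ^ 4 := by gcongr
      _ = 16 * (‖realFourier f t‖ * t ^ 4) := by ring
      _ ≤ _ := by nlinarith
  · have h2 := norm_realFourier_le f t
    have h3 : (1 + t) ^ 4 ≤ 2 ^ 4 := by gcongr; linarith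
    calc _ ≤ D * 2 ^ 4 := by gcongr
      _ ≤ _ := by nlinarith

theorem hasDerivAt_realFourier {f : ℝ → ℝ} (hf : Integrable f)
    (hf' : Integrable fun x => x * f x) (t : ℝ) :
    HasDerivAt (realFourier f) (-Complex.I * realFourier (fun x => x * f x) t) t := by
  have h := (hasDerivAt_integral_of_dominated_loc_of_deriv_le (𝕜 := ℝ) (μ := volume)
    (F := fun (t : ℝ) (ν : ℝ) => (f ν : ℂ) * Complex.exp (-(Complex.I * ν * t)))
    (F' := fun (t : ℝ) (ν : ℝ) => -Complex.I * (((ν * f ν : ℝ) : ℂ) *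
      Complex.exp (-(Complex.I * ν * t))))
    (bound := fun ν => ‖ν * f ν‖) (s := univ) (x₀ := t) Filter.univ_mem ?_ ?_ ?_ ?_ ?_ ?_).2
  · rw [integral_const_mul] at h
    exact h
  · exact .of_forall fun t => (integrable_mul_exp hf t).1
  · exact integrable_mul_exp hf t
  · exact ((integrable_mul_exp hf' t).const_mul _).1
  · refine .of_forall fun ν t _ => ?_
    rw [norm_mul, norm_mul, norm_exp_neg_I_mul, norm_neg, Complex.norm_I, Complex.norm_real]
    simp
  · exact hf'.norm
  · refine .of_forall fun ν t _ => ?_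
    have h1 : HasDerivAt (fun t : ℝ => -(Complex.I * ν * (t : ℂ))) (-(Complex.I * ν)) t := by
      simpa using ((Complex.ofRealCLM.hasDerivAt (x := t)).const_mul (Complex.I * ν)).fun_neg
    have := h1.cexp.const_mul (f ν : ℂ)
    exact this.congr_deriv (by push_cast; ring)

/-! ### The scaled transform: decay and Fourier inversion -/

theorem sieveFourier_eq (E : ℝ → ℝ) {lam : ℝ} (hlam : 0 < lam) (t : ℝ) :
    sieveFourier E lam t = lam * realFourier E (lam * t) := by
  unfold sieveFourier realFourier sieve
  have := Measure.integral_comp_div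
    (fun ν : ℝ => (E ν : ℂ) * Complex.exp (-(Complex.I * ν * ((lam * t : ℝ) : ℂ)))) lam
  rw [abs_of_pos hlam, Complex.real_smul] at this
  rw [← this]
  refine integral_congr_ae (.of_forall fun ν => ?_)
  have hl : (lam : ℂ) ≠ 0 := by exact_mod_cast hlam.ne'
  beta_reduce
  congr 2
  push_cast
  field_simp

theorem bracket_mul_le {lam : ℝ} (hlam : 0 < lam) : ∃ K : ℝ, 0 ≤ K ∧ ∀ t : ℝ, 0 < t →
    bracket 4 (lam * t) ≤ K * bracket 4 t := by
  refine ⟨(1 + 1 / lam) ^ 4, by positivity, fun t ht => ?_⟩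
  have hb : ∀ t : ℝ, 0 < t → bracket 4 t = ((1 + t) ^ 4)⁻¹ := fun t ht => by
    unfold bracket
    rw [abs_of_pos ht, Real.rpow_neg (by positivity), show (4 : ℝ) = (4 : ℕ) by norm_num,
      Real.rpow_natCast]
  rw [hb t ht, hb _ (by positivity), ← div_eq_mul_inv, le_div_iff₀ (by positivity),
    inv_mul_le_iff₀ (by positivity), ← mul_pow]
  gcongr
  have : (1 + lam * t) * (1 + 1 / lam) = 1 + t + lam * t + 1 / lam := by field_simp; ring
  rw [this]
  have : 0 < 1 / lam := by positivity
  have : 0 < lam * t := by positivity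
  linarith

/-- The properties of the transform `Ê^lam` that the analysis of `M^lam` depends on. -/
structure IsDecayingTransform (φ φ₁ φ₂ : ℝ → ℂ) (C : ℝ) : Prop where
  hasDerivAt : ∀ t, HasDerivAt φ (φ₁ t) t
  hasDerivAt_deriv : ∀ t, HasDerivAt φ₁ (φ₂ t) t
  continuous_two : Continuous φ₂
  const_nonneg : 0 ≤ C
  norm_le : ∀ t, 0 < t → ‖φ t‖ ≤ C * bracket 4 t
  norm_le_one : ∀ t, 0 < t → ‖φ₁ t‖ ≤ C * bracket 4 t
  norm_le_two : ∀ t, 0 < t → ‖φ₂ t‖ ≤ C * bracket 4 t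

/-- Each differentiation in t brings down -iλ and replaces x^j E by x^{j+1} E, so the decay for j =
0, 1, 2 gives the three bounds. -/
theorem IsSmoothSieving.isDecayingTransform {E : ℝ → ℝ} (hE : IsSmoothSieving E) {lam : ℝ}
    (hlam : 0 < lam) : ∃ φ₁ φ₂ C, IsDecayingTransform (sieveFourier E lam) φ₁ φ₂ C := by
  have hi : ∀ j : ℕ, Integrable fun x => x ^ j * E x := fun j =>
    integrable_pow_mul hE.vanish (hE.absCont (-2) 2).continuousOn.intervalIntegrable j
  set P : ℕ → ℝ → ℂ := fun j t => realFourier (fun x => x ^ j * E x) t with hP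
  have hPd : ∀ j t, HasDerivAt (P j) (-Complex.I * P (j + 1) t) t := fun j t => by
    have e : (fun x : ℝ => x ^ (j + 1) * E x) = fun x => x * (x ^ j * E x) := by
      ext x; ring
    have := hasDerivAt_realFourier (hi j) (by rw [← e]; exact hi (j + 1)) t
    rw [← e] at this
    exact this
  have hPs : ∀ (j : ℕ) (c : ℂ) (t : ℝ), HasDerivAt (fun t => c * P j (lam * t))
      (-Complex.I * lam * c * P (j + 1) (lam * t)) t := fun j c t => by
    have h1 : HasDerivAt (fun t : ℝ => lam * t) lam t := by
      simpa using (hasDerivAt_id t).const_mul lam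
    have := ((hPd j (lam * t)).scomp t h1).const_mul c
    exact this.congr_deriv (by rw [Complex.real_smul]; ring)
  have hE0 : sieveFourier E lam = fun t => (lam : ℂ) * P 0 (lam * t) := by
    ext t
    rw [sieveFourier_eq E hlam]
    simp [hP]
  obtain ⟨K, hK0, hK⟩ := bracket_mul_le hlam
  have hb : ∀ (j : ℕ) (c : ℂ), ∃ C : ℝ, 0 ≤ C ∧ ∀ t : ℝ, 0 < t →
      ‖c * P j (lam * t)‖ ≤ C * bracket 4 t := fun j c => by
    obtain ⟨C, hC0, hC⟩ := (hE.fourierDecay j).exists_bracket_le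
    refine ⟨‖c‖ * (C * K), by positivity, fun t ht => ?_⟩
    rw [norm_mul]
    calc _ ≤ ‖c‖ * (C * bracket 4 (lam * t)) := by gcongr; exact hC _ (by positivity)
      _ ≤ ‖c‖ * (C * (K * bracket 4 t)) := by gcongr; exact hK t ht
      _ = _ := by ring
  obtain ⟨C0, hC0, h0⟩ := hb 0 lam
  obtain ⟨C1, hC1, h1⟩ := hb 1 (-Complex.I * lam * lam)
  obtain ⟨C2, hC2, h2⟩ := hb 2 (-Complex.I * lam * (-Complex.I * lam * lam))
  refine ⟨_, _, C0 + C1 + C2, hE0 ▸ hPs 0 lam, hPs 1 (-Complex.I * lam * lam),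
    continuous_iff_continuousAt.2 fun t => (hPs 2 _ t).continuousAt, by positivity,
    fun t ht => ?_, fun t ht => ?_, fun t ht => ?_⟩
  · rw [hE0]
    refine (h0 t ht).trans (mul_le_mul_of_nonneg_right (by linarith) (bracket_nonneg _ _))
  · exact (h1 t ht).trans (mul_le_mul_of_nonneg_right (by linarith) (bracket_nonneg _ _))
  · exact (h2 t ht).trans (mul_le_mul_of_nonneg_right (by linarith) (bracket_nonneg _ _))

theorem IsSmoothSieving.sieveFourier_neg {E : ℝ → ℝ} (hE : IsSmoothSieving E) (lam t : ℝ) :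
    sieveFourier E lam (-t) = sieveFourier E lam t := by
  unfold sieveFourier
  rw [← integral_neg_eq_self]
  refine integral_congr_ae (.of_forall fun ν => ?_)
  simp [sieve, neg_div, hE.even]

/-- Fourier inversion for scaled sieving functions. -/
theorem IsSmoothSieving.inversion {E : ℝ → ℝ} (hE : IsSmoothSieving E) {lam : ℝ} (hlam : 0 < lam)
    (x : ℝ) : (sieve E lam x : ℂ) = (1 / Real.pi : ℂ) * ∫ t in Ioi (0 : ℝ), sieveFourier E lam t *
      (1 / 2 * (Complex.exp (Complex.I * x * t) + Complex.exp (-(Complex.I * x * t)))) := by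
  obtain ⟨φ₁, φ₂, C, hφ⟩ := hE.isDecayingTransform hlam
  set φ := sieveFourier E lam with hφd
  have hφc : Continuous φ := continuous_iff_continuousAt.2 fun t => (hφ.hasDerivAt t).continuousAt
  have hφi : Integrable φ := by
    refine ((integrable_bracket (r := 4) (by norm_num)).const_mul C).mono' hφc.aestronglyMeasurable ?_
    have hne : ∀ᵐ t : ℝ, t ≠ 0 := by simp [ae_iff]
    filter_upwards [hne] with t ht
    rcases lt_or_gt_of_ne ht with h | h
    · have := hφ.norm_le (-t) (by linarith)
      rw [hφd, hE.sieveFourier_neg] at this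
      unfold bracket at this ⊢
      rwa [abs_neg] at this
    · exact hφ.norm_le t h
  have hEc : Continuous E := by
    obtain ⟨K, hK⟩ := hE.lipschitz
    exact hK.continuous
  have hEi : Integrable E := integrable_of_vanish hE.vanish hEc.continuousOn.intervalIntegrable
  set F : ℝ → ℂ := fun ν => (sieve E lam ν : ℂ) with hF
  have hFc : Continuous F := by
    unfold F sieve
    fun_prop
  have hFi : Integrable F := (hEi.comp_div hlam.ne').ofReal
  have hfour : ∀ ξ : ℝ, FourierTransform.fourier F ξ = φ (2 * Real.pi * ξ) := fun ξ => by
    rw [Real.fourier_eq', hφd]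
    unfold sieveFourier
    refine integral_congr_ae (.of_forall fun ν => ?_)
    simp only [hF, smul_eq_mul]
    rw [mul_comm]
    congr 2
    simp
    ring
  have hpi : (2 * Real.pi : ℝ) ≠ 0 := by positivity
  have hfi : Integrable (FourierTransform.fourier F) := by
    have : FourierTransform.fourier F = fun ξ => φ (2 * Real.pi * ξ) := funext hfour
    rw [this]
    exact hφi.comp_mul_left' hpi
  have hinv := hFi.fourierInv_fourier_eq hfi (v := x) hFc.continuousAt
  have hexp : ∀ y t : ℝ, ‖Complex.exp (Complex.I * y * t)‖ = 1 := fun y t => by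
    rw [Complex.norm_exp]; simp
  have hg : ∀ y : ℝ, Integrable fun t : ℝ => φ t * Complex.exp (Complex.I * y * t) := fun y =>
    hφi.mul_bdd (c := 1) (Continuous.aestronglyMeasurable (by fun_prop))
      (.of_forall fun t => (hexp y t).le)
  have h1 : F x = 1 / (2 * Real.pi) * ∫ t : ℝ, φ t * Complex.exp (Complex.I * x * t) := by
    rw [← hinv, Real.fourierInv_eq']
    have := Measure.integral_comp_mul_left
      (fun t : ℝ => φ t * Complex.exp (Complex.I * x * t)) (2 * Real.pi)
    rw [abs_of_pos (by positivity), Complex.real_smul] at this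
    push_cast at this
    rw [one_div, ← this]
    refine integral_congr_ae (.of_forall fun ξ => ?_)
    simp only [hfour, smul_eq_mul]
    rw [mul_comm]
    congr 2
    simp
    ring
  -- Evenness of the transform folds the integral onto the positive half-line.
  have h2 : ∫ t : ℝ, φ t * Complex.exp (Complex.I * x * t) =
      ∫ t in Ioi (0 : ℝ), φ t * (Complex.exp (Complex.I * x * t) +
        Complex.exp (-(Complex.I * x * t))) := by
    rw [← intervalIntegral.integral_Iic_add_Ioi (hg x).integrableOn (hg x).integrableOn (b := 0)]
    have := integral_comp_neg_Ioi (0 : ℝ) (fun t : ℝ => φ t * Complex.exp (Complex.I * x * t))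
    rw [neg_zero] at this
    rw [← this, ← integral_add]
    · refine integral_congr_ae (.of_forall fun t => ?_)
      beta_reduce
      rw [hφd, hE.sieveFourier_neg]
      push_cast
      ring_nf
    · exact (hg x).comp_neg.integrableOn
    · exact (hg x).integrableOn
  have h3 : ∀ t : ℝ, φ t * (1 / 2 * (Complex.exp (Complex.I * x * t) +
      Complex.exp (-(Complex.I * x * t)))) = 1 / 2 * (φ t * (Complex.exp (Complex.I * x * t) +
      Complex.exp (-(Complex.I * x * t)))) := fun t => by ring
  simp only [h3]
  rw [integral_const_mul]
  change F x = _
  rw [h1, h2]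
  have hpc : (Real.pi : ℂ) ≠ 0 := by exact_mod_cast Real.pi_ne_zero
  generalize (∫ t in Ioi (0 : ℝ), φ t * (Complex.exp (Complex.I * x * t) +
        Complex.exp (-(Complex.I * x * t)))) = X
  field_simp

/-! ### The Mellin transform and its decay on vertical lines -/

theorem bracket_four_mul_rpow_le {t u : ℝ} (ht : 0 < t) : bracket 4 t * t ^ u ≤ t ^ (u - 4) := by
  have h : bracket 4 t ≤ t ^ (-4 : ℝ) := by
    unfold bracket
    rw [abs_of_pos ht]
    exact Real.rpow_le_rpow_of_nonpos ht (by linarith) (by norm_num)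
  calc _ ≤ t ^ (-4 : ℝ) * t ^ u := mul_le_mul_of_nonneg_right h (Real.rpow_nonneg ht.le _)
    _ = _ := by rw [← Real.rpow_add ht]; ring_nf

theorem integrableOn_bracket_mul_rpow {u : ℝ} (h1 : -1 < u) (h2 : u < 3) :
    IntegrableOn (fun t : ℝ => bracket 4 t * t ^ u) (Ioi 0) := by
  have hm : ∀ s : Set ℝ, AEStronglyMeasurable (fun t : ℝ => bracket 4 t * t ^ u)
      (volume.restrict s) := fun s =>
    ((continuous_bracket 4).measurable.mul (measurable_id.pow_const u)).aestronglyMeasurable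
  rw [← Ioc_union_Ioi_eq_Ioi (zero_le_one (α := ℝ))]
  refine IntegrableOn.union ?_ ?_
  · have := (intervalIntegral.intervalIntegrable_rpow' (a := 0) (b := 1) h1)
    rw [intervalIntegrable_iff_integrableOn_Ioc_of_le zero_le_one] at this
    refine this.mono' (hm _) ?_
    filter_upwards [ae_restrict_mem measurableSet_Ioc] with t ht
    have hp := Real.rpow_nonneg ht.1.le u
    rw [Real.norm_of_nonneg (mul_nonneg (bracket_nonneg _ _) hp)]
    exact mul_le_of_le_one_left hp (bracket_le_one (by norm_num) _)
  · refine (integrableOn_Ioi_rpow_of_lt (a := u - 4) (by linarith) one_pos).mono' (hm _) ?_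
    filter_upwards [ae_restrict_mem measurableSet_Ioi] with t ht
    have ht0 : 0 < t := zero_lt_one.trans ht
    rw [Real.norm_of_nonneg (mul_nonneg (bracket_nonneg _ _) (Real.rpow_nonneg ht0.le u))]
    exact bracket_four_mul_rpow_le ht0

theorem norm_mul_cpow_le {φ : ℝ → ℂ} {C : ℝ} (hφ : ∀ t, 0 < t → ‖φ t‖ ≤ C * bracket 4 t)
    (w : ℂ) {t : ℝ} (ht : 0 < t) : ‖φ t * (t : ℂ) ^ w‖ ≤ C * (bracket 4 t * t ^ w.re) := by
  rw [norm_mul, Complex.norm_cpow_eq_rpow_re_of_pos ht, ← mul_assoc]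
  exact mul_le_mul_of_nonneg_right (hφ t ht) (Real.rpow_nonneg ht.le _)

theorem integrableOn_mul_cpow {φ : ℝ → ℂ} {C : ℝ} (hc : Continuous φ)
    (hφ : ∀ t, 0 < t → ‖φ t‖ ≤ C * bracket 4 t) {w : ℂ} (h1 : -1 < w.re) (h2 : w.re < 3) :
    IntegrableOn (fun t : ℝ => φ t * (t : ℂ) ^ w) (Ioi 0) := by
  refine ((integrableOn_bracket_mul_rpow h1 h2).const_mul C).mono' ?_ ?_
  · refine ContinuousOn.aestronglyMeasurable (hc.continuousOn.mul fun t ht => ?_) measurableSet_Ioi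
    exact (Complex.continuousAt_ofReal_cpow_const _ _ (Or.inr (ne_of_gt ht))).continuousWithinAt
  · filter_upwards [ae_restrict_mem measurableSet_Ioi] with t ht
    exact norm_mul_cpow_le hφ w ht

theorem exists_norm_integral_mul_cpow_le {φ : ℝ → ℂ} {C : ℝ}
    (hC : 0 ≤ C) (hφ : ∀ t, 0 < t → ‖φ t‖ ≤ C * bracket 4 t) {u₁ u₂ : ℝ} (h1 : -1 < u₁)
    (h1' : u₁ < 3) (h2 : u₂ < 3) (h2' : -1 < u₂) : ∃ K : ℝ, 0 ≤ K ∧ ∀ w : ℂ, u₁ ≤ w.re →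
      w.re ≤ u₂ → ‖∫ t in Ioi (0 : ℝ), φ t * (t : ℂ) ^ w‖ ≤ K := by
  have hi := ((integrableOn_bracket_mul_rpow h1 h1').add
    (integrableOn_bracket_mul_rpow h2' h2)).const_mul C
  refine ⟨∫ t in Ioi (0 : ℝ), C * (bracket 4 t * t ^ u₁ + bracket 4 t * t ^ u₂), ?_,
    fun w hw1 hw2 => ?_⟩
  · refine setIntegral_nonneg measurableSet_Ioi fun t ht => ?_
    have ht0 : 0 < t := ht
    have := bracket_nonneg 4 t
    positivity
  · refine norm_integral_le_of_norm_le hi ?_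
    filter_upwards [ae_restrict_mem measurableSet_Ioi] with t ht
    refine (norm_mul_cpow_le hφ w ht).trans ?_
    rw [← mul_add]
    have := rpow_neg_le_add (c₁ := -u₂) (c₂ := -u₁) (x := -w.re) ht (by linarith) (by linarith)
    simp only [neg_neg] at this
    have := bracket_nonneg 4 t
    gcongr
    linarith

/-- Integration by parts against (t^w)'. The boundary terms vanish at 0 because Re w > 0 and φ is
bounded, and at infinity because φ is O(t⁻⁴). -/
theorem mul_integral_mul_cpow {φ ψ : ℝ → ℂ} {C : ℝ} (hd : ∀ t, HasDerivAt φ (ψ t) t)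
    (hψc : Continuous ψ) (hC : 0 ≤ C)
    (hφ : ∀ t, 0 < t → ‖φ t‖ ≤ C * bracket 4 t) (hψ : ∀ t, 0 < t → ‖ψ t‖ ≤ C * bracket 4 t)
    {w : ℂ} (h1 : 0 < w.re) (h2 : w.re < 3) :
    w * ∫ t in Ioi (0 : ℝ), φ t * (t : ℂ) ^ (w - 1) = -∫ t in Ioi (0 : ℝ), ψ t * (t : ℂ) ^ w := by
  have hφc : Continuous φ := continuous_iff_continuousAt.2 fun t => (hd t).continuousAt
  have hw0 : w ≠ 0 := fun h => by simp [h] at h1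
  have hbd : ∀ t : ℝ, 0 < t → ‖φ t * (t : ℂ) ^ w‖ ≤ C * (bracket 4 t * t ^ w.re) :=
    fun t ht => norm_mul_cpow_le hφ w ht
  have hsub : (w - 1).re = w.re - 1 := by simp
  have key := integral_Ioi_mul_deriv_eq_deriv_mul (a := 0) (u := φ) (u' := ψ)
    (v := fun t : ℝ => (t : ℂ) ^ w) (v' := fun t : ℝ => w * (t : ℂ) ^ (w - 1)) (a' := 0) (b' := 0)
    (fun t _ => hd t) (fun t ht => ?_) ?_ ?_ ?_ ?_
  · rw [← integral_const_mul]
    simp only [sub_self, zero_sub] at key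
    rw [← key]
    refine integral_congr_ae (.of_forall fun t => ?_)
    beta_reduce
    ring
  · exact hasDerivAt_ofReal_cpow_const (ne_of_gt ht) hw0
  · have := (integrableOn_mul_cpow hφc hφ (w := w - 1) (by rw [hsub]; linarith)
      (by rw [hsub]; linarith)).const_mul w
    refine this.congr (.of_forall fun t => ?_)
    simp only [Pi.mul_apply]
    ring
  · exact integrableOn_mul_cpow hψc hψ (by linarith) h2
  · refine squeeze_zero_norm' (a := fun t : ℝ => C * t ^ w.re) ?_ ?_
    · filter_upwards [self_mem_nhdsWithin] with t ht
      refine (hbd t ht).trans ?_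
      have ht0 : 0 < t := ht
      gcongr
      exact mul_le_of_le_one_left (Real.rpow_nonneg ht0.le _) (bracket_le_one (by norm_num) _)
    · have : Filter.Tendsto (fun t : ℝ => C * t ^ w.re) (nhds 0) (nhds (C * 0 ^ w.re)) :=
        ((Real.continuousAt_rpow_const 0 w.re (Or.inr h1.le)).tendsto).const_mul C
      rw [Real.zero_rpow h1.ne', mul_zero] at this
      exact this.mono_left nhdsWithin_le_nhds
  · refine squeeze_zero_norm' (a := fun t : ℝ => C * t ^ (-(4 - w.re))) ?_ ?_
    · filter_upwards [Filter.eventually_gt_atTop 0] with t ht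
      refine (hbd t ht).trans ?_
      rw [neg_sub]
      exact mul_le_mul_of_nonneg_left (bracket_four_mul_rpow_le ht) hC
    · simpa using (tendsto_rpow_neg_atTop (show (0 : ℝ) < 4 - w.re by linarith)).const_mul C

/-- The Mellin transform `(1/π) ∫₀^∞ φ(t) t^(-z) dt`. -/
noncomputable def halfMellin (φ : ℝ → ℂ) (z : ℂ) : ℂ :=
  (1 / Real.pi : ℂ) * ∫ t in Ioi (0 : ℝ), φ t * (t : ℂ) ^ (-z)

theorem norm_halfMellin (φ : ℝ → ℂ) (z : ℂ) :
    ‖halfMellin φ z‖ ≤ ‖∫ t in Ioi (0 : ℝ), φ t * (t : ℂ) ^ (-z)‖ := by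
  unfold halfMellin
  rw [norm_mul]
  refine mul_le_of_le_one_left (norm_nonneg _) ?_
  rw [norm_div, norm_one, Complex.norm_real, Real.norm_of_nonneg Real.pi_pos.le,
    div_le_one Real.pi_pos]
  linarith [Real.pi_gt_three]

theorem inv_norm_le_bracket {d y : ℝ} (hd : 0 < d) {z : ℂ} (h1 : d ≤ z.re) (h2 : |z.im| = |y|) :
    ‖z‖⁻¹ ≤ (1 + 1 / d) * bracket 1 y := by
  have e1 : d ≤ ‖z‖ := h1.trans (Complex.re_le_norm z)
  have e2 : |y| ≤ ‖z‖ := h2 ▸ Complex.abs_im_le_norm z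
  have hz : 0 < ‖z‖ := by linarith
  unfold bracket
  rw [Real.rpow_neg (by positivity), Real.rpow_one, ← div_eq_mul_inv, le_div_iff₀ (by positivity),
    inv_mul_le_iff₀ hz]
  have : 1 ≤ ‖z‖ / d := (one_le_div hd).2 e1
  have e3 : ‖z‖ * (1 + 1 / d) = ‖z‖ + ‖z‖ / d := by ring
  rw [e3]
  linarith

namespace IsDecayingTransform

variable {φ φ₁ φ₂ : ℝ → ℂ} {C : ℝ}

theorem continuous_zero (h : IsDecayingTransform φ φ₁ φ₂ C) : Continuous φ :=
  continuous_iff_continuousAt.2 fun t => (h.hasDerivAt t).continuousAt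

theorem continuous_one (h : IsDecayingTransform φ φ₁ φ₂ C) : Continuous φ₁ :=
  continuous_iff_continuousAt.2 fun t => (h.hasDerivAt_deriv t).continuousAt

theorem integrableOn (h : IsDecayingTransform φ φ₁ φ₂ C) {z : ℂ} (h1 : -3 < z.re) (h2 : z.re < 1) :
    IntegrableOn (fun t : ℝ => φ t * (t : ℂ) ^ (-z)) (Ioi 0) :=
  integrableOn_mul_cpow h.continuous_zero h.norm_le (by simp; linarith) (by simp; linarith)

theorem differentiableOn (h : IsDecayingTransform φ φ₁ φ₂ C) :
    DifferentiableOn ℂ (halfMellin φ) {z : ℂ | -3 < z.re ∧ z.re < 1} := by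
  have e : halfMellin φ = fun z => (1 / Real.pi : ℂ) * mellin φ (1 - z) := by
    ext z
    unfold halfMellin mellin
    congr 1
    refine integral_congr_ae (.of_forall fun t => ?_)
    simp [mul_comm]
  rw [e]
  intro z hz
  refine DifferentiableAt.differentiableWithinAt (DifferentiableAt.const_mul ?_ _)
  have hm : DifferentiableAt ℂ (mellin φ) (1 - z) := by
    refine mellin_differentiableAt_of_isBigO_rpow (a := 4) (b := 0)
      (h.continuous_zero.locallyIntegrable.locallyIntegrableOn _) ?_ ?_ ?_ ?_
    · refine Asymptotics.IsBigO.of_bound C ?_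
      filter_upwards [Filter.eventually_gt_atTop 0] with t ht
      have e := bracket_four_mul_rpow_le (u := 0) ht
      rw [Real.rpow_zero, mul_one, zero_sub] at e
      refine (h.norm_le t ht).trans ?_
      rw [Real.norm_of_nonneg (Real.rpow_nonneg ht.le _)]
      exact mul_le_mul_of_nonneg_left e h.const_nonneg
    · simp; linarith [hz.1]
    · refine Asymptotics.IsBigO.of_bound C ?_
      filter_upwards [self_mem_nhdsWithin] with t ht
      refine (h.norm_le t ht).trans ?_
      simp only [neg_zero, Real.rpow_zero, norm_one]
      exact mul_le_mul_of_nonneg_left (bracket_le_one (by norm_num) _) h.const_nonneg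
    · simp; linarith [hz.2]
  exact DifferentiableAt.comp (g := mellin φ) (f := fun z : ℂ => 1 - z) z hm (by fun_prop)

theorem exists_norm_halfMellin_le (h : IsDecayingTransform φ φ₁ φ₂ C) {x₁ x₂ : ℝ}
    (h1 : -3 < x₁) (h1' : x₁ < 1) (h2 : -3 < x₂) (h2' : x₂ < 1) : ∃ K : ℝ, 0 ≤ K ∧ ∀ z : ℂ,
      x₁ ≤ z.re → z.re ≤ x₂ → ‖halfMellin φ z‖ ≤ K := by
  obtain ⟨K, hK0, hK⟩ := exists_norm_integral_mul_cpow_le h.const_nonneg h.norm_le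
    (u₁ := -x₂) (u₂ := -x₁) (by linarith) (by linarith) (by linarith) (by linarith)
  exact ⟨K, hK0, fun z hz1 hz2 => (norm_halfMellin φ z).trans
    (hK (-z) (by simpa using hz2) (by simpa using hz1))⟩

/-- One integration by parts gains the factor 1/(1-z) but raises the power of t to 1-z, so
convergence at infinity moves the left edge from -3 to -2. -/
theorem exists_norm_halfMellin_le_one (h : IsDecayingTransform φ φ₁ φ₂ C) {x₁ x₂ : ℝ}
    (h1 : -2 < x₁) (h1' : x₁ < 1) (h2 : -2 < x₂) (h2' : x₂ < 1) : ∃ K : ℝ, 0 ≤ K ∧ ∀ z : ℂ,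
      x₁ ≤ z.re → z.re ≤ x₂ → ‖halfMellin φ z‖ ≤ K * bracket 1 z.im := by
  obtain ⟨K, hK0, hK⟩ := exists_norm_integral_mul_cpow_le h.const_nonneg h.norm_le_one
    (u₁ := 1 - x₂) (u₂ := 1 - x₁) (by linarith) (by linarith) (by linarith) (by linarith)
  have hd : 0 < 1 - x₂ := by linarith
  refine ⟨K * (1 + 1 / (1 - x₂)), by positivity, fun z hz1 hz2 => ?_⟩
  refine (norm_halfMellin φ z).trans ?_
  have e1 := mul_integral_mul_cpow h.hasDerivAt h.continuous_one h.const_nonneg h.norm_le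
    h.norm_le_one (w := 1 - z) (by simp; linarith) (by simp; linarith)
  rw [show (1 - z - 1 : ℂ) = -z by ring] at e1
  have n1 := inv_norm_le_bracket hd (z := 1 - z) (y := z.im) (by simp; linarith) (by simp)
  have p1 : 0 < ‖1 - z‖ := lt_of_lt_of_le hd
    (le_trans (by simp; linarith) (Complex.re_le_norm (1 - z)))
  have e3 := congrArg norm e1
  rw [norm_mul, norm_neg] at e3
  have e4 := hK (1 - z) (by simp; linarith) (by simp; linarith)
  rw [← e3] at e4
  have hb := bracket_nonneg 1 z.im
  calc _ = (‖1 - z‖)⁻¹ * (‖1 - z‖ * ‖∫ t in Ioi (0 : ℝ), φ t * (t : ℂ) ^ (-z)‖) := by field_simp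
    _ ≤ ((1 + 1 / (1 - x₂)) * bracket 1 z.im) * K := by gcongr
    _ = _ := by ring

/-- Two integrations by parts gain 1/((1-z)(2-z)) and move the left edge to -1. -/
theorem exists_norm_halfMellin_le_two (h : IsDecayingTransform φ φ₁ φ₂ C) {x₁ x₂ : ℝ}
    (h1 : -1 < x₁) (h1' : x₁ < 1) (h2 : -1 < x₂) (h2' : x₂ < 1) : ∃ K : ℝ, 0 ≤ K ∧ ∀ z : ℂ,
      x₁ ≤ z.re → z.re ≤ x₂ → ‖halfMellin φ z‖ ≤ K * bracket 2 z.im := by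
  obtain ⟨K, hK0, hK⟩ := exists_norm_integral_mul_cpow_le h.const_nonneg h.norm_le_two
    (u₁ := 2 - x₂) (u₂ := 2 - x₁) (by linarith) (by linarith) (by linarith) (by linarith)
  have hd : 0 < 1 - x₂ := by linarith
  refine ⟨K * (1 + 1 / (1 - x₂)) ^ 2, by positivity, fun z hz1 hz2 => ?_⟩
  refine (norm_halfMellin φ z).trans ?_
  have e1 := mul_integral_mul_cpow h.hasDerivAt h.continuous_one h.const_nonneg h.norm_le
    h.norm_le_one (w := 1 - z) (by simp; linarith) (by simp; linarith)
  have e2 := mul_integral_mul_cpow h.hasDerivAt_deriv h.continuous_two h.const_nonneg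
    h.norm_le_one h.norm_le_two (w := 2 - z) (by simp; linarith) (by simp; linarith)
  rw [show (1 - z - 1 : ℂ) = -z by ring] at e1
  rw [show (2 - z - 1 : ℂ) = 1 - z by ring] at e2
  have n1 := inv_norm_le_bracket hd (z := 1 - z) (y := z.im) (by simp; linarith) (by simp)
  have n2 := inv_norm_le_bracket hd (z := 2 - z) (y := z.im) (by simp; linarith) (by simp)
  have p1 : 0 < ‖1 - z‖ := lt_of_lt_of_le hd
    (le_trans (by simp; linarith) (Complex.re_le_norm (1 - z)))
  have p2 : 0 < ‖2 - z‖ := lt_of_lt_of_le hd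
    (le_trans (by simp; linarith) (Complex.re_le_norm (2 - z)))
  have e3 : ‖2 - z‖ * (‖1 - z‖ * ‖∫ t in Ioi (0 : ℝ), φ t * (t : ℂ) ^ (-z)‖) =
      ‖∫ t in Ioi (0 : ℝ), φ₂ t * (t : ℂ) ^ (2 - z)‖ := by
    rw [← norm_mul, ← norm_mul, e1, mul_neg, e2, neg_neg]
  have e4 := hK (2 - z) (by simp; linarith) (by simp; linarith)
  rw [← e3] at e4
  have hb := bracket_nonneg 1 z.im
  have hb2 : bracket 2 z.im = bracket 1 z.im * bracket 1 z.im := by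
    rw [← bracket_add]; norm_num
  calc _ = (‖2 - z‖)⁻¹ * (‖1 - z‖)⁻¹ *
        (‖2 - z‖ * (‖1 - z‖ * ‖∫ t in Ioi (0 : ℝ), φ t * (t : ℂ) ^ (-z)‖)) := by field_simp
    _ ≤ ((1 + 1 / (1 - x₂)) * bracket 1 z.im) * ((1 + 1 / (1 - x₂)) * bracket 1 z.im) * K := by
        gcongr
    _ = _ := by rw [hb2]; ring

end IsDecayingTransform

/-! ### An integrable majorant for the regularised double integrand -/

theorem bracket_sq (r y : ℝ) : bracket (r / 2) y * bracket (r / 2) y = bracket r y := by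
  rw [← bracket_add]; ring_nf

/-- On the path, the decay of the Mellin transform compensates for the slow decay of the Gamma
factors. -/
theorem IsDecayingTransform.exists_bracketTriple_le {φ φ₁ φ₂ : ℝ → ℂ} {C : ℝ}
    (h : IsDecayingTransform φ φ₁ φ₂ C) {c₁ c₂ : ℝ} (hc₁ : -3 / 2 < c₁) (hc₁' : c₁ < 0)
    (hc₂ : 0 < c₂) (hc₂' : c₂ < 1 / 2) : ∃ r K : ℝ, 1 < r ∧ 0 ≤ K ∧ ∀ z w : ℂ,
      c₁ ≤ z.re → z.re ≤ c₂ → c₁ ≤ w.re → w.re ≤ c₂ →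
      bracket (1 / 2 - c₁) z.im * bracket (1 / 2 - c₁) w.im * ‖halfMellin φ (z + w)‖ ≤
        K * bracketTriple r z.im w.im := by
  have hadd : ∀ z w : ℂ, c₁ ≤ z.re → z.re ≤ c₂ → c₁ ≤ w.re → w.re ≤ c₂ →
      2 * c₁ ≤ (z + w).re ∧ (z + w).re ≤ 2 * c₂ := fun z w h1 h2 h3 h4 => by
    rw [Complex.add_re]; constructor <;> linarith
  -- The further left c₁ lies, the fewer integrations by parts Re(z+w) ≥ 2c₁ allows (2c₁ > -1, -2 or
  -- -3), but the faster the Gamma factors decay.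
  rcases lt_or_ge (-1 / 2) c₁ with hA | hA
  · obtain ⟨K, hK0, hK⟩ := h.exists_norm_halfMellin_le_two (x₁ := 2 * c₁) (x₂ := 2 * c₂)
      (by linarith) (by linarith) (by linarith) (by linarith)
    -- Each Gamma factor supplies the exponent 1/2 - c₁ ≥ r/2 and the Mellin transform the exponent
    -- 2 ≥ r; r > 1 because c₁ < 0.
    set r := min (1 - 2 * c₁) 2 with hr
    have hr1 : 1 < r := lt_min (by linarith) (by norm_num)
    refine ⟨r, K, hr1, hK0, fun z w h1 h2 h3 h4 => ?_⟩
    obtain ⟨k1, k2⟩ := hadd z w h1 h2 h3 h4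
    have hM := hK (z + w) k1 k2
    rw [Complex.add_im] at hM
    have hp : r / 2 ≤ 1 / 2 - c₁ := by have := min_le_left (1 - 2 * c₁) 2; linarith
    have b1 := bracket_anti hp z.im
    have b2 := bracket_anti hp w.im
    have b3 := bracket_anti (min_le_right (1 - 2 * c₁) 2) (z.im + w.im)
    rw [← hr] at b3
    have s1 := bracket_sq r z.im
    have s2 := bracket_sq r w.im
    have s3 := bracket_sq r (z.im + w.im)
    set a := bracket (r / 2) z.im with ha
    set b := bracket (r / 2) w.im with hb
    set c := bracket (r / 2) (z.im + w.im) with hc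
    have a0 : 0 ≤ a := bracket_nonneg _ _
    have b0 : 0 ≤ b := bracket_nonneg _ _
    have n1 := bracket_nonneg (1 / 2 - c₁) z.im
    have n2 := bracket_nonneg (1 / 2 - c₁) w.im
    have n3 := bracket_nonneg 2 (z.im + w.im)
    calc _ ≤ a * b * (K * bracket r (z.im + w.im)) := by gcongr; exact hM.trans (by gcongr)
      _ = K * ((a * b) * (c * c)) := by rw [← s3]; ring
      _ ≤ K * bracketTriple r z.im w.im := by
        gcongr
        unfold bracketTriple
        rw [add_comm w.im z.im, ← s1, ← s2, ← s3]
        -- This is ab·c² ≤ (a² + b²)c²/2.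
        nlinarith [mul_nonneg (mul_self_nonneg (a - b)) (mul_self_nonneg c),
          mul_nonneg (mul_self_nonneg a) (mul_self_nonneg b),
          mul_nonneg (mul_self_nonneg a) (mul_self_nonneg c),
          mul_nonneg (mul_self_nonneg b) (mul_self_nonneg c)]
  · rcases lt_or_ge (-1) c₁ with hB | hB
    · obtain ⟨K, hK0, hK⟩ := h.exists_norm_halfMellin_le_one (x₁ := 2 * c₁) (x₂ := 2 * c₂)
        (by linarith) (by linarith) (by linarith) (by linarith)
      refine ⟨3 / 2, K, by norm_num, hK0, fun z w h1 h2 h3 h4 => ?_⟩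
      obtain ⟨k1, k2⟩ := hadd z w h1 h2 h3 h4
      have hM := hK (z + w) k1 k2
      rw [Complex.add_im] at hM
      have hp : 1 ≤ 1 / 2 - c₁ := by linarith
      have b1 := bracket_anti hp z.im
      have b2 := bracket_anti hp w.im
      have s : ∀ y, bracket 1 y = bracket (1 / 2) y * bracket (1 / 2) y := fun y =>
        (bracket_sq 1 y).symm
      have s' : ∀ y, bracket (3 / 2) y =
          bracket (1 / 2) y * bracket (1 / 2) y * bracket (1 / 2) y := fun y => by
        rw [← bracket_add, ← bracket_add]; norm_num
      have n1 := bracket_nonneg (1 / 2 - c₁) z.im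
      have n2 := bracket_nonneg (1 / 2 - c₁) w.im
      have m1 := bracket_nonneg 1 z.im
      have m2 := bracket_nonneg 1 w.im
      have a0 := bracket_nonneg (1 / 2) z.im
      have b0 := bracket_nonneg (1 / 2) w.im
      have c0 := bracket_nonneg (1 / 2) (z.im + w.im)
      -- The three first-order brackets are regrouped into three pairwise products of half powers;
      -- cubing these gives the exponent 3/2 > 1.
      have amgm : ∀ P Q R : ℝ, 0 ≤ P → 0 ≤ Q → 0 ≤ R →
          P * Q * R ≤ P * P * P + Q * Q * Q + R * R * R := fun P Q R hP hQ hR => by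
        nlinarith [mul_nonneg (add_nonneg (add_nonneg hP hQ) hR)
          (add_nonneg (add_nonneg (sq_nonneg (P - Q)) (sq_nonneg (Q - R))) (sq_nonneg (P - R))),
          mul_nonneg (mul_nonneg hP hQ) hR, pow_nonneg hP 3, pow_nonneg hQ 3, pow_nonneg hR 3]
      calc _ ≤ bracket 1 z.im * bracket 1 w.im * (K * bracket 1 (z.im + w.im)) := by gcongr
        _ = K * ((bracket (1 / 2) z.im * bracket (1 / 2) w.im) *
            (bracket (1 / 2) z.im * bracket (1 / 2) (z.im + w.im)) *
            (bracket (1 / 2) w.im * bracket (1 / 2) (z.im + w.im))) := by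
          rw [s, s, s]; ring
        _ ≤ K * bracketTriple (3 / 2) z.im w.im := by
          gcongr
          refine (amgm _ _ _ (mul_nonneg a0 b0) (mul_nonneg a0 c0) (mul_nonneg b0 c0)).trans
            (le_of_eq ?_)
          unfold bracketTriple
          rw [add_comm w.im z.im, s', s', s']
          ring
    · obtain ⟨K, hK0, hK⟩ := h.exists_norm_halfMellin_le (x₁ := 2 * c₁) (x₂ := 2 * c₂)
        (by linarith) (by linarith) (by linarith) (by linarith)
      refine ⟨3 / 2, K, by norm_num, hK0, fun z w h1 h2 h3 h4 => ?_⟩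
      obtain ⟨k1, k2⟩ := hadd z w h1 h2 h3 h4
      have hM := hK (z + w) k1 k2
      have hp : 3 / 2 ≤ 1 / 2 - c₁ := by linarith
      have b1 := bracket_anti hp z.im
      have b2 := bracket_anti hp w.im
      have n1 := bracket_nonneg (1 / 2 - c₁) z.im
      have n2 := bracket_nonneg (1 / 2 - c₁) w.im
      have m1 := bracket_nonneg (3 / 2) z.im
      have m2 := bracket_nonneg (3 / 2) w.im
      calc _ ≤ bracket (3 / 2) z.im * bracket (3 / 2) w.im * K := by gcongr
        _ = K * (bracket (3 / 2) z.im * bracket (3 / 2) w.im) := by ring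
        _ ≤ K * bracketTriple (3 / 2) z.im w.im := by
          gcongr
          unfold bracketTriple
          have := mul_nonneg m1 (bracket_nonneg (3 / 2) (w.im + z.im))
          have := mul_nonneg m2 (bracket_nonneg (3 / 2) (z.im + w.im))
          linarith

/-- The regularised cosine kernel; it equals `cos (π (z - w) / 2)` at `ε = 0`. -/
noncomputable def cosKernel (ε : ℝ) (z w : ℂ) : ℂ :=
  1 / 2 * ((ε - Complex.I) ^ (-z) * (ε + Complex.I) ^ (-w) +
    (ε + Complex.I) ^ (-z) * (ε - Complex.I) ^ (-w))

theorem cosKernel_zero (z w : ℂ) : cosKernel 0 z w = Complex.cos (Real.pi * (z - w) / 2) := by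
  have h1 : ∀ z : ℂ, (-Complex.I) ^ (-z) = Complex.exp (Real.pi / 2 * z * Complex.I) := fun z => by
    rw [Complex.cpow_def_of_ne_zero (neg_ne_zero.2 Complex.I_ne_zero), Complex.log_neg_I]
    ring_nf
  have h2 : ∀ z : ℂ, Complex.I ^ (-z) = Complex.exp (-(Real.pi / 2 * z * Complex.I)) := fun z => by
    rw [Complex.cpow_def_of_ne_zero Complex.I_ne_zero, Complex.log_I]
    ring_nf
  unfold cosKernel
  rw [Complex.ofReal_zero, zero_sub, zero_add, h1, h1, h2, h2, ← Complex.exp_add, ← Complex.exp_add,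
    Complex.cos]
  ring_nf

theorem norm_add_mul_I_bounds {ε : ℝ} (h0 : 0 ≤ ε) (h1 : ε ≤ 1) {s : ℂ}
    (hs : s = ε - Complex.I ∨ s = ε + Complex.I) : 1 ≤ ‖s‖ ∧ ‖s‖ ≤ 2 ∧ 0 ≤ s.re ∧ s.im ≠ 0 := by
  have hi : |s.im| = 1 := by rcases hs with rfl | rfl <;> simp
  have hr : s.re = ε := by rcases hs with rfl | rfl <;> simp
  have e1 := Complex.abs_im_le_norm s
  have e2 := Complex.norm_le_abs_re_add_abs_im s
  rw [hi] at e1 e2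
  rw [hr, abs_of_nonneg h0] at e2
  exact ⟨e1, by linarith, by rw [hr]; exact h0, fun h => by rw [h] at hi; simp at hi⟩

/-- Since ε ± i has modulus in [1, 2] and argument at most π/2 in absolute value, the bound is
uniform in ε, with exactly the exponential that Γ absorbs. -/
theorem norm_cpow_neg_le_exp {c₁ c₂ : ℝ} (hc₁ : c₁ < 0) (hc₂ : 0 < c₂) {ε : ℝ} (h0 : 0 ≤ ε)
    (h1 : ε ≤ 1) {s : ℂ} (hs : s = ε - Complex.I ∨ s = ε + Complex.I) {z : ℂ} (hz1 : c₁ ≤ z.re)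
    (hz2 : z.re ≤ c₂) :
    ‖s ^ (-z)‖ ≤ ((2 : ℝ) ^ (-c₁) + 1) * Real.exp (Real.pi / 2 * |z.im|) := by
  obtain ⟨n1, n2, n3, n4⟩ := norm_add_mul_I_bounds h0 h1 hs
  have hs0 : s ≠ 0 := fun h => by simp [h] at n4
  have e1 : ‖s‖ ^ (-c₁) ≤ (2 : ℝ) ^ (-c₁) :=
    Real.rpow_le_rpow (norm_nonneg _) n2 (by linarith)
  have e2 : ‖s‖ ^ (-c₂) ≤ 1 := Real.rpow_le_one_of_one_le_of_nonpos n1 (by linarith)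
  have e3 : |s.arg| ≤ Real.pi / 2 := Complex.abs_arg_le_pi_div_two_iff.2 n3
  refine (norm_cpow_neg_le hs0 hz1 hz2).trans ?_
  gcongr

theorem norm_cosKernel_le {c₁ c₂ : ℝ} (hc₁ : c₁ < 0) (hc₂ : 0 < c₂) {ε : ℝ} (h0 : 0 ≤ ε)
    (h1 : ε ≤ 1) {z w : ℂ} (hz1 : c₁ ≤ z.re) (hz2 : z.re ≤ c₂) (hw1 : c₁ ≤ w.re)
    (hw2 : w.re ≤ c₂) : ‖cosKernel ε z w‖ ≤ ((2 : ℝ) ^ (-c₁) + 1) ^ 2 *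
      (Real.exp (Real.pi / 2 * |z.im|) * Real.exp (Real.pi / 2 * |w.im|)) := by
  set Q := (2 : ℝ) ^ (-c₁) + 1
  have a1 := norm_cpow_neg_le_exp hc₁ hc₂ h0 h1 (Or.inl rfl) hz1 hz2
  have a2 := norm_cpow_neg_le_exp hc₁ hc₂ h0 h1 (Or.inr rfl) hz1 hz2
  have b1 := norm_cpow_neg_le_exp hc₁ hc₂ h0 h1 (Or.inl rfl) hw1 hw2
  have b2 := norm_cpow_neg_le_exp hc₁ hc₂ h0 h1 (Or.inr rfl) hw1 hw2
  have hQ : 0 ≤ Q := by positivity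
  unfold cosKernel
  rw [norm_mul]
  have hh : ‖(1 / 2 : ℂ)‖ = 1 / 2 := by simp
  rw [hh]
  set X := Real.exp (Real.pi / 2 * |z.im|)
  set Y := Real.exp (Real.pi / 2 * |w.im|)
  calc _ ≤ 1 / 2 * ((Q * X) * (Q * Y) + (Q * X) * (Q * Y)) := by
        gcongr
        refine (norm_add_le _ _).trans ?_
        rw [norm_mul, norm_mul]
        gcongr
    _ = _ := by ring

theorem continuous_cosKernel {ε : ℝ} (h0 : 0 ≤ ε) (h1 : ε ≤ 1) :
    Continuous fun p : ℂ × ℂ => cosKernel ε p.1 p.2 := by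
  have key : ∀ s : ℂ, (s = ε - Complex.I ∨ s = ε + Complex.I) →
      Continuous fun z : ℂ => s ^ (-z) := fun s hs => by
    obtain ⟨n1, n2, n3, n4⟩ := norm_add_mul_I_bounds h0 h1 hs
    have hs0 : s ≠ 0 := fun h => by simp [h] at n4
    exact continuous_neg.const_cpow (Or.inl hs0)
  have k1 := key _ (Or.inl rfl)
  have k2 := key _ (Or.inr rfl)
  unfold cosKernel
  exact continuous_const.mul (((k1.comp continuous_fst).mul (k2.comp continuous_snd)).add
    ((k2.comp continuous_fst).mul (k1.comp continuous_snd)))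

theorem tendsto_cosKernel (z w : ℂ) : Filter.Tendsto (fun ε => cosKernel ε z w)
    (nhdsWithin 0 (Ioi 0)) (nhds (cosKernel 0 z w)) := by
  have k1 : ∀ z : ℂ, ContinuousAt (fun ε : ℝ => ((ε : ℂ) - Complex.I) ^ (-z)) 0 := fun z =>
    ContinuousAt.cpow (by fun_prop) continuousAt_const (by simp [Complex.mem_slitPlane_iff])
  have k2 : ∀ z : ℂ, ContinuousAt (fun ε : ℝ => ((ε : ℂ) + Complex.I) ^ (-z)) 0 := fun z =>
    ContinuousAt.cpow (by fun_prop) continuousAt_const (by simp [Complex.mem_slitPlane_iff])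
  have : ContinuousAt (fun ε => cosKernel ε z w) 0 := by
    unfold cosKernel
    exact continuousAt_const.mul (((k1 z).mul (k2 w)).add ((k2 z).mul (k1 w)))
  exact this.tendsto.mono_left nhdsWithin_le_nhds

/-- The integrand of the double integral, with regularised cosine kernel. -/
noncomputable def doubleIntegrand (φ : ℝ → ℂ) (α β ε : ℝ) (z w : ℂ) : ℂ :=
  Complex.Gamma z * (α : ℂ) ^ (-z) *
    (Complex.Gamma w * (β : ℂ) ^ (-w) * halfMellin φ (z + w) * cosKernel ε z w)

section

variable {φ φ₁ φ₂ : ℝ → ℂ} {C c₁ c₂ B α β : ℝ}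

/-- The exponential growth of the kernel cancels against the Gamma factors. Uniformity down to ε = 0
gives both the absolute convergence claimed in the theorem and the majorant for the limit. -/
theorem IsDecayingTransform.exists_norm_doubleIntegrand_le (h : IsDecayingTransform φ φ₁ φ₂ C)
    (hα : 0 < α) (hβ : 0 < β) (hc₁ : -3 / 2 < c₁) (hc₁' : c₁ < 0)
    (hc₂ : 0 < c₂) (hc₂' : c₂ < 1 / 2) (hB : 0 < B) : ∃ r K : ℝ, 1 < r ∧ 0 ≤ K ∧
      ∀ ε, 0 ≤ ε → ε ≤ 1 → ∀ z ∈ bentLine c₁ c₂ B, ∀ w ∈ bentLine c₁ c₂ B,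
      ‖doubleIntegrand φ α β ε z w‖ ≤ K * bracketTriple r z.im w.im := by
  obtain ⟨r, K, hr, hK0, hK⟩ := h.exists_bracketTriple_le hc₁ hc₁' hc₂ hc₂'
  obtain ⟨D, hD0, hD⟩ := exists_norm_Gamma_le_bentLine hc₁ hc₁' hc₂ hc₂' hB
  set Q := (2 : ℝ) ^ (-c₁) + 1
  set A := α ^ (-c₁) + α ^ (-c₂)
  set A' := β ^ (-c₁) + β ^ (-c₂)
  have hA0 : 0 ≤ A := by positivity
  have hA0' : 0 ≤ A' := by positivity
  refine ⟨r, A * A' * Q ^ 2 * D ^ 2 * K, hr, by positivity, fun ε h0 h1 z hz w hw => ?_⟩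
  have hcc := (hc₁'.trans hc₂).le
  obtain ⟨z1, z2, -⟩ := bentLine_subset_bentRegion hcc hz
  obtain ⟨w1, w2, -⟩ := bentLine_subset_bentRegion hcc hw
  have e1 := hD z hz
  have e2 := hD w hw
  have e3 := hK z w z1 z2 w1 w2
  have e4 := norm_cosKernel_le hc₁' hc₂ h0 h1 z1 z2 w1 w2
  have e5 : ‖(α : ℂ) ^ (-z)‖ ≤ A := by
    rw [Complex.norm_cpow_eq_rpow_re_of_pos hα, Complex.neg_re]
    exact rpow_neg_le_add hα z1 z2
  have e6 : ‖(β : ℂ) ^ (-w)‖ ≤ A' := by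
    rw [Complex.norm_cpow_eq_rpow_re_of_pos hβ, Complex.neg_re]
    exact rpow_neg_le_add hβ w1 w2
  unfold doubleIntegrand
  simp only [norm_mul]
  set X := Real.exp (Real.pi / 2 * |z.im|)
  set Y := Real.exp (Real.pi / 2 * |w.im|)
  have p1 := bracket_nonneg (1 / 2 - c₁) z.im
  have p2 := bracket_nonneg (1 / 2 - c₁) w.im
  calc ‖Complex.Gamma z‖ * ‖(α : ℂ) ^ (-z)‖ *
        (‖Complex.Gamma w‖ * ‖(β : ℂ) ^ (-w)‖ * ‖halfMellin φ (z + w)‖ * ‖cosKernel ε z w‖)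
      ≤ ‖Complex.Gamma z‖ * A * (‖Complex.Gamma w‖ * A' * ‖halfMellin φ (z + w)‖ *
        (Q ^ 2 * (X * Y))) := by gcongr
    _ = A * A' * Q ^ 2 * ((‖Complex.Gamma z‖ * X) * (‖Complex.Gamma w‖ * Y) *
        ‖halfMellin φ (z + w)‖) := by ring
    _ ≤ A * A' * Q ^ 2 * ((D * bracket (1 / 2 - c₁) z.im) * (D * bracket (1 / 2 - c₁) w.im) *
        ‖halfMellin φ (z + w)‖) := by gcongr
    _ = A * A' * Q ^ 2 * D ^ 2 * (bracket (1 / 2 - c₁) z.im * bracket (1 / 2 - c₁) w.im *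
        ‖halfMellin φ (z + w)‖) := by ring
    _ ≤ A * A' * Q ^ 2 * D ^ 2 * (K * bracketTriple r z.im w.im) := by gcongr
    _ = _ := by ring

theorem continuousOn_Gamma_bentLine (hc₁' : c₁ < 0) (hc₂ : 0 < c₂) (hB : 0 < B) :
    ContinuousOn Complex.Gamma (bentLine c₁ c₂ B) := fun _ hz =>
  (differentiableAt_Gamma_of_mem_bentRegion hc₂ hB
    (bentLine_subset_bentRegion (hc₁'.trans hc₂).le hz)).continuousAt.continuousWithinAt

theorem IsDecayingTransform.continuousOn_doubleIntegrand (h : IsDecayingTransform φ φ₁ φ₂ C)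
    (hα : 0 < α) (hβ : 0 < β) (hc₁ : -3 / 2 < c₁) (hc₁' : c₁ < 0)
    (hc₂ : 0 < c₂) (hc₂' : c₂ < 1 / 2) (hB : 0 < B) {ε : ℝ} (h0 : 0 ≤ ε) (h1 : ε ≤ 1) :
    ContinuousOn (fun p : ℂ × ℂ => doubleIntegrand φ α β ε p.1 p.2)
      (bentLine c₁ c₂ B ×ˢ bentLine c₁ c₂ B) := by
  have hG := continuousOn_Gamma_bentLine hc₁' hc₂ hB
  have g1 : ContinuousOn (fun p : ℂ × ℂ => Complex.Gamma p.1)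
      (bentLine c₁ c₂ B ×ˢ bentLine c₁ c₂ B) := hG.comp continuousOn_fst fun p hp => hp.1
  have g2 : ContinuousOn (fun p : ℂ × ℂ => Complex.Gamma p.2)
      (bentLine c₁ c₂ B ×ˢ bentLine c₁ c₂ B) := hG.comp continuousOn_snd fun p hp => hp.2
  have q1 : Continuous fun p : ℂ × ℂ => (α : ℂ) ^ (-p.1) :=
    continuous_fst.neg.const_cpow (Or.inl (by exact_mod_cast hα.ne'))
  have q2 : Continuous fun p : ℂ × ℂ => (β : ℂ) ^ (-p.2) :=
    continuous_snd.neg.const_cpow (Or.inl (by exact_mod_cast hβ.ne'))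
  have m : ContinuousOn (fun p : ℂ × ℂ => halfMellin φ (p.1 + p.2))
      (bentLine c₁ c₂ B ×ˢ bentLine c₁ c₂ B) := by
    refine h.differentiableOn.continuousOn.comp (f := fun p : ℂ × ℂ => p.1 + p.2)
      (by fun_prop) fun p hp => ?_
    have hcc := (hc₁'.trans hc₂).le
    obtain ⟨z1, z2, -⟩ := bentLine_subset_bentRegion hcc hp.1
    obtain ⟨w1, w2, -⟩ := bentLine_subset_bentRegion hcc hp.2
    show -3 < (p.1 + p.2).re ∧ (p.1 + p.2).re < 1
    rw [Complex.add_re]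
    constructor <;> linarith
  unfold doubleIntegrand
  exact (g1.mul q1.continuousOn).mul
    (((g2.mul q2.continuousOn).mul m).mul (continuous_cosKernel h0 h1).continuousOn)

theorem IsDecayingTransform.integrable_doubleIntegrand (h : IsDecayingTransform φ φ₁ φ₂ C)
    (hα : 0 < α) (hβ : 0 < β) (hc₁ : -3 / 2 < c₁) (hc₁' : c₁ < 0)
    (hc₂ : 0 < c₂) (hc₂' : c₂ < 1 / 2) (hB : 0 < B) {ε : ℝ} (h0 : 0 ≤ ε) (h1 : ε ≤ 1) :
    Integrable (fun p : ℂ × ℂ => doubleIntegrand φ α β ε p.1 p.2)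
      ((bentLineMeasure c₁ c₂ B).prod (bentLineMeasure c₁ c₂ B)) := by
  obtain ⟨r, K, hr, hK0, hK⟩ := h.exists_norm_doubleIntegrand_le hα hβ hc₁ hc₁' hc₂ hc₂' hB
  refine ((integrable_bracketTriple c₁ c₂ B hr).const_mul K).mono'
    (aestronglyMeasurable_prod_bentLine hB.le
      (h.continuousOn_doubleIntegrand hα hβ hc₁ hc₁' hc₂ hc₂' hB h0 h1)) ?_
  filter_upwards [Measure.quasiMeasurePreserving_fst.ae (ae_mem_bentLine hB.le),
    Measure.quasiMeasurePreserving_snd.ae (ae_mem_bentLine hB.le)] with p hp1 hp2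
  exact hK ε h0 h1 _ hp1 _ hp2

/-- The inner integrand is integrable along the path. -/
theorem IsDecayingTransform.integrable_inner (h : IsDecayingTransform φ φ₁ φ₂ C)
    (hβ : 0 < β) (hc₁ : -3 / 2 < c₁) (hc₁' : c₁ < 0)
    (hc₂ : 0 < c₂) (hc₂' : c₂ < 1 / 2) (hB : 0 < B) {z : ℂ} (hz : z ∈ bentLine c₁ c₂ B) :
    Integrable (fun w : ℂ => Complex.Gamma w * (β : ℂ) ^ (-w) *
        halfMellin φ (z + w) * Complex.cos (Real.pi * (z - w) / 2))
        (bentLineMeasure c₁ c₂ B) := by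
  obtain ⟨r, K, hr, hK0, hK⟩ := h.exists_norm_doubleIntegrand_le (one_pos) hβ hc₁ hc₁' hc₂ hc₂' hB
  -- The inner integrand is the double integrand at α = 1, ε = 0 divided by Γ(z), which has no
  -- zeros.
  have hG : Complex.Gamma z ≠ 0 := by
    apply Complex.Gamma_ne_zero
    rintro m rfl
    obtain ⟨z1, z2, z3⟩ := bentLine_subset_bentRegion (hc₁'.trans hc₂).le hz
    rcases z3 with z3 | z3
    · simp at z3; linarith
    · have : (0 : ℝ) ≤ m := by positivity
      simp at z3
      linarith
  have hi : Integrable (fun w : ℂ => doubleIntegrand φ 1 β 0 z w) (bentLineMeasure c₁ c₂ B) := by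
    refine ((integrable_bracketTriple_right c₁ c₂ B hr z.im).const_mul K).mono'
      (aestronglyMeasurable_bentLine hB.le ?_) ?_
    · exact (h.continuousOn_doubleIntegrand one_pos hβ hc₁ hc₁' hc₂ hc₂' hB le_rfl
        zero_le_one).comp (f := fun w : ℂ => (z, w)) (by fun_prop) fun w hw => ⟨hz, hw⟩
    · filter_upwards [ae_mem_bentLine hB.le] with w hw
      exact hK 0 le_rfl zero_le_one z hz w hw
  refine (hi.const_mul (Complex.Gamma z)⁻¹).congr (.of_forall fun w => ?_)
  unfold doubleIntegrand
  simp only [Complex.ofReal_one, Complex.one_cpow, mul_one, cosKernel_zero]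
  field_simp

/-! ### Parseval's formula in the right half-plane -/

theorem ofReal_mul_cpow {r : ℝ} (hr : 0 < r) {s : ℂ} (hs : s ≠ 0) (z : ℂ) :
    ((r : ℂ) * s) ^ z = (r : ℂ) ^ z * s ^ z := by
  have hr' : (r : ℂ) ≠ 0 := by exact_mod_cast hr.ne'
  rw [Complex.cpow_def_of_ne_zero (mul_ne_zero hr' hs), Complex.cpow_def_of_ne_zero hr',
    Complex.cpow_def_of_ne_zero hs, Complex.log_ofReal_mul hr hs, Complex.ofReal_log hr.le,
    add_mul, Complex.exp_add]

/-- Parseval formula for a product of two exponentials in the right half plane. -/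
theorem IsDecayingTransform.integral_mul_exp_mul_exp (h : IsDecayingTransform φ φ₁ φ₂ C)
    (hc₁ : -3 / 2 < c₁) (hc₁' : c₁ < 0)
    (hc₂ : 0 < c₂) (hc₂' : c₂ < 1 / 2) (hB : 0 < B) {a b : ℂ} (ha : 0 < a.re) (hb : 0 < b.re) :
    Integrable (fun p : ℂ × ℂ => (bentTangent c₁ c₂ p.1 * (Complex.Gamma p.1 * a ^ (-p.1))) *
        (bentTangent c₁ c₂ p.2 * (Complex.Gamma p.2 * b ^ (-p.2))) * halfMellin φ (p.1 + p.2))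
      ((bentLineMeasure c₁ c₂ B).prod (bentLineMeasure c₁ c₂ B)) ∧
    (1 / Real.pi : ℂ) * ∫ t in Ioi (0 : ℝ), φ t * (Complex.exp (-(a * t)) * Complex.exp (-(b * t)))
      = (1 / (2 * Real.pi * Complex.I) : ℂ) ^ 2 *
        ∫ p : ℂ × ℂ, (bentTangent c₁ c₂ p.1 * (Complex.Gamma p.1 * a ^ (-p.1))) *
          (bentTangent c₁ c₂ p.2 * (Complex.Gamma p.2 * b ^ (-p.2))) * halfMellin φ (p.1 + p.2)
          ∂((bentLineMeasure c₁ c₂ B).prod (bentLineMeasure c₁ c₂ B)) := by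
  have hcc := (hc₁'.trans hc₂).le
  have ha0 : a ≠ 0 := fun h => by simp [h] at ha
  have hb0 : b ≠ 0 := fun h => by simp [h] at hb
  set μ := bentLineMeasure c₁ c₂ B with hμ
  set ν := (volume : Measure ℝ).restrict (Ioi 0) with hν
  set f : ℂ → ℂ := fun z => bentTangent c₁ c₂ z * (Complex.Gamma z * a ^ (-z)) with hf
  set g : ℂ → ℂ := fun z => bentTangent c₁ c₂ z * (Complex.Gamma z * b ^ (-z)) with hg
  have hfi : Integrable f μ :=
    (exp_neg_eq_bentLineIntegral hc₁ hc₁' hc₂ hc₂' hB ha).1.bentTangent_mul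
  have hgi : Integrable g μ :=
    (exp_neg_eq_bentLineIntegral hc₁ hc₁' hc₂ hc₂' hB hb).1.bentTangent_mul
  have hrep : ∀ {a : ℂ}, 0 < a.re → ∀ t : ℝ, 0 < t → Complex.exp (-(a * t)) =
      (1 / (2 * Real.pi * Complex.I) : ℂ) *
        ∫ z, (bentTangent c₁ c₂ z * (Complex.Gamma z * a ^ (-z))) * (t : ℂ) ^ (-z) ∂μ := by
    intro a ha t ht
    have ha0 : a ≠ 0 := fun h => by simp [h] at ha
    have hre : 0 < (a * t).re := by simpa using mul_pos ha ht
    obtain ⟨e1, e2⟩ := exp_neg_eq_bentLineIntegral hc₁ hc₁' hc₂ hc₂' hB hre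
    rw [e2, bentLineIntegral_eq hcc hB e1]
    congr 1
    refine integral_congr_ae (.of_forall fun z => ?_)
    beta_reduce
    rw [mul_comm a, ofReal_mul_cpow ht ha0]
    ring
  -- Integrating H over t first produces the Mellin transform at z + w; integrating over (z, w)
  -- first produces the two exponentials.
  set H : (ℂ × ℂ) × ℝ → ℂ := fun q => (f q.1.1 * g q.1.2) * (φ q.2 * (q.2 : ℂ) ^ (-(q.1.1 + q.1.2)))
    with hH
  -- The exponent -Re(z+w) lies between -2c₂ > -1 and -2c₁ < 3, so the endpoint powers dominate
  -- uniformly on the path.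
  have hdom : Integrable (fun t : ℝ => C * (bracket 4 t * t ^ (-(2 * c₁)) +
      bracket 4 t * t ^ (-(2 * c₂)))) ν :=
    ((integrableOn_bracket_mul_rpow (by linarith) (by linarith)).add
      (integrableOn_bracket_mul_rpow (by linarith) (by linarith))).const_mul C
  have hHi : Integrable H ((μ.prod μ).prod ν) := by
    refine ((hfi.norm.mul_prod hgi.norm).mul_prod hdom).mono' ?_ ?_
    · refine AEStronglyMeasurable.mul ((hfi.mul_prod hgi).1.comp_fst) ?_
      refine Measurable.aestronglyMeasurable ?_
      have := h.continuous_zero.measurable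
      exact (this.comp measurable_snd).mul
        ((Complex.measurable_ofReal.comp measurable_snd).pow (by fun_prop))
    · have a1 : ∀ᵐ p ∂(μ.prod μ), p.1 ∈ bentLine c₁ c₂ B :=
        Measure.quasiMeasurePreserving_fst.ae (ae_mem_bentLine hB.le)
      have a2 : ∀ᵐ p ∂(μ.prod μ), p.2 ∈ bentLine c₁ c₂ B :=
        Measure.quasiMeasurePreserving_snd.ae (ae_mem_bentLine hB.le)
      have a3 : ∀ᵐ t ∂ν, t ∈ Ioi (0 : ℝ) := ae_restrict_mem measurableSet_Ioi
      filter_upwards [Measure.quasiMeasurePreserving_fst.ae a1,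
        Measure.quasiMeasurePreserving_fst.ae a2,
        Measure.quasiMeasurePreserving_snd.ae a3] with q h1 h2 h3
      obtain ⟨z1, z2, -⟩ := bentLine_subset_bentRegion hcc h1
      obtain ⟨w1, w2, -⟩ := bentLine_subset_bentRegion hcc h2
      simp only [hH, norm_mul (f q.1.1 * g q.1.2), norm_mul (f q.1.1)]
      refine mul_le_mul_of_nonneg_left ?_ (mul_nonneg (norm_nonneg _) (norm_nonneg _))
      refine (norm_mul_cpow_le h.norm_le _ h3).trans ?_
      rw [Complex.neg_re, Complex.add_re, ← mul_add]
      have e := rpow_neg_le_add (c₁ := 2 * c₁) (c₂ := 2 * c₂) (x := q.1.1.re + q.1.2.re) h3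
        (by linarith) (by linarith)
      have := bracket_nonneg 4 q.2
      have := h.const_nonneg
      gcongr
  have hpi : (1 / Real.pi : ℂ) ≠ 0 := by
    have : (Real.pi : ℂ) ≠ 0 := by exact_mod_cast Real.pi_ne_zero
    exact one_div_ne_zero this
  have hinner : ∀ p : ℂ × ℂ, f p.1 * g p.2 * halfMellin φ (p.1 + p.2) =
      (1 / Real.pi : ℂ) * ∫ t, H (p, t) ∂ν := fun p => by
    simp only [hH]
    rw [integral_const_mul, halfMellin]
    ring
  constructor
  · refine (hHi.integral_prod_left.const_mul (1 / Real.pi : ℂ)).congr (.of_forall fun p => ?_)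
    exact (hinner p).symm
  · refine Eq.trans ?_ (congrArg (fun X : ℂ => (1 / (2 * Real.pi * Complex.I) : ℂ) ^ 2 * X)
      (integral_congr_ae (.of_forall hinner)).symm)
    rw [integral_const_mul, integral_integral_swap (f := fun p t => H (p, t)) hHi,
      mul_left_comm]
    congr 1
    rw [← integral_const_mul]
    refine setIntegral_congr_fun measurableSet_Ioi fun t ht => ?_
    rw [hrep ha t ht, hrep hb t ht]
    have e : ∫ p : ℂ × ℂ, H (p, t) ∂(μ.prod μ) = φ t *
        ((∫ z, f z * (t : ℂ) ^ (-z) ∂μ) * ∫ w, g w * (t : ℂ) ^ (-w) ∂μ) := by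
      rw [← integral_prod_mul, ← integral_const_mul]
      refine integral_congr_ae (.of_forall fun p => ?_)
      have ht0 : (t : ℂ) ≠ 0 := by exact_mod_cast (ne_of_gt ht : t ≠ 0)
      simp only [hH]
      rw [neg_add, Complex.cpow_add _ _ ht0]
      ring
    rw [e]
    ring

end

/-! ### Regularisation, the limit ε → 0, and the iterated integral -/

section

variable {φ φ₁ φ₂ : ℝ → ℂ} {C c₁ c₂ B α β : ℝ}

theorem IsDecayingTransform.integrableOn_mul_bounded (h : IsDecayingTransform φ φ₁ φ₂ C)
    {f : ℝ → ℂ} (hf : Continuous f) (hb : ∀ t : ℝ, 0 < t → ‖f t‖ ≤ 1) :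
    IntegrableOn (fun t => φ t * f t) (Ioi 0) := by
  have h0 := h.integrableOn (z := 0) (by simp) (by simp)
  simp only [neg_zero, Complex.cpow_zero, mul_one] at h0
  refine h0.mul_bdd (c := 1) hf.aestronglyMeasurable ?_
  filter_upwards [ae_restrict_mem measurableSet_Ioi] with t ht
  exact hb t ht

theorem norm_exp_neg_mul_le_one {a : ℂ} (ha : 0 ≤ a.re) {t : ℝ} (ht : 0 < t) :
    ‖Complex.exp (-(a * t))‖ ≤ 1 := by
  rw [Complex.norm_exp, Real.exp_le_one_iff]
  simpa using mul_nonneg ha ht.le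

/-- The product of the regularised exponentials. -/
noncomputable def regularizedCos (α β ε t : ℝ) : ℂ :=
  1 / 2 * (Complex.exp (-(α * (ε - Complex.I) * t)) * Complex.exp (-(β * (ε + Complex.I) * t)) +
    Complex.exp (-(α * (ε + Complex.I) * t)) * Complex.exp (-(β * (ε - Complex.I) * t)))

theorem norm_regularizedCos_le (hα : 0 < α) (hβ : 0 < β) {ε : ℝ} (h0 : 0 ≤ ε) {t : ℝ} (ht : 0 < t) :
    ‖regularizedCos α β ε t‖ ≤ 1 := by
  have k : ∀ {r : ℝ}, 0 < r → 0 ≤ (r * (ε - Complex.I) : ℂ).re ∧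
      0 ≤ (r * (ε + Complex.I) : ℂ).re := fun {r} hr => by
    simp; positivity
  have a1 := norm_exp_neg_mul_le_one (k hα).1 ht
  have a2 := norm_exp_neg_mul_le_one (k hα).2 ht
  have b1 := norm_exp_neg_mul_le_one (k hβ).1 ht
  have b2 := norm_exp_neg_mul_le_one (k hβ).2 ht
  unfold regularizedCos
  rw [norm_mul]
  have hh : ‖(1 / 2 : ℂ)‖ = 1 / 2 := by simp
  rw [hh]
  calc _ ≤ 1 / 2 * ((1 : ℝ) * 1 + 1 * 1) := by
        gcongr
        refine (norm_add_le _ _).trans ?_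
        rw [norm_mul, norm_mul]
        gcongr
    _ = 1 := by norm_num

/-- Parseval's formula is applied to the pairs α(ε ∓ i), β(ε ± i) and averaged; factoring the
positive numbers α, β out of the complex powers leaves `cosKernel`. -/
theorem IsDecayingTransform.regularized_identity (h : IsDecayingTransform φ φ₁ φ₂ C)
    (hα : 0 < α) (hβ : 0 < β) (hc₁ : -3 / 2 < c₁) (hc₁' : c₁ < 0)
    (hc₂ : 0 < c₂) (hc₂' : c₂ < 1 / 2) (hB : 0 < B) {ε : ℝ} (hε : 0 < ε) :
    (1 / Real.pi : ℂ) * ∫ t in Ioi (0 : ℝ), φ t * regularizedCos α β ε t =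
      (1 / (2 * Real.pi * Complex.I) : ℂ) ^ 2 *
        ∫ p : ℂ × ℂ, bentTangent c₁ c₂ p.1 * bentTangent c₁ c₂ p.2 *
          doubleIntegrand φ α β ε p.1 p.2
          ∂((bentLineMeasure c₁ c₂ B).prod (bentLineMeasure c₁ c₂ B)) := by
  have k : ∀ {r : ℝ}, 0 < r → 0 < (r * (ε - Complex.I) : ℂ).re ∧
      0 < (r * (ε + Complex.I) : ℂ).re := fun {r} hr => by
    simp; positivity
  obtain ⟨i1, e1⟩ := h.integral_mul_exp_mul_exp hc₁ hc₁' hc₂ hc₂' hB (k hα).1 (k hβ).2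
  obtain ⟨i2, e2⟩ := h.integral_mul_exp_mul_exp hc₁ hc₁' hc₂ hc₂' hB (k hα).2 (k hβ).1
  have hint : ∀ {a b : ℂ}, 0 ≤ a.re → 0 ≤ b.re → IntegrableOn (fun t : ℝ =>
      φ t * (Complex.exp (-(a * t)) * Complex.exp (-(b * t)))) (Ioi 0) := fun {a b} ha hb => by
    refine h.integrableOn_mul_bounded (by fun_prop) fun t ht => ?_
    rw [norm_mul]
    exact mul_le_one₀ (norm_exp_neg_mul_le_one ha ht) (norm_nonneg _)
      (norm_exp_neg_mul_le_one hb ht)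
  have hL : ∫ t in Ioi (0 : ℝ), φ t * regularizedCos α β ε t = 1 / 2 *
      ((∫ t in Ioi (0 : ℝ), φ t * (Complex.exp (-(α * (ε - Complex.I) * t)) *
        Complex.exp (-(β * (ε + Complex.I) * t)))) +
      ∫ t in Ioi (0 : ℝ), φ t * (Complex.exp (-(α * (ε + Complex.I) * t)) *
        Complex.exp (-(β * (ε - Complex.I) * t)))) := by
    rw [← integral_add (hint (k hα).1.le (k hβ).2.le) (hint (k hα).2.le (k hβ).1.le),
      ← integral_const_mul]
    refine integral_congr_ae (.of_forall fun t => ?_)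
    beta_reduce
    unfold regularizedCos
    ring
  have hn1 : (ε - Complex.I : ℂ) ≠ 0 := fun h => by
    have := congrArg Complex.im h; simp at this
  have hn2 : (ε + Complex.I : ℂ) ≠ 0 := fun h => by
    have := congrArg Complex.im h; simp at this
  have hadd := integral_add i1 i2
  rw [hL, mul_left_comm, mul_add, e1, e2, ← mul_add, ← hadd, mul_left_comm]
  congr 1
  rw [← integral_const_mul]
  refine integral_congr_ae (.of_forall fun p => ?_)
  beta_reduce
  unfold doubleIntegrand cosKernel
  rw [ofReal_mul_cpow hα hn1, ofReal_mul_cpow hα hn2, ofReal_mul_cpow hβ hn1,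
    ofReal_mul_cpow hβ hn2]
  ring

/-- Dominated convergence on both sides, with majorant |φ| in t and the multiple of `bracketTriple`
on the product of the paths. -/
theorem IsDecayingTransform.limit_identity (h : IsDecayingTransform φ φ₁ φ₂ C)
    (hα : 0 < α) (hβ : 0 < β) (hc₁ : -3 / 2 < c₁) (hc₁' : c₁ < 0)
    (hc₂ : 0 < c₂) (hc₂' : c₂ < 1 / 2) (hB : 0 < B) :
    (1 / Real.pi : ℂ) * ∫ t in Ioi (0 : ℝ), φ t * regularizedCos α β 0 t =
      (1 / (2 * Real.pi * Complex.I) : ℂ) ^ 2 *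
        ∫ p : ℂ × ℂ, bentTangent c₁ c₂ p.1 * bentTangent c₁ c₂ p.2 *
          doubleIntegrand φ α β 0 p.1 p.2
          ∂((bentLineMeasure c₁ c₂ B).prod (bentLineMeasure c₁ c₂ B)) := by
  obtain ⟨r, K, hr, hK0, hK⟩ := h.exists_norm_doubleIntegrand_le hα hβ hc₁ hc₁' hc₂ hc₂' hB
  have hev : ∀ᶠ ε : ℝ in nhdsWithin 0 (Ioi 0), ε ∈ Ioc (0 : ℝ) 1 := Ioc_mem_nhdsGT one_pos
  have hcr : ∀ ε, Continuous fun t => regularizedCos α β ε t := fun ε => by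
    unfold regularizedCos; fun_prop
  have hcr' : ∀ t, Continuous fun ε => regularizedCos α β ε t := fun t => by
    unfold regularizedCos; fun_prop
  have l1 : Filter.Tendsto (fun ε => ∫ t in Ioi (0 : ℝ), φ t * regularizedCos α β ε t)
      (nhdsWithin 0 (Ioi 0)) (nhds (∫ t in Ioi (0 : ℝ), φ t * regularizedCos α β 0 t)) := by
    have h0 := h.integrableOn (z := 0) (by simp) (by simp)
    simp only [neg_zero, Complex.cpow_zero, mul_one] at h0
    refine tendsto_integral_filter_of_dominated_convergence (fun t => ‖φ t‖) ?_ ?_ h0.norm ?_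
    · exact .of_forall fun ε => (h.continuous_zero.mul (hcr ε)).aestronglyMeasurable
    · filter_upwards [hev] with ε hε
      filter_upwards [ae_restrict_mem measurableSet_Ioi] with t ht
      rw [norm_mul]
      exact mul_le_of_le_one_right (norm_nonneg _) (norm_regularizedCos_le hα hβ hε.1.le ht)
    · exact .of_forall fun t => (((hcr' t).tendsto 0).mono_left nhdsWithin_le_nhds).const_mul _
  have l2 : Filter.Tendsto (fun ε => ∫ p : ℂ × ℂ, bentTangent c₁ c₂ p.1 * bentTangent c₁ c₂ p.2 *
          doubleIntegrand φ α β ε p.1 p.2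
          ∂((bentLineMeasure c₁ c₂ B).prod (bentLineMeasure c₁ c₂ B)))
      (nhdsWithin 0 (Ioi 0)) (nhds (∫ p : ℂ × ℂ, bentTangent c₁ c₂ p.1 * bentTangent c₁ c₂ p.2 *
          doubleIntegrand φ α β 0 p.1 p.2
          ∂((bentLineMeasure c₁ c₂ B).prod (bentLineMeasure c₁ c₂ B)))) := by
    refine tendsto_integral_filter_of_dominated_convergence
      (fun p => K * bracketTriple r p.1.im p.2.im) ?_ ?_
      ((integrable_bracketTriple c₁ c₂ B hr).const_mul K) ?_
    · filter_upwards [hev] with ε hε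
      have hτ := measurable_bentTangent c₁ c₂
      exact ((hτ.comp measurable_fst).mul (hτ.comp measurable_snd)).aestronglyMeasurable.mul
        (h.integrable_doubleIntegrand hα hβ hc₁ hc₁' hc₂ hc₂' hB hε.1.le hε.2).1
    · filter_upwards [hev] with ε hε
      filter_upwards [Measure.quasiMeasurePreserving_fst.ae (ae_mem_bentLine hB.le),
        Measure.quasiMeasurePreserving_snd.ae (ae_mem_bentLine hB.le)] with p hp1 hp2
      rw [norm_mul, norm_mul, norm_bentTangent, norm_bentTangent, one_mul, one_mul]
      exact hK ε hε.1.le hε.2 _ hp1 _ hp2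
    · refine .of_forall fun p => Filter.Tendsto.const_mul _ ?_
      unfold doubleIntegrand
      exact ((tendsto_cosKernel p.1 p.2).const_mul _).const_mul _
  refine tendsto_nhds_unique (l1.const_mul _) ((l2.const_mul _).congr' ?_)
  filter_upwards [hev] with ε hε
  exact (h.regularized_identity hα hβ hc₁ hc₁' hc₂ hc₂' hB hε.1).symm

theorem regularizedCos_zero (α β t : ℝ) : regularizedCos α β 0 t =
    1 / 2 * (Complex.exp (Complex.I * ((α - β : ℝ) : ℂ) * t) +
      Complex.exp (-(Complex.I * ((α - β : ℝ) : ℂ) * t))) := by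
  unfold regularizedCos
  rw [← Complex.exp_add, ← Complex.exp_add]
  push_cast
  ring_nf

/-- Fubini for the absolutely convergent product integral. The inner identity needs z on the path,
which holds almost everywhere for the arc length measure. -/
theorem IsDecayingTransform.integral_doubleIntegrand_eq (h : IsDecayingTransform φ φ₁ φ₂ C)
    (hα : 0 < α) (hβ : 0 < β) (hc₁ : -3 / 2 < c₁) (hc₁' : c₁ < 0)
    (hc₂ : 0 < c₂) (hc₂' : c₂ < 1 / 2) (hB : 0 < B) :
    (1 / (2 * Real.pi * Complex.I) : ℂ) ^ 2 *
        ∫ p : ℂ × ℂ, bentTangent c₁ c₂ p.1 * bentTangent c₁ c₂ p.2 *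
          doubleIntegrand φ α β 0 p.1 p.2
          ∂((bentLineMeasure c₁ c₂ B).prod (bentLineMeasure c₁ c₂ B)) =
      bentLineIntegral c₁ c₂ B (fun z => Complex.Gamma z * (α : ℂ) ^ (-z) *
        bentLineIntegral c₁ c₂ B (fun w => Complex.Gamma w * (β : ℂ) ^ (-w) *
          halfMellin φ (z + w) * Complex.cos (Real.pi * (z - w) / 2))) := by
  have hcc := (hc₁'.trans hc₂).le
  set μ := bentLineMeasure c₁ c₂ B with hμ
  set κ : ℂ := 1 / (2 * Real.pi * Complex.I) with hκ
  have hi := h.integrable_doubleIntegrand hα hβ hc₁ hc₁' hc₂ hc₂' hB le_rfl zero_le_one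
  have hτ := measurable_bentTangent c₁ c₂
  have hi2 : Integrable (fun p : ℂ × ℂ => bentTangent c₁ c₂ p.2 *
      doubleIntegrand φ α β 0 p.1 p.2) (μ.prod μ) :=
    hi.bdd_mul (c := 1) (hτ.comp measurable_snd).aestronglyMeasurable
      (.of_forall fun p => (norm_bentTangent c₁ c₂ p.2).le)
  have hi3 : Integrable (fun p : ℂ × ℂ => bentTangent c₁ c₂ p.1 * bentTangent c₁ c₂ p.2 *
      doubleIntegrand φ α β 0 p.1 p.2) (μ.prod μ) := by
    have := hi2.bdd_mul (c := 1) (hτ.comp measurable_fst).aestronglyMeasurable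
      (.of_forall fun p => (norm_bentTangent c₁ c₂ p.1).le)
    refine this.congr (.of_forall fun p => ?_)
    simp only [Function.comp]
    ring
  have hinner : ∀ z ∈ bentLine c₁ c₂ B, Complex.Gamma z * (α : ℂ) ^ (-z) *
        bentLineIntegral c₁ c₂ B (fun w => Complex.Gamma w * (β : ℂ) ^ (-w) *
          halfMellin φ (z + w) * Complex.cos (Real.pi * (z - w) / 2)) =
      κ * ∫ w, bentTangent c₁ c₂ w * doubleIntegrand φ α β 0 z w ∂μ := fun z hz => by
    rw [bentLineIntegral_eq hcc hB (h.integrable_inner hβ hc₁ hc₁' hc₂ hc₂' hB hz),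
      mul_left_comm, ← integral_const_mul]
    congr 1
    refine integral_congr_ae (.of_forall fun w => ?_)
    beta_reduce
    rw [doubleIntegrand, cosKernel_zero]
    ring
  have hae : (fun z => Complex.Gamma z * (α : ℂ) ^ (-z) *
        bentLineIntegral c₁ c₂ B (fun w => Complex.Gamma w * (β : ℂ) ^ (-w) *
          halfMellin φ (z + w) * Complex.cos (Real.pi * (z - w) / 2))) =ᵐ[μ]
      fun z => κ * ∫ w, bentTangent c₁ c₂ w * doubleIntegrand φ α β 0 z w ∂μ := by
    filter_upwards [ae_mem_bentLine hB.le] with z hz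
    exact hinner z hz
  have hout : Integrable (fun z => Complex.Gamma z * (α : ℂ) ^ (-z) *
        bentLineIntegral c₁ c₂ B (fun w => Complex.Gamma w * (β : ℂ) ^ (-w) *
          halfMellin φ (z + w) * Complex.cos (Real.pi * (z - w) / 2))) μ :=
    (hi2.integral_prod_left.const_mul κ).congr hae.symm
  rw [bentLineIntegral_eq hcc hB hout, integral_prod _ hi3, pow_two, mul_assoc]
  congr 1
  rw [← integral_const_mul]
  refine integral_congr_ae ?_
  filter_upwards [hae] with z hz
  rw [hz, mul_left_comm]
  congr 1
  rw [← integral_const_mul]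
  refine integral_congr_ae (.of_forall fun w => ?_)
  beta_reduce
  ring

end

theorem proposition4p1 (E : ℝ → ℝ) (hE : IsSmoothSieving E) (lam : ℝ) (hlam : 0 < lam)
    (α β : ℝ) (hα : 0 < α) (hβ : 0 < β)
    (c₁ c₂ B : ℝ) (hc₁ : -3 / 2 < c₁) (hc₁' : c₁ < 0) (hc₂ : 0 < c₂) (hc₂' : c₂ < 1 / 2)
    (hB : 0 < B) :
    -- the integral for `M^lam` converges absolutely and is holomorphic in `-3 < Re Z < 1`
    (∀ Z : ℂ, -3 < Z.re → Z.re < 1 →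
      IntegrableOn (fun t : ℝ => sieveFourier E lam t * (t : ℂ) ^ (-Z)) (Ioi 0)) ∧
    DifferentiableOn ℂ (sieveMellin E lam) {Z : ℂ | -3 < Z.re ∧ Z.re < 1} ∧
    -- absolute convergence of the inner integrals and of the double integral
    (∀ z ∈ bentLine c₁ c₂ B,
      Integrable (fun w : ℂ => Complex.Gamma w * (β : ℂ) ^ (-w) *
        sieveMellin E lam (z + w) * Complex.cos (Real.pi * (z - w) / 2))
        (bentLineMeasure c₁ c₂ B)) ∧
    Integrable (fun p : ℂ × ℂ => Complex.Gamma p.1 * (α : ℂ) ^ (-p.1) *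
        (Complex.Gamma p.2 * (β : ℂ) ^ (-p.2) *
          sieveMellin E lam (p.1 + p.2) * Complex.cos (Real.pi * (p.1 - p.2) / 2)))
      ((bentLineMeasure c₁ c₂ B).prod (bentLineMeasure c₁ c₂ B)) ∧
    -- the representation
    (sieve E lam (α - β) : ℂ) =
      bentLineIntegral c₁ c₂ B (fun z => Complex.Gamma z * (α : ℂ) ^ (-z) *
        bentLineIntegral c₁ c₂ B (fun w => Complex.Gamma w * (β : ℂ) ^ (-w) *
          sieveMellin E lam (z + w) * Complex.cos (Real.pi * (z - w) / 2))) := by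
  obtain ⟨φ₁, φ₂, C, hφ⟩ := hE.isDecayingTransform hlam
  refine ⟨fun Z h1 h2 => hφ.integrableOn h1 h2, hφ.differentiableOn,
    fun z hz => hφ.integrable_inner hβ hc₁ hc₁' hc₂ hc₂' hB hz, ?_, ?_⟩
  · refine (hφ.integrable_doubleIntegrand hα hβ hc₁ hc₁' hc₂ hc₂' hB le_rfl zero_le_one).congr
      (.of_forall fun p => ?_)
    simp only [doubleIntegrand, cosKernel_zero]
    rfl
  · have h1 := hE.inversion hlam (α - β)
    simp only [← regularizedCos_zero] at h1
    rw [h1, hφ.limit_identity hα hβ hc₁ hc₁' hc₂ hc₂' hB,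
      hφ.integral_doubleIntegrand_eq hα hβ hc₁ hc₁' hc₂ hc₂' hB]
    rfl
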